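/- Let $R$ be a Noetherian commutative ring with a dualizing complex $\omega$, put $Y=\operatorname{Spec}R$, and let $A=\bigoplus_{i\in\mathbb Z}A_i$ be a Noetherian commutative $\mathbb Z$-graded $R$-algebra such that $A_0$ is finitely generated as an $R$-module. Let $I^+$ and $I^-$ be the ideals of $A$ generated by the homogeneous elements of positive, respectively negative, degree. Let $\mathrm{Gr}(A)$ be the category of $\mathbb Z$-graded $A$-modules with degree-preserving maps, $\mathcal D(\mathrm{Gr}(A))$ its derived category, and $\mathcal D_{\rm perf}(\mathrm{Gr}(A))\subset\mathcal D(\mathrm{Gr}(A))$ the full subcategory of objects isomorphic to bounded complexes of finitely generated projective graded modules. For a homogeneous ideal $I\subset A$, let $\mathcal D_{I^\infty\text{-Tor}}(\mathrm{Gr}(A))$ be the full subcategory of complexes in whose cohomology modules every element is killed by some power of $I$, and let $\mathcal D_{I\text{-triv}}(\mathrm{Gr}(A))$ be its right orthogonal, that is, the full subcategory of those $X$ with $\operatorname{Hom}(T,X)=0$ for all $T\in\mathcal D_{I^\infty\text{-Tor}}(\mathrm{Gr}(A))$. There is a semi-orthogonal decomposition $\mathcal D(\mathrm{Gr}(A))=\langle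 \mathcal D_{I\text{-triv}}(\mathrm{Gr}(A)),\mathcal D_{I^\infty\text{-Tor}}(\mathrm{Gr}(A))\rangle$; let $\mathbf R\Gamma_I$ be the right adjoint of the inclusion of $\mathcal D_{I^\infty\text{-Tor}}(\mathrm{Gr}(A))$ (regarded as an endofunctor of $\mathcal D(\mathrm{Gr}(A))$), and let $\check{\mathcal C}_I:\mathcal D(\mathrm{Gr}(A))\to\mathcal D_{I\text{-triv}}(\mathrm{Gr}(A))$ be the left adjoint of the inclusion of $\mathcal D_{I\text{-triv}}(\mathrm{Gr}(A))$. Let $\mathbb D_Y:\mathcal D(\mathrm{Gr}(A))^{\rm op}\to\mathcal D(\mathrm{Gr}(A))$ be the weight-degreewise dualizing functor, $\mathbb D_Y(M)_i=\mathbf R\mathrm{Hom}_R(M_{-i},\omega)$. Assume that there is an isomorphism $\mathbf R\Gamma_{I^+}(A)[1]\cong\mathbb D_Y(\mathbf R\Gamma_{I^-}(A))$ in $\mathcal D(\mathrm{Gr}(A))$. Then for every full triangulated subcategory $\mathcal E\subset\mathcal D_{\rm perf}(\mathrm{Gr}(A))$, the functor $\check{\mathcal C}_{I^+}|_{\mathcal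 E}:\mathcal E\to\mathcal D_{I^+\text{-triv}}(\mathrm{Gr}(A))$ is fully faithful if and only if the functor $\check{\mathcal C}_{I^-}|_{\mathcal E}:\mathcal E\to\mathcal D_{I^-\text{-triv}}(\mathrm{Gr}(A))$ is fully faithful. -/

import Mathlib

open CategoryTheory CategoryTheory.Limits Opposite Pretriangulated

universe u v

/-- A `ℤ`-graded module over the `ℤ`-graded `R`-algebra `A = ⨁ 𝒜 i`, given by its weight pieces
`X j` and by the action maps `𝒜 i × X j → X k` for `i + j = k`. The `R`-module structure of a
piece is the one through `R → 𝒜 0`, since `r • x = r • (1 x) = (r • 1) x`. -/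
structure GrMod {R A : Type u} [CommRing R] [CommRing A] [Algebra R A]
    (𝒜 : ℤ → Submodule R A) [GradedAlgebra 𝒜] where
  /-- the weight pieces -/
  X : ℤ → ModuleCat.{u} R
  /-- the action of homogeneous elements -/
  act : ∀ {i j k : ℤ}, i + j = k → (𝒜 i →ₗ[R] X j →ₗ[R] X k)
  one_act : ∀ {j : ℤ} (h : 0 + j = j) (a : 𝒜 0), (a : A) = 1 → ∀ x : X j, act h a x = x
  mul_act : ∀ {i j l m n p : ℤ} (h₁ : p + l = n) (h₂ : j + l = m) (h₃ : i + m = n)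
    (a : 𝒜 i) (b : 𝒜 j) (c : 𝒜 p), (c : A) = a * b →
    ∀ x : X l, act h₁ c x = act h₃ a (act h₂ b x)

namespace GrMod

variable {R A : Type u} [CommRing R] [CommRing A] [Algebra R A]
  {𝒜 : ℤ → Submodule R A} [GradedAlgebra 𝒜]

/-- Maps of graded modules of degree `0`. -/
@[ext]
structure Hom (M N : GrMod 𝒜) where
  /-- the weight components -/
  app : ∀ i, M.X i →ₗ[R] N.X i
  comm : ∀ {i j k : ℤ} (h : i + j = k) (a : 𝒜 i) (x : M.X j),
    app k (M.act h a x) = N.act h a (app j x)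

instance : Category (GrMod 𝒜) where
  Hom := Hom
  id M := { app := fun _ => LinearMap.id, comm := fun _ _ _ => rfl }
  comp f g :=
    { app := fun i => (g.app i).comp (f.app i)
      comm := fun h a x => by simp [f.comm, g.comm] }

@[ext]
lemma hom_ext {M N : GrMod 𝒜} {f g : M ⟶ N} (h : ∀ i (x : M.X i), f.app i x = g.app i x) :
    f = g :=
  Hom.ext (funext fun i => LinearMap.ext (h i))

@[simp] lemma id_app (M : GrMod 𝒜) (i : ℤ) (x : M.X i) : Hom.app (𝟙 M) i x = x := rfl

@[simp] lemma comp_app {M N P : GrMod 𝒜} (f : M ⟶ N) (g : N ⟶ P) (i : ℤ) (x : M.X i) :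
    Hom.app (f ≫ g) i x = g.app i (f.app i x) := rfl

lemma hom_comm {M N : GrMod 𝒜} (f : M ⟶ N) {i j k : ℤ} (h : i + j = k) (a : 𝒜 i)
    (x : M.X j) : f.app k (M.act h a x) = N.act h a (f.app j x) := f.comm h a x

section Preadditive
variable {M N : GrMod 𝒜}

instance : Zero (M ⟶ N) := ⟨{ app := fun _ => 0, comm := fun _ _ _ => by simp }⟩
instance : Add (M ⟶ N) :=
  ⟨fun f g => { app := fun i => f.app i + g.app i, comm := fun _ _ _ => by simp [hom_comm] }⟩
instance : Neg (M ⟶ N) :=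
  ⟨fun f => { app := fun i => -f.app i, comm := fun _ _ _ => by simp [hom_comm] }⟩
instance : Sub (M ⟶ N) :=
  ⟨fun f g => { app := fun i => f.app i - g.app i, comm := fun _ _ _ => by simp [hom_comm] }⟩
instance : SMul ℕ (M ⟶ N) :=
  ⟨fun n f => { app := fun i => n • f.app i, comm := fun _ _ _ => by simp [hom_comm] }⟩
instance : SMul ℤ (M ⟶ N) :=
  ⟨fun n f => { app := fun i => n • f.app i, comm := fun _ _ _ => by simp [hom_comm] }⟩

instance : AddCommGroup (M ⟶ N) :=
  Function.Injective.addCommGroup (fun f : M ⟶ N => f.app) (fun _ _ h => Hom.ext h)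
    rfl (fun _ _ => rfl) (fun _ => rfl) (fun _ _ => rfl) (fun _ _ => rfl) (fun _ _ => rfl)

@[simp] lemma zero_app (i : ℤ) (x : M.X i) : Hom.app (0 : M ⟶ N) i x = 0 := rfl
@[simp] lemma add_app (f g : M ⟶ N) (i : ℤ) (x : M.X i) :
    Hom.app (f + g) i x = f.app i x + g.app i x := rfl

end Preadditive

instance : Preadditive (GrMod 𝒜) where
  add_comp _ _ _ f g h := by ext; simp
  comp_add _ _ _ f g h := by ext; simp

/-- The zero graded module. -/
def zero : GrMod 𝒜 where
  X _ := ModuleCat.of R PUnit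
  act _ := 0
  one_act _ _ _ _ := rfl
  mul_act _ _ _ _ _ _ _ _ := rfl

instance : HasZeroObject (GrMod 𝒜) :=
  ⟨zero, (IsZero.iff_id_eq_zero _).2 (hom_ext fun _ _ => rfl)⟩

/-- The direct sum of two graded modules. -/
def prod (M N : GrMod 𝒜) : GrMod 𝒜 where
  X i := ModuleCat.of R (M.X i × N.X i)
  act {i j k} h := LinearMap.mk₂ R (fun a x => (M.act h a x.1, N.act h a x.2))
    (fun _ _ _ => by simp) (fun _ _ _ => by simp) (fun _ _ _ => by simp) (fun _ _ _ => by simp)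
  one_act h a ha x := Prod.ext (M.one_act h a ha x.1) (N.one_act h a ha x.2)
  mul_act h₁ h₂ h₃ a b c hc x :=
    Prod.ext (M.mul_act h₁ h₂ h₃ a b c hc x.1) (N.mul_act h₁ h₂ h₃ a b c hc x.2)

instance : HasBinaryBiproducts (GrMod 𝒜) where
  has_binary_biproduct M N := hasBinaryBiproduct_of_total
    { pt := prod M N
      fst := { app := fun i => LinearMap.fst R _ _, comm := fun _ _ _ => rfl }
      snd := { app := fun i => LinearMap.snd R _ _, comm := fun _ _ _ => rfl }
      inl := { app := fun i => LinearMap.inl R _ _,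
               comm := fun h a x => Prod.ext rfl (map_zero (N.act h a)).symm }
      inr := { app := fun i => LinearMap.inr R _ _,
               comm := fun h a x => Prod.ext (map_zero (M.act h a)).symm rfl }
      inl_fst := rfl
      inl_snd := rfl
      inr_fst := rfl
      inr_snd := rfl }
    (hom_ext fun _ x => Prod.ext (add_zero x.1) (zero_add x.2))

instance : HasFiniteProducts (GrMod 𝒜) := by
  have : HasBinaryProducts (GrMod 𝒜) := inferInstance
  exact hasFiniteProducts_of_has_binary_and_terminal

section Ker
variable {M N : GrMod 𝒜} (f : M ⟶ N)

/-- The weightwise kernel. -/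
def ker : GrMod 𝒜 where
  X i := ModuleCat.of R (LinearMap.ker (f.app i))
  act {i j k} h := LinearMap.mk₂ R (fun a x => ⟨M.act h a x.1, by
      have := x.2
      rw [LinearMap.mem_ker] at this ⊢
      rw [hom_comm, this, map_zero]⟩)
    (fun _ _ _ => by ext; simp) (fun _ _ _ => by ext; simp) (fun _ _ _ => by ext; simp)
    (fun _ _ _ => by ext; simp)
  one_act h a ha x := Subtype.ext (M.one_act h a ha x.1)
  mul_act h₁ h₂ h₃ a b c hc x := Subtype.ext (M.mul_act h₁ h₂ h₃ a b c hc x.1)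

/-- The inclusion of the kernel. -/
def kerι : ker f ⟶ M where
  app i := (LinearMap.ker (f.app i)).subtype
  comm _ _ _ := rfl

lemma kerι_comp : kerι f ≫ f = 0 := hom_ext fun i x => x.2

/-- The weightwise kernel is a kernel. -/
def kerIsLimit : IsLimit (KernelFork.ofι (kerι f) (kerι_comp f)) :=
  KernelFork.IsLimit.ofι _ _
    (fun g hg => { app := fun i => (g.app i).codRestrict _ (fun x => congr_arg (fun t => Hom.app t i x) hg)
                   comm := fun h a x => Subtype.ext (hom_comm g h a x) })
    (fun g hg => rfl)
    (fun g hg m hm => by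
      ext i x
      exact Subtype.ext (congr_arg (fun t => Hom.app t i x) hm))

instance : HasKernels (GrMod 𝒜) := ⟨fun f => ⟨_, kerIsLimit f⟩⟩

/-- The weightwise cokernel. -/
def coker : GrMod 𝒜 where
  X i := ModuleCat.of R (N.X i ⧸ LinearMap.range (f.app i))
  act {i j k} h :=
    { toFun := fun a => Submodule.mapQ _ _ (N.act h a) (by
        rintro _ ⟨x, rfl⟩
        exact ⟨M.act h a x, hom_comm f h a x⟩)
      map_add' := fun a b => by
        ext x
        simp
      map_smul' := fun r a => by
        ext x
        simp }
  one_act h a ha x := by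
    obtain ⟨x, rfl⟩ := Submodule.mkQ_surjective _ x
    exact congr_arg _ (N.one_act h a ha x)
  mul_act h₁ h₂ h₃ a b c hc x := by
    obtain ⟨x, rfl⟩ := Submodule.mkQ_surjective _ x
    exact congr_arg _ (N.mul_act h₁ h₂ h₃ a b c hc x)

/-- The projection to the cokernel. -/
def cokerπ : N ⟶ coker f where
  app i := (LinearMap.range (f.app i)).mkQ
  comm _ _ _ := rfl

lemma comp_cokerπ : f ≫ cokerπ f = 0 :=
  hom_ext fun i x => (Submodule.Quotient.mk_eq_zero _).2 ⟨x, rfl⟩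

/-- The weightwise cokernel is a cokernel. -/
def cokerIsColimit : IsColimit (CokernelCofork.ofπ (cokerπ f) (comp_cokerπ f)) :=
  CokernelCofork.IsColimit.ofπ _ _
    (fun {P} g hg =>
      { app := fun i => Submodule.liftQ _ (g.app i) (by
          rintro _ ⟨x, rfl⟩
          exact congr_arg (fun t => Hom.app t i x) hg)
        comm := fun {i j k} h a x => by
          obtain ⟨x, rfl⟩ := Submodule.mkQ_surjective _ x
          exact hom_comm g h a x })
    (fun g hg => rfl)
    (fun g hg m hm => by
      ext i x
      obtain ⟨x, rfl⟩ := Submodule.mkQ_surjective _ x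
      exact congr_arg (fun t => Hom.app t i x) hm)

instance : HasCokernels (GrMod 𝒜) := ⟨fun f => ⟨_, cokerIsColimit f⟩⟩

lemma injective_of_mono [Mono f] (i : ℤ) : Function.Injective (f.app i) := by
  have h : kerι f = 0 := by rw [← cancel_mono f, kerι_comp, zero_comp]
  rw [injective_iff_map_eq_zero]
  intro x hx
  exact congr_arg (fun t => Hom.app t i (⟨x, hx⟩ : LinearMap.ker (f.app i))) h

lemma surjective_of_epi [Epi f] (i : ℤ) : Function.Surjective (f.app i) := by
  have h : cokerπ f = 0 := by rw [← cancel_epi f, comp_cokerπ, comp_zero]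
  intro y
  exact (Submodule.Quotient.mk_eq_zero _).1 (congr_arg (fun t => Hom.app t i y) h)

/-- The inverse of a weightwise bijective map. -/
noncomputable def isoOfBijective (hf : ∀ i, Function.Bijective (f.app i)) : M ≅ N where
  hom := f
  inv :=
    { app := fun i => (LinearEquiv.ofBijective (f.app i) (hf i)).symm
      comm := fun {i j k} h a x => by
        apply (hf k).1
        obtain ⟨x, rfl⟩ := (hf j).2 x
        rw [hom_comm]
        erw [LinearEquiv.apply_symm_apply (LinearEquiv.ofBijective (f.app k) (hf k)),
          LinearEquiv.symm_apply_apply (LinearEquiv.ofBijective (f.app j) (hf j))] }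
  hom_inv_id := by
    ext i x
    exact LinearEquiv.symm_apply_apply (LinearEquiv.ofBijective (f.app i) (hf i)) x
  inv_hom_id := by
    ext i x
    exact LinearEquiv.apply_symm_apply (LinearEquiv.ofBijective (f.app i) (hf i)) x

lemma isIso_of_bijective (hf : ∀ i, Function.Bijective (f.app i)) : IsIso f :=
  (isoOfBijective f hf).isIso_hom

end Ker

noncomputable instance : Abelian (GrMod 𝒜) where
  normalMonoOfMono {M N} f hf := ⟨
    { Z := coker f
      g := cokerπ f
      w := comp_cokerπ f
      isLimit := IsKernel.isoKernel _ _ (kerIsLimit (cokerπ f))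
        (isoOfBijective
          (KernelFork.IsLimit.lift' (kerIsLimit (cokerπ f)) f (comp_cokerπ f)).1 (fun i => by
            constructor
            · intro x y hxy
              exact injective_of_mono f i (congr_arg Subtype.val hxy)
            · rintro ⟨y, hy⟩
              obtain ⟨x, rfl⟩ := (Submodule.Quotient.mk_eq_zero _).1 hy
              exact ⟨x, rfl⟩)) rfl }⟩
  normalEpiOfEpi {M N} f hf := ⟨
    { W := ker f
      g := kerι f
      w := kerι_comp f
      isColimit := IsCokernel.cokernelIso _ _ (cokerIsColimit (kerι f))
        (isoOfBijective
          (CokernelCofork.IsColimit.desc' (cokerIsColimit (kerι f)) f (kerι_comp f)).1 (fun i => by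
            constructor
            · rw [injective_iff_map_eq_zero]
              intro x hx
              obtain ⟨x, rfl⟩ := Submodule.mkQ_surjective _ x
              exact (Submodule.Quotient.mk_eq_zero _).2 ⟨⟨x, hx⟩, rfl⟩
            · intro y
              obtain ⟨x, rfl⟩ := surjective_of_epi f i y
              exact ⟨Submodule.mkQ _ x, rfl⟩)) rfl }⟩

end GrMod

namespace GrMod

variable {R A : Type u} [CommRing R] [CommRing A] [Algebra R A]
  {𝒜 : ℤ → Submodule R A} [GradedAlgebra 𝒜]

lemma act_congr (M : GrMod 𝒜) {i i' j k : ℤ} (h : i + j = k) (h' : i' + j = k)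
    (a : 𝒜 i) (a' : 𝒜 i') (ha : (a : A) = a') (x : M.X j) : M.act h a x = M.act h' a' x := by
  obtain rfl : i = i' := by lia
  obtain rfl : a = a' := Subtype.ext ha
  rfl

lemma act_act (M : GrMod 𝒜) {i j l m n p : ℤ} (h₂ : j + l = m) (h₃ : i + m = n)
    (h₁ : p + l = n) (a : 𝒜 i) (b : 𝒜 j) (c : 𝒜 p) (hc : (a * b : A) = c) (x : M.X l) :
    M.act h₃ a (M.act h₂ b x) = M.act h₁ c x :=
  (M.mul_act h₁ h₂ h₃ a b c hc.symm x).symm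

lemma isZero_iff (M : GrMod 𝒜) : IsZero M ↔ ∀ i (x : M.X i), x = 0 :=
  ⟨fun h i x => congr_arg (fun t => Hom.app t i x) ((IsZero.iff_id_eq_zero _).1 h),
    fun h => (IsZero.iff_id_eq_zero _).2 (hom_ext h)⟩

/-- Homology of a short complex of graded modules is computed weightwise. -/
def leftHomologyData (S : ShortComplex (GrMod 𝒜)) : S.LeftHomologyData where
  K := ker S.g
  H := coker ((kerIsLimit S.g).lift (KernelFork.ofι S.f S.zero))
  i := kerι S.g
  π := cokerπ _
  wi := kerι_comp S.g
  hi := kerIsLimit S.g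
  wπ := comp_cokerπ _
  hπ := cokerIsColimit _

lemma exact_iff (S : ShortComplex (GrMod 𝒜)) :
    S.Exact ↔ ∀ i (x : S.X₂.X i), S.g.app i x = 0 → ∃ y, S.f.app i y = x := by
  rw [(leftHomologyData S).exact_iff, isZero_iff]
  constructor
  · intro h i x hx
    obtain ⟨y, hy⟩ := (Submodule.Quotient.mk_eq_zero _).1
      (h i (Submodule.mkQ _ (⟨x, hx⟩ : LinearMap.ker (S.g.app i))))
    exact ⟨y, congr_arg Subtype.val hy⟩
  · intro h i x
    obtain ⟨⟨x, hx⟩, rfl⟩ := Submodule.mkQ_surjective _ x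
    obtain ⟨y, rfl⟩ := h i x hx
    exact (Submodule.Quotient.mk_eq_zero _).2 ⟨y, rfl⟩

section Loc
variable {d : ℤ} (f : 𝒜 d)

/-- The powers of a homogeneous element. -/
def pw (k : ℕ) : 𝒜 (k * d) :=
  ⟨(f : A) ^ k, by simpa using SetLike.pow_mem_graded k f.2⟩

@[simp] lemma pw_val (k : ℕ) : (pw f k : A) = (f : A) ^ k := rfl

/-- Multiplication by `f ^ (l - k)`. -/
def trans (M : GrMod 𝒜) (n : ℤ) (k l : ℕ) (h : k ≤ l) :
    M.X (n + k * d) →ₗ[R] M.X (n + l * d) :=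
  M.act (by push_cast [h]; ring) (pw f (l - k))

instance (M : GrMod 𝒜) (n : ℤ) :
    DirectedSystem (fun k : ℕ => M.X (n + k * d)) (fun k l h => trans f M n k l h) where
  map_self k x := M.act_congr (i' := 0) _ (zero_add _) _ ⟨1, SetLike.one_mem_graded 𝒜⟩ (by simp) x
    |>.trans (M.one_act _ _ rfl x)
  map_map k l m hkl hlm x := by
    refine M.act_act _ _ _ _ _ _ ?_ x
    simp only [pw_val, ← pow_add]
    congr 1
    lia

/-- The weight `n` piece of `M_f`, the direct limit of `M_n → M_{n + d} → M_{n + 2 d} → ⋯`. -/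
abbrev locX (M : GrMod 𝒜) (n : ℤ) : Type u :=
  Module.DirectLimit (fun k : ℕ => M.X (n + k * d)) (trans f M n)

/-- The fraction `x / f ^ k`. -/
noncomputable abbrev frac (M : GrMod 𝒜) (n : ℤ) (k : ℕ) : M.X (n + k * d) →ₗ[R] locX f M n :=
  Module.DirectLimit.of R ℕ (fun k : ℕ => M.X (n + k * d)) (trans f M n) k

lemma frac_trans (M : GrMod 𝒜) (n : ℤ) {k l : ℕ} (h : k ≤ l) (x : M.X (n + k * d)) :
    frac f M n l (trans f M n k l h x) = frac f M n k x :=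
  Module.DirectLimit.of_f

lemma exists_frac (M : GrMod 𝒜) (n : ℤ) (z : locX f M n) : ∃ k x, frac f M n k x = z :=
  Module.DirectLimit.exists_of z

lemma frac_eq_zero_iff (M : GrMod 𝒜) (n : ℤ) (k : ℕ) (x : M.X (n + k * d)) :
    frac f M n k x = 0 ↔ ∃ l, ∃ h : k ≤ l, trans f M n k l h x = 0 := by
  constructor
  · intro h
    obtain ⟨l, hl, h⟩ := Module.DirectLimit.of.zero_exact h
    exact ⟨l, hl, h⟩
  · rintro ⟨l, h, hx⟩
    rw [← frac_trans f M n h, hx, map_zero]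

lemma act_trans (M : GrMod 𝒜) {i j k : ℤ} (h : i + j = k) (a : 𝒜 i) (p q : ℕ) (hpq : p ≤ q)
    (x : M.X (j + p * d)) :
    M.act (by rw [← h, add_assoc]) a (trans f M j p q hpq x) =
      trans f M k p q hpq (M.act (by rw [← h, add_assoc]) a x) :=
  (M.act_act _ _ (p := i + (q - p : ℕ) * d) (by push_cast [hpq]; lia) _ _
    ⟨a * (f : A) ^ (q - p), SetLike.mul_mem_graded a.2 (pw f (q - p)).2⟩ rfl x).trans
    (M.act_act _ _ _ _ _ _ (mul_comm _ _) x).symm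

/-- The action on `M_f`. -/
noncomputable def locAct (M : GrMod 𝒜) {i j k : ℤ} (h : i + j = k) :
    𝒜 i →ₗ[R] locX f M j →ₗ[R] locX f M k where
  toFun a := Module.DirectLimit.map (fun m => M.act (by rw [← h, add_assoc]) a)
    (fun p q hpq => LinearMap.ext (act_trans f M h a p q hpq))
  map_add' a b := by
    apply Module.DirectLimit.hom_ext
    intro m
    ext x
    simp
  map_smul' r a := by
    apply Module.DirectLimit.hom_ext
    intro m
    ext x
    simp

lemma locAct_frac (M : GrMod 𝒜) {i j k : ℤ} (h : i + j = k) (a : 𝒜 i) (m : ℕ)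
    (x : M.X (j + m * d)) :
    locAct f M h a (frac f M j m x) = frac f M k m (M.act (by rw [← h, add_assoc]) a x) :=
  Module.DirectLimit.map_apply_of _ (fun p q hpq => LinearMap.ext (act_trans f M h a p q hpq)) x

/-- The localization `M_f` of a graded module at a homogeneous element. -/
noncomputable def locObj (M : GrMod 𝒜) : GrMod 𝒜 where
  X n := ModuleCat.of R (locX f M n)
  act h := locAct f M h
  one_act {j} h a ha x := by
    obtain ⟨k, x, rfl⟩ := exists_frac f M j x
    exact (locAct_frac f M h a k x).trans (congr_arg _ (M.one_act _ a ha x))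
  mul_act {i j l m n p} h₁ h₂ h₃ a b c hc x := by
    obtain ⟨k, x, rfl⟩ := exists_frac f M l x
    rw [locAct_frac, locAct_frac, locAct_frac]
    exact congr_arg _ (M.mul_act _ _ _ a b c hc x)

lemma app_trans {M N : GrMod 𝒜} (φ : M ⟶ N) (n : ℤ) (k l : ℕ) (h : k ≤ l) :
    φ.app (n + l * d) ∘ₗ trans f M n k l h = trans f N n k l h ∘ₗ φ.app (n + k * d) :=
  LinearMap.ext fun x => hom_comm φ _ _ x

/-- The weight `n` piece of the map on localizations. -/
noncomputable def locMapX {M N : GrMod 𝒜} (φ : M ⟶ N) (n : ℤ) : locX f M n →ₗ[R] locX f N n :=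
  Module.DirectLimit.map (fun k : ℕ => φ.app (n + k * d)) (app_trans f φ n)

lemma locMapX_frac {M N : GrMod 𝒜} (φ : M ⟶ N) (n : ℤ) (k : ℕ) (x : M.X (n + k * d)) :
    locMapX f φ n (frac f M n k x) = frac f N n k (φ.app _ x) :=
  Module.DirectLimit.map_apply_of (fun k : ℕ => φ.app (n + k * d)) (app_trans f φ n) x

/-- The map on localizations induced by a map of graded modules. -/
noncomputable def locMap {M N : GrMod 𝒜} (φ : M ⟶ N) : locObj f M ⟶ locObj f N where
  app n := locMapX f φ n
  comm {i j k} h a x := by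
    obtain ⟨m, x, rfl⟩ := exists_frac f M j x
    change locMapX f φ k (locAct f M h a _) = locAct f N h a (locMapX f φ j _)
    rw [locAct_frac, locMapX_frac, locMapX_frac, locAct_frac, hom_comm]

lemma locMap_frac {M N : GrMod 𝒜} (φ : M ⟶ N) (n : ℤ) (k : ℕ) (x : M.X (n + k * d)) :
    (locMap f φ).app n (frac f M n k x) = frac f N n k (φ.app _ x) :=
  locMapX_frac f φ n k x

/-- Localization at a homogeneous element, as a functor. -/
noncomputable def loc : GrMod 𝒜 ⥤ GrMod 𝒜 where
  obj := locObj f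
  map := locMap f
  map_id M := by
    ext n x
    obtain ⟨k, x, rfl⟩ := exists_frac f M n x
    exact locMap_frac f _ n k x
  map_comp {M N P} φ ψ := by
    ext n x
    obtain ⟨k, x, rfl⟩ := exists_frac f M n x
    change locMapX f (φ ≫ ψ) n (frac f M n k x) = locMapX f ψ n (locMapX f φ n (frac f M n k x))
    rw [locMapX_frac, locMapX_frac, locMapX_frac, comp_app]

instance : (loc f).Additive where
  map_add {M N φ ψ} := by
    ext n x
    obtain ⟨k, x, rfl⟩ := exists_frac f M n x
    change (locMap f (φ + ψ)).app _ _ = (locMap f φ).app _ _ + (locMap f ψ).app _ _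
    rw [locMap_frac, locMap_frac, locMap_frac, add_app]
    exact map_add (frac f N n k) _ _

lemma loc_exact (S : ShortComplex (GrMod 𝒜)) (hS : S.Exact) : (S.map (loc f)).Exact := by
  rw [exact_iff] at hS ⊢
  intro n x hx
  obtain ⟨k, x, rfl⟩ := exists_frac f S.X₂ n x
  obtain ⟨l, hl, h⟩ := (frac_eq_zero_iff f _ _ _ _).1 ((locMap_frac f S.g n k x).symm.trans hx)
  obtain ⟨y, hy⟩ := hS _ (trans f _ n k l hl x) ((hom_comm S.g _ _ x).trans h)
  refine ⟨frac f _ n l y, (locMap_frac f S.f n l y).trans ?_⟩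
  rw [hy, frac_trans]

instance : PreservesFiniteLimits (loc (𝒜 := 𝒜) f) :=
  by
  have := ((loc (𝒜 := 𝒜) f).exact_tfae.out 1 3).1 (loc_exact f)
  exact this.1

instance : PreservesFiniteColimits (loc (𝒜 := 𝒜) f) :=
  by
  have := ((loc (𝒜 := 𝒜) f).exact_tfae.out 1 3).1 (loc_exact f)
  exact this.2

/-- The localization map `M → M_f`. -/
noncomputable def η (M : GrMod 𝒜) : M ⟶ locObj f M where
  app n := (frac f M n 0).comp (M.act (by simp) (pw f 0))
  comm {i j k} h a x := by
    change _ = locAct f M h a (frac f M j 0 _)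
    rw [locAct_frac]
    refine congr_arg (frac f M k 0) ?_
    exact (M.act_act _ _ (p := i) (by simpa using h) _ _ a (by simp) x).trans
      (M.act_act _ _ _ _ _ _ (by simp) x).symm

lemma η_app (M : GrMod 𝒜) (n : ℤ) (x : M.X n) (k : ℕ) :
    (η f M).app n x = frac f M n k (M.act (add_comm _ _) (pw f k) x) := by
  change frac f M n 0 _ = _
  rw [← frac_trans f M n (Nat.zero_le k)]
  exact congr_arg _ (M.act_act _ _ _ _ _ _ (by simp) x)

/-- The localization map is natural. -/
noncomputable def ηNat : 𝟭 (GrMod 𝒜) ⟶ loc f where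
  app := η f
  naturality M N φ := by
    ext n x
    change (η f N).app n (φ.app n x) = (locMap f φ).app n ((η f M).app n x)
    rw [η_app f _ _ _ 0, η_app f _ _ _ 0, locMap_frac, hom_comm]

lemma locAct_pw (M : GrMod 𝒜) (n : ℤ) (k : ℕ) (x : M.X (n + k * d)) :
    locAct f M (add_comm _ _) (pw f k) (frac f M n k x) = (η f M).app (n + k * d) x := by
  rw [locAct_frac, η_app f M _ _ k]

lemma loc_η (M : GrMod 𝒜) : locMap f (η f M) = η f (locObj f M) := by
  ext n x
  obtain ⟨k, x, rfl⟩ := exists_frac f M n x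
  refine (locMap_frac f (η f M) n k x).trans (Eq.trans ?_ (η_app f (locObj f M) n _ k).symm)
  exact congr_arg _ (locAct_pw f M n k x).symm

lemma η_bijective (N : GrMod 𝒜)
    (h : ∀ (n : ℤ) (k : ℕ), Function.Bijective
      (N.act (add_comm _ _ : (k : ℤ) * d + n = n + k * d) (pw f k))) (n : ℤ) :
    Function.Bijective ((η f N).app n) := by
  constructor
  · rw [injective_iff_map_eq_zero]
    intro x hx
    rw [η_app f N n x 0] at hx
    obtain ⟨l, hl, hx⟩ := (frac_eq_zero_iff f _ _ _ _).1 hx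
    refine (injective_iff_map_eq_zero _).1 (h n l).1 x (Eq.trans ?_ hx)
    exact (N.act_act _ _ _ _ _ _ (by simp) x).symm
  · intro z
    obtain ⟨k, x, rfl⟩ := exists_frac f N n z
    obtain ⟨y, rfl⟩ := (h n k).2 x
    exact ⟨y, η_app f N n y k⟩

lemma locAct_bijective (M : GrMod 𝒜) (n : ℤ) (k : ℕ) : Function.Bijective
    (locAct f M (add_comm _ _ : (k : ℤ) * d + n = n + k * d) (pw f k)) := by
  constructor
  · rw [injective_iff_map_eq_zero]
    intro x hx
    obtain ⟨l, x, rfl⟩ := exists_frac f M n x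
    rw [locAct_frac, frac_eq_zero_iff] at hx
    obtain ⟨m, hm, hx⟩ := hx
    rw [frac_eq_zero_iff]
    refine ⟨m + k, by lia, ?_⟩
    have := congr_arg (M.act (i := 0) (k := n + (m + k : ℕ) * d) (by push_cast; ring)
      ⟨1, SetLike.one_mem_graded 𝒜⟩) hx
    rw [map_zero] at this
    refine Eq.trans ?_ this
    unfold trans
    rw [M.act_act _ _ (p := (m - l : ℕ) * d) (by push_cast [hm]; ring) _ _ (pw f (m - l)) (by simp),
      M.act_act _ _ (p := (m - l : ℕ) * d + k * d) (by push_cast [hm]; ring) _ _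
      ⟨(f : A) ^ (m - l) * f ^ k, SetLike.mul_mem_graded (pw f _).2 (pw f _).2⟩ rfl]
    refine M.act_congr _ _ _ _ ?_ x
    simp only [pw_val, ← pow_add]
    congr 1
    lia
  · intro z
    obtain ⟨l, x, rfl⟩ := exists_frac f M (n + k * d) z
    refine ⟨frac f M n (k + l) (M.act (i := 0) (by push_cast; ring)
      ⟨1, SetLike.one_mem_graded 𝒜⟩ x), ?_⟩
    rw [locAct_frac, ← frac_trans f M (n + k * d) (Nat.le_add_left l k) x]
    refine congr_arg _ ?_
    refine (M.act_act _ _ (p := k * d) (by push_cast; ring) _ _ (pw f k) (by simp) x).trans ?_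
    exact M.act_congr _ _ _ _ (by simp) x

instance (M : GrMod 𝒜) : IsIso (η f (locObj f M)) :=
  isIso_of_bijective _ (η_bijective f _ (locAct_bijective f M))

/-- `M_f = 0` if and only if every element of `M` is killed by a power of `f`. -/
lemma isZero_loc_iff (M : GrMod 𝒜) :
    IsZero ((loc f).obj M) ↔ ∀ (n : ℤ) (x : M.X n), ∃ k : ℕ, M.act rfl (pw f k) x = 0 := by
  rw [isZero_iff]
  constructor
  · intro h n x
    obtain ⟨k, hk, hx⟩ := (frac_eq_zero_iff f M n 0 _).1 (h n ((η f M).app n x))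
    refine ⟨k, ?_⟩
    have := congr_arg (M.act (i := 0) (k := k * d + n) (by ring)
      ⟨1, SetLike.one_mem_graded 𝒜⟩) hx
    rw [map_zero] at this
    refine Eq.trans ?_ this
    unfold trans
    rw [M.act_act _ _ (p := k * d) (by ring) _ _ (pw f k) (by simp),
      M.act_act _ _ (p := k * d) rfl _ _ (pw f k) (by simp)]
  · intro h n z
    obtain ⟨l, x, rfl⟩ := exists_frac f M n z
    obtain ⟨k, hx⟩ := h _ x
    refine (frac_eq_zero_iff f M n l x).2 ⟨k + l, by lia, ?_⟩
    have := congr_arg (M.act (i := 0) (k := n + (k + l : ℕ) * d) (by push_cast; ring)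
      ⟨1, SetLike.one_mem_graded 𝒜⟩) hx
    rw [map_zero] at this
    refine Eq.trans ?_ this
    rw [M.act_act _ _ (p := k * d) (by push_cast; ring) _ _ (pw f k) (by simp)]
    exact M.act_congr _ _ _ _ (by simp) x

end Loc
end GrMod

namespace GrMod

variable {R A : Type u} [CommRing R] [CommRing A] [Algebra R A]
  {𝒜 : ℤ → Submodule R A} [GradedAlgebra 𝒜]

/-- `M` is `I^∞`-torsion: every homogeneous element is killed by some power of `I`. -/
def IsTorsion (I : Ideal A) (M : GrMod 𝒜) : Prop :=
  ∀ (j : ℤ) (x : M.X j), ∃ n : ℕ, ∀ (i : ℤ) (a : 𝒜 i), (a : A) ∈ I ^ n → M.act rfl a x = 0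

/-- The ideal of elements all of whose homogeneous components kill `x`. -/
def annih (M : GrMod 𝒜) {j : ℤ} (x : M.X j) : Ideal A where
  carrier := {a | ∀ i, M.act rfl (DirectSum.decompose 𝒜 a i) x = 0}
  zero_mem' i := by simp
  add_mem' {a b} ha hb i := by
    rw [DirectSum.decompose_add, DirectSum.add_apply, map_add, LinearMap.add_apply, ha i, hb i,
      add_zero]
  smul_mem' b a ha := by
    change ∀ i, _
    induction b using DirectSum.Decomposition.inductionOn 𝒜 with
    | zero => intro i; simp
    | add b c hb hc =>
      intro i
      rw [smul_eq_mul] at hb hc ⊢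
      rw [add_mul, DirectSum.decompose_add, DirectSum.add_apply, map_add, LinearMap.add_apply,
        hb i, hc i, add_zero]
    | homogeneous b =>
      rename_i m
      intro i
      have h := DirectSum.coe_decompose_mul_add_of_left_mem 𝒜 (j := i - m) b.2 (b := a)
      obtain ⟨k, rfl⟩ : ∃ k, i = m + k := ⟨i - m, by ring⟩
      rw [add_sub_cancel_left] at h
      refine (M.mul_act rfl rfl (add_assoc m k j).symm b (DirectSum.decompose 𝒜 a k) _ h x).trans ?_
      rw [ha k, map_zero]

lemma mem_annih (M : GrMod 𝒜) {i j : ℤ} (x : M.X j) (a : 𝒜 i) :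
    (a : A) ∈ annih M x ↔ M.act rfl a x = 0 := by
  constructor
  · intro h
    have := h i
    rwa [DirectSum.decompose_coe, DirectSum.of_eq_same] at this
  · intro h k
    rw [DirectSum.decompose_coe]
    by_cases hk : i = k
    · subst hk
      rwa [DirectSum.of_eq_same]
    · rw [DirectSum.of_eq_of_ne _ _ _ (Ne.symm hk), map_zero, LinearMap.zero_apply]

/-- Torsion with respect to an ideal generated by finitely many homogeneous elements. -/
lemma isTorsion_span_iff (l : List (Σ d, 𝒜 d)) (M : GrMod 𝒜) :
    IsTorsion (Ideal.span {a : A | ∃ f ∈ l, (f.2 : A) = a}) M ↔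
      ∀ f ∈ l, IsZero ((loc f.2).obj M) := by
  simp only [isZero_loc_iff]
  constructor
  · intro h f hf n x
    obtain ⟨k, hk⟩ := h n x
    have hf' : (f.2 : A) ∈ Ideal.span {a : A | ∃ f ∈ l, (f.2 : A) = a} :=
      Ideal.subset_span ⟨f, hf, rfl⟩
    exact ⟨k, hk _ (pw f.2 k) (Ideal.pow_mem_pow hf' k)⟩
  · intro h j x
    have hfg : (Ideal.span {a : A | ∃ f ∈ l, (f.2 : A) = a}).FG := by
      refine Submodule.fg_span ?_
      refine (l.map (fun f => (f.2 : A))).finite_toSet.subset ?_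
      rintro a ⟨f, hf, rfl⟩
      exact List.mem_map.2 ⟨f, hf, rfl⟩
    obtain ⟨n, hn⟩ := Ideal.exists_pow_le_of_le_radical_of_fg (J := annih M x) (by
      rw [Ideal.span_le]
      rintro a ⟨f, hf, rfl⟩
      obtain ⟨k, hk⟩ := h f hf j x
      exact ⟨k, (mem_annih M x (pw f.2 k)).2 hk⟩) hfg
    exact ⟨n, fun i a ha => (mem_annih M x a).1 (hn ha)⟩

/-- A homogeneous ideal of a Noetherian graded ring has finitely many homogeneous generators. -/
lemma exists_generators [IsNoetherianRing A] (I : HomogeneousIdeal 𝒜) :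
    ∃ l : List (Σ d, 𝒜 d), I.toIdeal = Ideal.span {a : A | ∃ f ∈ l, (f.2 : A) = a} := by
  obtain ⟨S, hS⟩ := (Ideal.IsHomogeneous.iff_exists 𝒜 _).1 I.isHomogeneous
  obtain ⟨t, hts, ht⟩ := (Submodule.fg_span_iff_fg_span_finset_subset (R := A)
    (Subtype.val '' S)).1 (IsNoetherian.noetherian _)
  choose d hd using fun a : t => (show SetLike.IsHomogeneousElem 𝒜 (a : A) from by
    obtain ⟨b, _, hb⟩ := hts a.2
    rw [← hb]
    exact b.2)
  refine ⟨t.attach.toList.map (fun a => ⟨d a, ⟨a, hd a⟩⟩), ?_⟩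
  rw [hS, Ideal.span, ht]
  congr 1
  ext a
  constructor
  · intro ha
    exact ⟨⟨d ⟨a, ha⟩, ⟨a, hd ⟨a, ha⟩⟩⟩, List.mem_map.2 ⟨⟨a, ha⟩, by simp, rfl⟩, rfl⟩
  · rintro ⟨f, hf, rfl⟩
    obtain ⟨b, _, rfl⟩ := List.mem_map.1 hf
    exact b.2

noncomputable instance : HasDerivedCategory (GrMod 𝒜) := HasDerivedCategory.standard _

lemma derived_isZero_iff (X : DerivedCategory (GrMod 𝒜)) :
    IsZero X ↔ ∀ n, IsZero ((DerivedCategory.homologyFunctor (GrMod 𝒜) n).obj X) := by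
  constructor
  · intro h n
    exact (DerivedCategory.homologyFunctor (GrMod 𝒜) n).map_isZero h
  · intro h
    have hz := isZero_zero (DerivedCategory (GrMod 𝒜))
    have : IsIso (hz.from_ X) := by
      rw [DerivedCategory.isIso_iff]
      intro n
      exact isIso_of_isTerminal (h n).isTerminal
        ((DerivedCategory.homologyFunctor (GrMod 𝒜) n).map_isZero hz).isTerminal _
    exact hz.of_iso (asIso (hz.from_ X))

section
variable {d : ℤ} (f : 𝒜 d)

/-- Localization at `f` on the derived category. -/
noncomputable abbrev locD : DerivedCategory (GrMod 𝒜) ⥤ DerivedCategory (GrMod 𝒜) :=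
  (loc f).mapDerivedCategory

lemma exists_locD_homology_iso (X : DerivedCategory (GrMod 𝒜)) (n : ℤ) :
    Nonempty ((DerivedCategory.homologyFunctor (GrMod 𝒜) n).obj ((locD f).obj X) ≅
      (loc f).obj ((DerivedCategory.homologyFunctor (GrMod 𝒜) n).obj X)) := by
  let K := DerivedCategory.Q.objPreimage X
  let e : DerivedCategory.Q.obj K ≅ X := DerivedCategory.Q.objObjPreimageIso X
  let H := DerivedCategory.homologyFunctor (GrMod 𝒜) n
  exact ⟨H.mapIso ((locD f).mapIso e.symm) ≪≫
    H.mapIso ((loc f).mapDerivedCategoryFactors.app K) ≪≫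
    (DerivedCategory.homologyFunctorFactors (GrMod 𝒜) n).app _ ≪≫
    (K.sc n).mapHomologyIso (loc f) ≪≫
    (loc f).mapIso ((DerivedCategory.homologyFunctorFactors (GrMod 𝒜) n).app K).symm ≪≫
    (loc f).mapIso (H.mapIso e)⟩

lemma isZero_locD_iff (X : DerivedCategory (GrMod 𝒜)) :
    IsZero ((locD f).obj X) ↔
      ∀ n, IsZero ((loc f).obj ((DerivedCategory.homologyFunctor (GrMod 𝒜) n).obj X)) := by
  rw [derived_isZero_iff]
  exact forall_congr' fun n => (exists_locD_homology_iso f X n).some.isZero_iff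

lemma isZero_loc_loc {e : ℤ} (g : 𝒜 e) (M : GrMod 𝒜) (h : IsZero ((loc g).obj M)) :
    IsZero ((loc g).obj ((loc f).obj M)) := by
  rw [isZero_loc_iff] at h ⊢
  intro n x
  obtain ⟨k, x, rfl⟩ := exists_frac f M n x
  obtain ⟨l, hl⟩ := h _ x
  refine ⟨l, (locAct_frac f M rfl _ k x).trans ?_⟩
  have := congr_arg (M.act (i := 0) (k := l * e + n + k * d) (by ring)
      ⟨1, SetLike.one_mem_graded 𝒜⟩) hl
  rw [map_zero, M.act_act _ _ (p := l * e) (by ring) _ _ (pw g l) (by simp)] at this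
  exact (congr_arg _ this).trans (map_zero _)

lemma isZero_locD_locD {e : ℤ} (g : 𝒜 e) (X : DerivedCategory (GrMod 𝒜))
    (h : IsZero ((locD g).obj X)) : IsZero ((locD g).obj ((locD f).obj X)) := by
  rw [isZero_locD_iff] at h ⊢
  intro n
  exact ((loc g).mapIso (exists_locD_homology_iso f X n).some).isZero_iff.2
    (isZero_loc_loc f g _ (h n))

/-- The localization map of complexes. -/
noncomputable def ηC : 𝟭 (CochainComplex (GrMod 𝒜) ℤ) ⟶
    (loc f).mapHomologicalComplex (ComplexShape.up ℤ) where
  app K := { f := fun n => η f (K.X n), comm' := fun i j _ => ((ηNat f).naturality (K.d i j)).symm }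
  naturality K L φ := by
    ext n : 1
    exact (ηNat f).naturality (φ.f n)

noncomputable instance : Localization.Lifting DerivedCategory.Q
    (HomologicalComplex.quasiIso (GrMod 𝒜) (ComplexShape.up ℤ))
    (𝟭 (CochainComplex (GrMod 𝒜) ℤ) ⋙ DerivedCategory.Q) (𝟭 (DerivedCategory (GrMod 𝒜))) :=
  ⟨Iso.refl _⟩

/-- The localization map on the derived category. -/
noncomputable def ηD : 𝟭 (DerivedCategory (GrMod 𝒜)) ⟶ locD f :=
  Localization.liftNatTrans DerivedCategory.Q
    (HomologicalComplex.quasiIso (GrMod 𝒜) (ComplexShape.up ℤ))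
    (𝟭 (CochainComplex (GrMod 𝒜) ℤ) ⋙ DerivedCategory.Q)
    ((loc f).mapHomologicalComplex (ComplexShape.up ℤ) ⋙ DerivedCategory.Q) _ _
    (Functor.whiskerRight (ηC f) DerivedCategory.Q)

lemma ηD_Q (K : CochainComplex (GrMod 𝒜) ℤ) :
    (ηD f).app (DerivedCategory.Q.obj K) =
      DerivedCategory.Q.map ((ηC f).app K) ≫ (loc f).mapDerivedCategoryFactors.inv.app K := by
  refine (Localization.liftNatTrans_app ..).trans ?_
  exact Category.id_comp _

instance (K : CochainComplex (GrMod 𝒜) ℤ) :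
    IsIso ((ηC f).app (((loc f).mapHomologicalComplex (ComplexShape.up ℤ)).obj K)) := by
  have : ∀ n, IsIso (((ηC f).app (((loc f).mapHomologicalComplex
      (ComplexShape.up ℤ)).obj K)).f n) := fun n =>
    inferInstanceAs (IsIso (η f (locObj f (K.X n))))
  exact HomologicalComplex.Hom.isIso_of_components _

instance (X : DerivedCategory (GrMod 𝒜)) : IsIso ((ηD f).app ((locD f).obj X)) := by
  let K := DerivedCategory.Q.objPreimage X
  let e : (locD f).obj X ≅ DerivedCategory.Q.obj
      (((loc f).mapHomologicalComplex (ComplexShape.up ℤ)).obj K) :=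
    (locD f).mapIso (DerivedCategory.Q.objObjPreimageIso X).symm ≪≫
      (loc f).mapDerivedCategoryFactors.app K
  rw [NatTrans.isIso_app_iff_of_iso (ηD f) e, ηD_Q]
  infer_instance

instance (X : DerivedCategory (GrMod 𝒜)) : IsIso ((locD f).map ((ηD f).app X)) := by
  let K := DerivedCategory.Q.objPreimage X
  let e : DerivedCategory.Q.obj K ≅ X := DerivedCategory.Q.objObjPreimageIso X
  have h1 : IsIso (((loc f).mapHomologicalComplex (ComplexShape.up ℤ)).map ((ηC f).app K)) := by
    have : ∀ n, IsIso ((((loc f).mapHomologicalComplex (ComplexShape.up ℤ)).map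
        ((ηC f).app K)).f n) := fun n => by
      change IsIso (locMap f (η f (K.X n)))
      rw [loc_η]
      infer_instance
    exact HomologicalComplex.Hom.isIso_of_components _
  have h2 : IsIso ((locD f).map (DerivedCategory.Q.map ((ηC f).app K))) :=
    (NatIso.isIso_map_iff (loc f).mapDerivedCategoryFactors ((ηC f).app K)).2
      (by dsimp; infer_instance)
  have h3 : IsIso ((locD f).map ((ηD f).app (DerivedCategory.Q.obj K))) := by
    rw [ηD_Q, Functor.map_comp]
    infer_instance
  exact (NatTrans.isIso_app_iff_of_iso (Functor.whiskerRight (ηD f) (locD f)) e).1 h3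

end
end GrMod

section Adm
variable {C : Type u} [Category.{v} C] [HasZeroObject C] [HasShift C ℤ] [Preadditive C]
  [∀ n : ℤ, (shiftFunctor C n).Additive] [Pretriangulated C]

/-- Every object `X` sits in a distinguished triangle `T → X → Z → T[1]` with `T` in `P` and `Z`
in the right orthogonal of `P`, that is, `C = ⟨P^⊥, P⟩` is a semi-orthogonal decomposition. -/
def HasDecomposition (P : ObjectProperty C) : Prop :=
  ∀ X : C, ∃ (T Z : C) (i : T ⟶ X) (p : X ⟶ Z) (δ : Z ⟶ T⟦(1 : ℤ)⟧),
    P T ∧ P.rightOrthogonal Z ∧ Triangle.mk i p δ ∈ distTriang C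

variable {P : ObjectProperty C} [P.IsStableUnderShift ℤ]

lemma HasDecomposition.isRightAdjoint (h : HasDecomposition P) :
    P.rightOrthogonal.ι.IsRightAdjoint := by
  choose T Z i p δ hT hZ hd using h
  have key (X : C) (Y : P.rightOrthogonal.FullSubcategory) : Function.Bijective
      (fun g : (⟨Z X, hZ X⟩ : P.rightOrthogonal.FullSubcategory) ⟶ Y => p X ≫ g.hom) := by
    constructor
    · intro g g' hg
      obtain ⟨φ, hφ⟩ := Triangle.yoneda_exact₃ _ (hd X) (g.hom - g'.hom)
        ((Preadditive.comp_sub (p X) g.hom g'.hom).trans (sub_eq_zero.2 hg))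
      have : φ = 0 := Y.property φ (P.le_shift 1 _ (hT X))
      ext
      rw [← sub_eq_zero, hφ, this]
      exact comp_zero
    · intro g
      obtain ⟨φ, hφ⟩ := Triangle.yoneda_exact₂ _ (hd X) g (Y.property _ (hT X))
      exact ⟨ObjectProperty.homMk φ, hφ.symm⟩
  exact (Adjunction.adjunctionOfEquivLeft (G := P.rightOrthogonal.ι)
    (fun X Y => Equiv.ofBijective _ (key X Y))
    (fun X Y Y' g h => (Category.assoc _ _ _).symm)).isRightAdjoint

lemma HasDecomposition.isLeftAdjoint (h : HasDecomposition P) : P.ι.IsLeftAdjoint := by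
  choose T Z i p δ hT hZ hd using h
  have key (X : C) (Y : P.FullSubcategory) : Function.Bijective
      (fun g : Y ⟶ (⟨T X, hT X⟩ : P.FullSubcategory) => g.hom ≫ i X) := by
    constructor
    · intro g g' hg
      obtain ⟨φ, hφ⟩ := Triangle.coyoneda_exact₂ _ (inv_rot_of_distTriang _ (hd X))
        (g.hom - g'.hom) ((Preadditive.sub_comp g.hom g'.hom (i X)).trans (sub_eq_zero.2 hg))
      have : φ = 0 := P.rightOrthogonal.le_shift (-1) _ (hZ X) φ Y.property
      ext
      rw [← sub_eq_zero, hφ, this]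
      exact zero_comp
    · intro g
      obtain ⟨φ, hφ⟩ := Triangle.coyoneda_exact₂ _ (hd X) g (hZ X _ Y.property)
      exact ⟨ObjectProperty.homMk φ, hφ.symm⟩
  exact (Adjunction.adjunctionOfEquivRight (F := P.ι)
    (fun Y X => (Equiv.ofBijective _ (key X Y)).symm)
    (fun Y Y' X f g => by
      rw [Equiv.symm_apply_eq]
      have := Equiv.apply_symm_apply (Equiv.ofBijective _ (key X Y')) g
      change _ ≫ i X = g at this
      refine Eq.trans ?_ (Category.assoc f.hom _ (i X)).symm
      rw [this]
      rfl)).isLeftAdjoint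

end Adm

namespace GrMod

variable {R A : Type u} [CommRing R] [CommRing A] [Algebra R A]
  {𝒜 : ℤ → Submodule R A} [GradedAlgebra 𝒜]

/-- Objects of the derived category killed by localization at each member of a list. -/
def torL (l : List (Σ d, 𝒜 d)) : ObjectProperty (DerivedCategory (GrMod 𝒜)) :=
  fun X => ∀ f ∈ l, IsZero ((locD f.2).obj X)

lemma torL_locD {d : ℤ} (f : 𝒜 d) (l : List (Σ d, 𝒜 d)) (hf : ⟨d, f⟩ ∈ l)
    (X : DerivedCategory (GrMod 𝒜)) : (torL l).rightOrthogonal ((locD f).obj X) := by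
  intro T φ hT
  have h := (ηD f).naturality φ
  rw [(hT ⟨d, f⟩ hf).eq_of_tgt ((ηD f).app T) 0, zero_comp] at h
  rw [← cancel_mono ((ηD f).app ((locD f).obj X)), zero_comp]
  exact h

lemma hasDecomposition_torL (l : List (Σ d, 𝒜 d)) : HasDecomposition (torL l) := by
  induction l with
  | nil =>
    intro X
    have hz := isZero_zero (DerivedCategory (GrMod 𝒜))
    refine ⟨X, _, 𝟙 X, 0, 0, by simp [torL], fun T φ _ => hz.eq_of_tgt _ _,
      contractible_distinguished X⟩
  | cons f l ih =>
    intro X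
    obtain ⟨T, Z, i, p, δ, hT, hZ, hd⟩ := ih X
    obtain ⟨K, j, w, hK⟩ := distinguished_cocone_triangle₁ ((ηD f.2).app T)
    obtain ⟨Z', p', δ', hZ'⟩ := distinguished_cocone_triangle (j ≫ i)
    have o := Triangulated.someOctahedron rfl hK hd hZ'
    have hle : torL (f :: l) ≤ torL l := fun X hX g hg => hX g (List.mem_cons_of_mem _ hg)
    refine ⟨K, Z', j ≫ i, p', δ', ?_, ?_, hZ'⟩
    · intro g hg
      have ht := (locD g.2).map_distinguished _ hK
      rcases List.mem_cons.1 hg with rfl | hg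
      · exact Triangle.isZero₁_of_isIso₂ _ ht
          (inferInstanceAs (IsIso ((locD g.2).map ((ηD g.2).app T))))
      · exact Triangle.isZero₁_of_isZero₂₃ _ ht (hT g hg) (isZero_locD_locD f.2 g.2 T (hT g hg))
    · exact ObjectProperty.ext_of_isTriangulatedClosed₂ _ _ o.mem
        (torL_locD f.2 _ List.mem_cons_self T) (fun T' φ hT' => hZ φ (hle _ hT'))

/-- The full subcategory of `D(Gr(A))` of objects with `I^∞`-torsion cohomology. -/
def dTor (I : HomogeneousIdeal 𝒜) : ObjectProperty (DerivedCategory (GrMod 𝒜)) := fun X =>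
  ∀ n : ℤ, IsTorsion I.toIdeal ((DerivedCategory.homologyFunctor (GrMod 𝒜) n).obj X)

/-- The full subcategory of `I`-trivial objects of `D(Gr(A))`: those `X` such that every map
`T → X` from an object `T` with `I^∞`-torsion cohomology is zero. -/
def dTriv (I : HomogeneousIdeal 𝒜) : ObjectProperty (DerivedCategory (GrMod 𝒜)) :=
  (dTor I).rightOrthogonal

lemma IsTorsion.of_iso {I : Ideal A} {M N : GrMod 𝒜} (e : M ≅ N) (h : IsTorsion I M) :
    IsTorsion I N := by
  intro j x
  obtain ⟨n, hn⟩ := h j (e.inv.app j x)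
  refine ⟨n, fun i a ha => ?_⟩
  have := congr_arg (e.hom.app _) (hn i a ha)
  rw [map_zero, hom_comm, ← comp_app, e.inv_hom_id] at this
  exact this

instance (I : HomogeneousIdeal 𝒜) : (dTor I).IsStableUnderShift ℤ where
  isStableUnderShiftBy a := ⟨fun X hX n => (hX (a + n)).of_iso
    (((DerivedCategory.homologyFunctor (GrMod 𝒜) 0).shiftIso a n (a + n) rfl).app X).symm⟩

lemma hasDecomposition_dTor [IsNoetherianRing A] (I : HomogeneousIdeal 𝒜) :
    HasDecomposition (dTor I) := by
  obtain ⟨l, hl⟩ := exists_generators I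
  have : dTor I = torL l := by
    ext X
    simp only [dTor, hl, isTorsion_span_iff, torL, isZero_locD_iff]
    exact ⟨fun h f hf n => h n f hf, fun h n f hf => h f hf n⟩
  rw [this]
  exact hasDecomposition_torL l

section
variable [IsNoetherianRing A] (I : HomogeneousIdeal 𝒜)

instance : (dTriv I).ι.IsRightAdjoint := (hasDecomposition_dTor I).isRightAdjoint

instance : (dTor I).ι.IsLeftAdjoint := (hasDecomposition_dTor I).isLeftAdjoint

/-- The functor `Č_I : D(Gr(A)) → D_{I-triv}(Gr(A))`, left adjoint to the inclusion. -/
noncomputable def cech : DerivedCategory (GrMod 𝒜) ⥤ (dTriv I).FullSubcategory :=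
  (dTriv I).ι.leftAdjoint

/-- The local cohomology functor `RΓ_I : D(Gr(A)) → D(Gr(A))`, the right adjoint of the inclusion
of the objects with `I^∞`-torsion cohomology. -/
noncomputable def localCohomology : DerivedCategory (GrMod 𝒜) ⥤ DerivedCategory (GrMod 𝒜) :=
  (dTor I).ι.rightAdjoint ⋙ (dTor I).ι
end

end GrMod

namespace GrMod
open CochainComplex.HomComplex

variable {R A : Type u} [CommRing R] [CommRing A] [Algebra R A]
  {𝒜 : ℤ → Submodule R A} [GradedAlgebra 𝒜]

/-- The functor `M ↦ M_i`. -/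
def wt (i : ℤ) : GrMod 𝒜 ⥤ ModuleCat.{u} R where
  obj M := M.X i
  map f := ModuleCat.ofHom (f.app i)

instance (i : ℤ) : (wt (𝒜 := 𝒜) i).Additive where

lemma wt_exact (i : ℤ) (S : ShortComplex (GrMod 𝒜)) (hS : S.Exact) : (S.map (wt i)).Exact := by
  rw [ShortComplex.moduleCat_exact_iff]
  exact (exact_iff S).1 hS i

instance (i : ℤ) : PreservesFiniteLimits (wt (𝒜 := 𝒜) i) := by
  have := ((wt (𝒜 := 𝒜) i).exact_tfae.out 1 3).1 (wt_exact i)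
  exact this.1

instance (i : ℤ) : PreservesFiniteColimits (wt (𝒜 := 𝒜) i) := by
  have := ((wt (𝒜 := 𝒜) i).exact_tfae.out 1 3).1 (wt_exact i)
  exact this.2

/-- The complex of `R`-modules `M_i` of a complex of graded modules `M`. -/
abbrev wtC (i : ℤ) : CochainComplex (GrMod 𝒜) ℤ ⥤ CochainComplex (ModuleCat.{u} R) ℤ :=
  (wt i).mapHomologicalComplex _

/-- Multiplication by `a ∈ 𝒜 i` as a map of complexes `M_j ⟶ M_k`, for `i + j = k`. -/
def actC (M : CochainComplex (GrMod 𝒜) ℤ) {i j k : ℤ} (h : i + j = k) (a : 𝒜 i) :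
    (wtC j).obj M ⟶ (wtC k).obj M where
  f n := ModuleCat.ofHom ((M.X n).act h a)
  comm' m n _ := by
    ext x
    exact hom_comm (M.d m n) h a x

lemma actC_one (M : CochainComplex (GrMod 𝒜) ℤ) {j : ℤ} (h : 0 + j = j) (a : 𝒜 0)
    (ha : (a : A) = 1) : actC M h a = 𝟙 _ := by
  ext p x
  exact (M.X p).one_act h a ha x

lemma actC_add (M : CochainComplex (GrMod 𝒜) ℤ) {i j k : ℤ} (h : i + j = k) (a b : 𝒜 i) :
    actC M h (a + b) = actC M h a + actC M h b := by
  ext p x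
  exact LinearMap.map_add₂ ((M.X p).act h) a b x

lemma actC_smul (M : CochainComplex (GrMod 𝒜) ℤ) {i j k : ℤ} (h : i + j = k) (r : R)
    (a : 𝒜 i) : actC M h (r • a) = r • actC M h a := by
  ext p x
  exact LinearMap.map_smul₂ ((M.X p).act h) r a x

lemma actC_mul (M : CochainComplex (GrMod 𝒜) ℤ) {i j l m n p : ℤ} (h₁ : p + l = n)
    (h₂ : j + l = m) (h₃ : i + m = n) (a : 𝒜 i) (b : 𝒜 j) (c : 𝒜 p) (hc : (c : A) = a * b) :
    actC M h₂ b ≫ actC M h₃ a = actC M h₁ c := by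
  ext p x
  exact ((M.X p).mul_act h₁ h₂ h₃ a b c hc x).symm

lemma actC_map {M N : CochainComplex (GrMod 𝒜) ℤ} (f : M ⟶ N) {i j k : ℤ} (h : i + j = k)
    (a : 𝒜 i) : (wtC j).map f ≫ actC N h a = actC M h a ≫ (wtC k).map f := by
  ext p x
  exact (hom_comm (f.f p) h a x).symm

variable (J : CochainComplex (ModuleCat.{u} R) ℤ)

section
variable {K L N : CochainComplex (ModuleCat.{u} R) ℤ} {J} {n : ℤ}

lemma cochain_ext {φ ψ : Cochain K J n}
    (h : ∀ p q (hpq : p + n = q) (x : K.X p), φ.v p q hpq x = ψ.v p q hpq x) : φ = ψ :=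
  Cochain.ext _ _ fun p q hpq => ModuleCat.hom_ext (LinearMap.ext (h p q hpq))

variable (J n) in
/-- Precomposition of cochains with a map of complexes. -/
def precomp (f : K ⟶ L) : Cochain L J n →ₗ[R] Cochain K J n where
  toFun φ := (Cochain.ofHom f).comp φ (zero_add n)
  map_add' _ _ := Cochain.comp_add ..
  map_smul' _ _ := Cochain.comp_smul ..

lemma precomp_v (f : K ⟶ L) (φ : Cochain L J n) (p q : ℤ) (hpq : p + n = q) (x : K.X p) :
    (precomp J n f φ).v p q hpq x = φ.v p q hpq (f.f p x) := by
  simp [precomp]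

lemma precomp_comp (f : K ⟶ L) (g : L ⟶ N) (φ : Cochain N J n) :
    precomp J n f (precomp J n g φ) = precomp J n (f ≫ g) φ :=
  cochain_ext fun _ _ _ _ => (precomp_v _ _ _ _ _ _).trans
    ((precomp_v _ φ _ _ _ _).trans (precomp_v _ _ _ _ _ _).symm)

lemma precomp_id (φ : Cochain K J n) : precomp J n (𝟙 K) φ = φ :=
  cochain_ext fun _ _ _ _ => precomp_v _ φ _ _ _ _

lemma precomp_add (f g : K ⟶ L) (φ : Cochain L J n) :
    precomp J n (f + g) φ = precomp J n f φ + precomp J n g φ :=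
  cochain_ext fun p q hpq x => by
    rw [Cochain.add_v, precomp_v]
    refine Eq.trans ?_ (congr_arg₂ (· + ·) (precomp_v f φ p q hpq x)
      (precomp_v g φ p q hpq x)).symm
    exact map_add (φ.v p q hpq).hom (f.f p x) (g.f p x)

lemma precomp_smul (r : R) (f : K ⟶ L) (φ : Cochain L J n) :
    precomp J n (r • f) φ = r • precomp J n f φ :=
  cochain_ext fun p q hpq x => by
    rw [Cochain.smul_v, precomp_v]
    refine Eq.trans ?_ (congr_arg (r • ·) (precomp_v f φ p q hpq x)).symm
    exact map_smul (φ.v p q hpq).hom r (f.f p x)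

lemma δ_precomp (f : K ⟶ L) (φ : Cochain L J n) (m : ℤ) :
    δ n m (precomp J n f φ) = precomp J m f (δ n m φ) := by
  by_cases h : n + 1 = m
  · exact δ_ofHom_comp f φ m
  · rw [δ_shape n m h, δ_shape n m h, map_zero]
end

/-- The graded module of degree `n` cochains: its weight `i` piece is `Hom^n_R(M_{-i}, J)`. -/
def dualX (M : CochainComplex (GrMod 𝒜) ℤ) (n : ℤ) : GrMod 𝒜 where
  X i := ModuleCat.of R (Cochain ((wtC (-i)).obj M) J n)
  act {i j k} h := LinearMap.mk₂ R
    (fun a φ => precomp J n (actC M (show i + -k = -j by lia) a) φ)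
    (fun a b φ => (congr_arg (precomp J n · φ) (actC_add M _ a b)).trans (precomp_add _ _ φ))
    (fun r a φ => (congr_arg (precomp J n · φ) (actC_smul M _ r a)).trans (precomp_smul _ _ φ))
    (fun a φ ψ => map_add _ _ _)
    (fun r a φ => map_smul _ _ _)
  one_act {j} h a ha φ := by
    refine Eq.trans ?_ (precomp_id φ)
    exact congr_arg (precomp J n · φ) (actC_one M _ a ha)
  mul_act {i j l m n' p'} h₁ h₂ h₃ a b c hc φ := by
    refine Eq.trans ?_ (precomp_comp (actC M _ a) (actC M _ b) φ).symm
    exact congr_arg (precomp J n · φ) (actC_mul M _ _ _ b a c (hc.trans (mul_comm _ _))).symm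

/-- The complex of graded modules `Hom_R(M, J)`. -/
def dualObj (M : CochainComplex (GrMod 𝒜) ℤ) : CochainComplex (GrMod 𝒜) ℤ where
  X n := dualX J M n
  d n m := { app := fun i => δ_hom R ((wtC (-i)).obj M) J n m
             comm := fun {i j k} h a φ => δ_precomp _ φ m }
  shape n m h := by
    ext i φ : 2
    exact δ_shape n m h φ
  d_comp_d' n m p _ _ := by
    ext i φ : 2
    exact δ_δ n m p φ

/-- The maps `Hom^n_R(N, J) ⟶ Hom^n_R(M, J)` induced by `M ⟶ N`. -/
def dualMapX {M N : CochainComplex (GrMod 𝒜) ℤ} (f : M ⟶ N) (n : ℤ) :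
    dualX J N n ⟶ dualX J M n where
  app i := precomp J n ((wtC (-i)).map f)
  comm {i j k} h a φ := by
    refine (precomp_comp (K := (wtC (-k)).obj M) _ _ φ).trans (Eq.trans ?_
      (precomp_comp (K := (wtC (-k)).obj M) _ _ φ).symm)
    exact congr_arg (precomp J n · φ) (actC_map f _ a)

/-- The functoriality of `dualObj`. -/
def dualMap {M N : CochainComplex (GrMod 𝒜) ℤ} (f : M ⟶ N) : dualObj J N ⟶ dualObj J M where
  f n := dualMapX J f n
  comm' _ m _ := hom_ext fun i φ => δ_precomp ((wtC (-i)).map f) φ m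

/-- The functor `M ↦ Hom_R(M, J)` on complexes of graded modules. -/
def dual : (CochainComplex (GrMod 𝒜) ℤ)ᵒᵖ ⥤ CochainComplex (GrMod 𝒜) ℤ where
  obj M := dualObj J M.unop
  map f := dualMap J f.unop
  map_id M := HomologicalComplex.Hom.ext (funext fun n => hom_ext fun i φ =>
    (congr_arg (precomp J n · φ) ((wtC (-i)).map_id M.unop)).trans (precomp_id φ))
  map_comp f g := HomologicalComplex.Hom.ext (funext fun n => hom_ext fun i φ =>
    (congr_arg (precomp J n · φ) ((wtC (-i)).map_comp g.unop f.unop)).trans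
      (precomp_comp _ _ φ).symm)

lemma toHom_precomp {K L J : CochainComplex (ModuleCat.{u} R) ℤ} (f : K ⟶ L) {n : ℤ}
    (z : Cocycle L J n) : CohomologyClass.toHom (.mk (z.precomp f)) =
      (HomotopyCategory.quotient _ _).map f ≫ CohomologyClass.toHom (.mk z) := by
  rw [CohomologyClass.toHom_mk, CohomologyClass.toHom_mk, Cocycle.equivHomShift_symm_precomp,
    Functor.map_comp]

section
variable {K L : CochainComplex (ModuleCat.{u} R) ℤ} {J} [J.IsKInjective] (f : K ⟶ L) [QuasiIso f]

open HomotopyCategory in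
lemma quotient_precomp_bijective (n : ℤ) : Function.Bijective
    (fun g : (quotient _ (ComplexShape.up ℤ)).obj L ⟶ (quotient _ _).obj (J⟦n⟧) =>
      (quotient _ _).map f ≫ g) := by
  have hJ := CochainComplex.IsKInjective.rightOrthogonal (J⟦n⟧)
  rw [← ObjectProperty.isLocal_trW, ← quasiIso_eq_trW_subcategoryAcyclic] at hJ
  refine hJ _ ((quotient_map_mem_quasiIso_iff f).2 ?_)
  rwa [HomologicalComplex.mem_quasiIso_iff]

lemma exists_precomp (n m : ℤ) (hnm : n + 1 = m) (l : ℤ) (hl : l + 1 = n) (z : Cochain K J n)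
    (hz : δ n m z = 0) :
    ∃ (w : Cochain L J n) (y : Cochain K J l), δ n m w = 0 ∧ precomp J n f w = z + δ l n y := by
  obtain ⟨g, hg⟩ := (quotient_precomp_bijective f n).2
    (CohomologyClass.toHom (.mk (Cocycle.mk z m hnm hz)))
  obtain ⟨w, rfl⟩ := (CohomologyClass.toHom_bijective L J n).2 g
  obtain ⟨w, rfl⟩ := w.mk_surjective
  dsimp only at hg
  rw [← toHom_precomp] at hg
  have h := (CohomologyClass.toHom_bijective K J n).1 hg
  rw [← sub_eq_zero, ← CohomologyClass.mk_sub, CohomologyClass.mk_eq_zero_iff,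
    mem_coboundaries_iff _ l hl] at h
  obtain ⟨y, hy⟩ := h
  refine ⟨w.1, y, w.δ_eq_zero m, ?_⟩
  rw [hy]
  exact (add_sub_cancel z (precomp J n f w.1)).symm

lemma exists_of_precomp (n m : ℤ) (hnm : n + 1 = m) (l : ℤ) (hl : l + 1 = n) (z : Cochain L J n)
    (hz : δ n m z = 0) (y : Cochain K J l) (hy : δ l n y = precomp J n f z) :
    ∃ y' : Cochain L J l, δ l n y' = z := by
  have h : CohomologyClass.mk ((Cocycle.mk z m hnm hz).precomp f) = 0 := by
    rw [CohomologyClass.mk_eq_zero_iff, mem_coboundaries_iff _ l hl]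
    exact ⟨y, hy⟩
  have h2 := toHom_precomp f (Cocycle.mk z m hnm hz)
  rw [h, map_zero] at h2
  have h3 := (quotient_precomp_bijective f n).1 (h2.symm.trans comp_zero.symm)
  rw [← map_zero CohomologyClass.toHom] at h3
  have h4 := (CohomologyClass.toHom_bijective L J n).1 h3
  rwa [CohomologyClass.mk_eq_zero_iff, mem_coboundaries_iff _ l hl] at h4

end

lemma quasiIso_of_elements {S T : ShortComplex (GrMod 𝒜)} (φ : S ⟶ T)
    (inj : ∀ i (x : S.X₂.X i), S.g.app i x = 0 → ∀ y, T.f.app i y = φ.τ₂.app i x →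
      ∃ y', S.f.app i y' = x)
    (surj : ∀ i (x : T.X₂.X i), T.g.app i x = 0 → ∃ w y, S.g.app i w = 0 ∧
      φ.τ₂.app i w = x + T.f.app i y) : ShortComplex.QuasiIso φ := by
  let γ : ShortComplex.LeftHomologyMapData φ (leftHomologyData S) (leftHomologyData T) := default
  rw [γ.quasiIso_iff]
  have hi (i : ℤ) (x : LinearMap.ker (S.g.app i)) :
      Subtype.val (p := (· ∈ LinearMap.ker (T.g.app i))) (γ.φK.app i x) = φ.τ₂.app i x.1 :=
    congr_arg (fun t : ker S.g ⟶ T.X₂ => Hom.app t i x) γ.commi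
  have hπ (i : ℤ) (x : LinearMap.ker (S.g.app i)) :
      γ.φH.app i (Submodule.mkQ _ x) = Submodule.mkQ _ (γ.φK.app i x) :=
    congr_arg (fun t : ker S.g ⟶ (leftHomologyData T).H => Hom.app t i x) γ.commπ
  refine isIso_of_bijective _ fun i => ⟨?_, fun x => ?_⟩
  · rw [injective_iff_map_eq_zero]
    intro x hx
    obtain ⟨x, rfl⟩ := Submodule.mkQ_surjective _ x
    obtain ⟨y, hy⟩ := (Submodule.Quotient.mk_eq_zero _).1 ((hπ i x).symm.trans hx)
    obtain ⟨y', hy'⟩ := inj i x.1 x.2 y ((congr_arg Subtype.val hy).trans (hi i x))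
    exact (Submodule.Quotient.mk_eq_zero _).2 ⟨y', Subtype.ext hy'⟩
  · obtain ⟨x, rfl⟩ := Submodule.mkQ_surjective _ x
    obtain ⟨w, y, hw, h⟩ := surj i x.1 x.2
    refine ⟨Submodule.mkQ _ (⟨w, hw⟩ : LinearMap.ker (S.g.app i)), (hπ i _).trans ?_⟩
    refine (Submodule.Quotient.eq _).2 ⟨y, Subtype.ext ?_⟩
    exact (eq_sub_of_add_eq' h.symm).trans (congr_arg (· - x.1) (hi i ⟨w, hw⟩)).symm

section
variable [J.IsKInjective]

lemma quasiIso_dualMap {M N : CochainComplex (GrMod 𝒜) ℤ} (f : M ⟶ N) [QuasiIso f] :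
    QuasiIso (dualMap J f) := by
  rw [quasiIso_iff]
  intro n
  rw [quasiIsoAt_iff' _ (n - 1) n (n + 1) (by simp) (by simp)]
  refine quasiIso_of_elements _ (fun i x hx y hy => ?_) (fun i x hx => ?_)
  · exact exists_of_precomp ((wtC (-i)).map f) n (n + 1) rfl (n - 1) (by ring) x hx y hy
  · exact exists_precomp ((wtC (-i)).map f) n (n + 1) rfl (n - 1) (by ring) x hx

/-- The functor `D_Y : D(Gr(A))ᵒᵖ ⥤ D(Gr(A))`, `D_Y(M)_i = RHom_R(M_{-i}, J)`, induced by the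
exact functor `M ↦ Hom_R(M, J)`, for a K-injective complex `J` of `R`-modules. -/
noncomputable def dualD : (DerivedCategory (GrMod 𝒜))ᵒᵖ ⥤ DerivedCategory (GrMod 𝒜) :=
  Localization.lift (dual J ⋙ DerivedCategory.Q)
    (W := (HomologicalComplex.quasiIso (GrMod 𝒜) (ComplexShape.up ℤ)).op)
    (fun M N f hf => by
      have : QuasiIso f.unop := hf
      exact (DerivedCategory.isIso_Q_map_iff_quasiIso _ (dualMap J f.unop)).2
        (quasiIso_dualMap J f.unop))
    (DerivedCategory.Q (C := GrMod 𝒜)).op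
end

end GrMod

namespace GrMod

variable {R A : Type u} [CommRing R] [CommRing A] [Algebra R A]
  {𝒜 : ℤ → Submodule R A} [GradedAlgebra 𝒜]

/-- A dualizing complex over `R`, represented by a bounded complex of injective modules: its
cohomology is finitely generated, and `R → RHom_R(ω, ω)` is an isomorphism, that is, up to
homotopy the endomorphisms of `ω` are exactly the multiplications by elements of `R`, and there
are no nonzero maps `ω → ω[n]` for `n ≠ 0`. -/
class IsDualizingComplex (ω : CochainComplex (ModuleCat.{u} R) ℤ) : Prop where
  bounded : ∃ a b : ℤ, ω.IsStrictlyGE a ∧ ω.IsStrictlyLE b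
  injective (n : ℤ) : Injective (ω.X n)
  finite (n : ℤ) : Module.Finite R (ω.homology n)
  existsUnique_smul (f : ω ⟶ ω) : ∃! r : R, Nonempty (Homotopy f (r • 𝟙 ω))
  homotopy_zero (n : ℤ) (hn : n ≠ 0) (f : ω ⟶ ω⟦n⟧) : Nonempty (Homotopy f 0)

instance (ω : CochainComplex (ModuleCat.{u} R) ℤ) [h : IsDualizingComplex ω] :
    ω.IsKInjective := by
  obtain ⟨a, _, _, _⟩ := h.bounded
  have := h.injective
  exact CochainComplex.isKInjective_of_injective ω a

variable (𝒜) in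
/-- `A` as a graded module over itself. -/
def self : GrMod 𝒜 where
  X i := ModuleCat.of R (𝒜 i)
  act {i j k} h := LinearMap.mk₂ R
    (fun a x => ⟨a * x, h ▸ SetLike.mul_mem_graded a.2 x.2⟩)
    (fun a b x => Subtype.ext (add_mul _ _ _)) (fun r a x => Subtype.ext (smul_mul_assoc _ _ _))
    (fun a x y => Subtype.ext (mul_add _ _ _)) (fun r a x => Subtype.ext (mul_smul_comm _ _ _))
  one_act h a ha x := Subtype.ext (by simp [ha])
  mul_act h₁ h₂ h₃ a b c hc x := Subtype.ext (by simp [hc, mul_assoc])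

variable (𝒜) in
/-- `A` as an object of `D(Gr(A))`. -/
noncomputable def selfD : DerivedCategory (GrMod 𝒜) :=
  (DerivedCategory.singleFunctor (GrMod 𝒜) 0).obj (self 𝒜)

variable (𝒜) in
/-- The ideal `I⁺` generated by the homogeneous elements of positive weight. -/
def posIdeal : HomogeneousIdeal 𝒜 :=
  ⟨Ideal.span {a | ∃ i : ℤ, 0 < i ∧ a ∈ 𝒜 i},
    Ideal.homogeneous_span 𝒜 _ fun _ ⟨i, _, h⟩ => ⟨i, h⟩⟩

variable (𝒜) in
/-- The ideal `I⁻` generated by the homogeneous elements of negative weight. -/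
def negIdeal : HomogeneousIdeal 𝒜 :=
  ⟨Ideal.span {a | ∃ i : ℤ, i < 0 ∧ a ∈ 𝒜 i},
    Ideal.homogeneous_span 𝒜 _ fun _ ⟨i, _, h⟩ => ⟨i, h⟩⟩

/-- `M` is generated by finitely many homogeneous elements. -/
def IsFG (M : GrMod 𝒜) : Prop :=
  ∃ (n : ℕ) (d : Fin n → ℤ) (x : ∀ k, M.X (d k)), ∀ (i : ℤ) (y : M.X i),
    ∃ a : ∀ k, 𝒜 (i - d k), y = ∑ k, M.act (sub_add_cancel i (d k)) (a k) (x k)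

variable (𝒜) in
/-- The full subcategory `D_perf(Gr(A))` of objects isomorphic to a bounded complex of finitely
generated projective graded modules. -/
def dPerf : ObjectProperty (DerivedCategory (GrMod 𝒜)) := fun X =>
  ∃ K : CochainComplex (GrMod 𝒜) ℤ, (∃ a b : ℤ, K.IsStrictlyGE a ∧ K.IsStrictlyLE b) ∧
    (∀ n, Projective (K.X n) ∧ IsFG (K.X n)) ∧ Nonempty (X ≅ DerivedCategory.Q.obj K)

end GrMod

/-! By the triangle RΓ_I G → G → Č_I G and the stability of E under shifts, Č_I is fully faithful on
E if and only if Hom(F, RΓ_I G) = 0 for all F, G in E (`cech_full_faithful_iff`).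

A perfect complex K has a dual Q = Hom_A(K, A), and RHom(K, -) and RHom(Q, -) are adjoint to each
other on both sides (`DualPair.adjD`, `DualPair.swap`). Hence both preserve torsion objects and
commute with RΓ_I (`nonempty_lc_homD_iso`); moreover K = RHom(Q, A). Put V = RHom(K, RΓ_{I^-} F).
Then Hom(K, RΓ_{I^-} F) = Hom(A, V). On the other side, Hom(F, RΓ_{I^+} K) = Hom(F, RHom(Q, RΓ_{I^+}
A)) = Hom(RHom(K, F), RΓ_{I^+} A), and by the assumed isomorphism this is Hom(RHom(K, F)[1], D
RΓ_{I^-} A). Vanishing of Hom(X, D RΓ_I Y) is symmetric in X and Y (`eq_zero_dual_lc`), so the last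
group vanishes if and only if Hom(A, D(V[1])) does. The roles of K and F are exchanged between the
two sides, which is harmless since all pairs in E are considered.

Maps from A see only weight zero. It remains to compare acyclicity of the complex of R-modules V_0
with vanishing of RHom_R(V_0, ω), for V_0 with finitely generated cohomology bounded above.

The finiteness holds because V = RΓ_{I^-}(RHom(K, F)): taking cones of multiplication by the
generators of I^- reduces to torsion complexes with Noetherian cohomology, and the negative weights
of the generators allow a descent from each cone (`IsBoundedNoeth.hasFinitePieces_lc`).

The comparison is `acyclic_of_dual_eq_zero`. If RHom(N, ω) = 0, then RHom(N, R) = RHom(N, RHom(ω,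
ω)) = RHom(ω, RHom(N, ω)) = 0. Hence RHom(N, R/J) = 0 for every J obtained from 0 by successively
adding nonzerodivisors. A nonzero top cohomology module of N would have a nonzero map to some such
R/J (`IsNoetherianRing.exists_linearMap_ne_zero`), and this map would extend to N. -/

namespace GrMod

variable {R A : Type u} [CommRing R] [CommRing A] [Algebra R A]
  {𝒜 : ℤ → Submodule R A} [GradedAlgebra 𝒜]

/-! ### The `R`-linear structure -/

section Linear
variable {M N : GrMod 𝒜}

instance : SMul R (M ⟶ N) :=
  ⟨fun r f => { app := fun i => r • f.app i, comm := fun _ _ _ => by simp [hom_comm] }⟩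

/-- The weight components of a map, as an additive map. -/
def appHom : (M ⟶ N) →+ (∀ i, M.X i →ₗ[R] N.X i) where
  toFun f := f.app
  map_zero' := rfl
  map_add' _ _ := rfl

instance : Module R (M ⟶ N) :=
  Function.Injective.module R appHom (fun _ _ h => Hom.ext h) (fun _ _ => rfl)

instance : Linear R (GrMod 𝒜) where
  smul_comp _ _ _ r f g := by
    ext i x
    exact map_smul (g.app i) r _

@[simp] lemma neg_app (f : M ⟶ N) (i : ℤ) (x : M.X i) : Hom.app (-f) i x = -f.app i x := rfl

/-- Evaluation of maps at an element. -/
def evalHom (i : ℤ) (x : M.X i) : (M ⟶ N) →ₗ[R] N.X i where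
  toFun f := f.app i x
  map_add' _ _ := rfl
  map_smul' _ _ := rfl

lemma sum_app {ι : Type*} (s : Finset ι) (f : ι → (M ⟶ N)) (i : ℤ) (x : M.X i) :
    Hom.app (∑ k ∈ s, f k : M ⟶ N) i x = ∑ k ∈ s, (f k).app i x :=
  map_sum (evalHom i x) f s

lemma units_smul_app (e : ℤˣ) (f : M ⟶ N) (i : ℤ) (x : M.X i) :
    Hom.app (e • f) i x = e • f.app i x := by
  rcases Int.units_eq_one_or e with rfl | rfl
  · simp
  · simp

end Linear

/-! ### Twists -/

/-- The product of homogeneous elements. -/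
def hmul {i j k : ℤ} (h : i + j = k) (a : 𝒜 i) (b : 𝒜 j) : 𝒜 k :=
  ⟨a * b, h ▸ SetLike.mul_mem_graded a.2 b.2⟩

variable (𝒜) in
/-- The unit, as a homogeneous element. -/
def hone : 𝒜 0 := ⟨1, SetLike.one_mem_graded 𝒜⟩

@[simp] lemma act_hone (M : GrMod 𝒜) {i : ℤ} (h : 0 + i = i) (x : M.X i) :
    M.act h (hone 𝒜) x = x := M.one_act h _ rfl x

/-- Commutativity of `A` enters here; it makes multiplication by a homogeneous element a map of
graded modules. -/
lemma act_comm (M : GrMod 𝒜) {i j k m m' n : ℤ} (h₁ : i + m = n) (h₂ : j + k = m)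
    (h₃ : j + m' = n) (h₄ : i + k = m') (a : 𝒜 i) (b : 𝒜 j) (x : M.X k) :
    M.act h₁ a (M.act h₂ b x) = M.act h₃ b (M.act h₄ a x) := by
  rw [M.act_act h₂ h₁ (p := i + j) (by lia) a b (hmul rfl a b) rfl,
    M.act_act h₄ h₃ (p := i + j) (by lia) b a (hmul rfl a b) (mul_comm _ _)]

/-- The twist `M(d)`, with `M(d)_i = M_{i + d}`. -/
def twObj (d : ℤ) (M : GrMod 𝒜) : GrMod 𝒜 where
  X i := M.X (i + d)
  act {i j k} h := M.act (show i + (j + d) = k + d by lia)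
  one_act h a ha x := M.one_act _ a ha x
  mul_act h₁ h₂ h₃ a b c hc x := M.mul_act _ _ _ a b c hc x

/-- Twisting, as a functor. -/
def tw (d : ℤ) : GrMod 𝒜 ⥤ GrMod 𝒜 where
  obj := twObj d
  map f := { app := fun i => f.app (i + d), comm := fun _ a x => hom_comm f _ a x }

instance (d : ℤ) : (tw (𝒜 := 𝒜) d).Additive where

lemma tw_exact (d : ℤ) (S : ShortComplex (GrMod 𝒜)) (hS : S.Exact) : (S.map (tw d)).Exact := by
  rw [exact_iff] at hS ⊢
  exact fun i x hx => hS (i + d) x hx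

instance (d : ℤ) : PreservesFiniteLimits (tw (𝒜 := 𝒜) d) := by
  have := ((tw (𝒜 := 𝒜) d).exact_tfae.out 1 3).1 (tw_exact d)
  exact this.1

instance (d : ℤ) : PreservesFiniteColimits (tw (𝒜 := 𝒜) d) := by
  have := ((tw (𝒜 := 𝒜) d).exact_tfae.out 1 3).1 (tw_exact d)
  exact this.2

/-- Multiplication by `a ∈ 𝒜 e`, as a map `M(d) ⟶ M(e + d)`. -/
def mulTw (M : GrMod 𝒜) {e d d' : ℤ} (h : e + d = d') (a : 𝒜 e) :
    (tw d).obj M ⟶ (tw d').obj M where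
  app i := M.act (show e + (i + d) = i + d' by lia) a
  comm _ b x := M.act_comm _ _ _ _ a b x

/-- Twists of complexes. -/
abbrev twC (d : ℤ) : CochainComplex (GrMod 𝒜) ℤ ⥤ CochainComplex (GrMod 𝒜) ℤ :=
  (tw d).mapHomologicalComplex _

/-- Multiplication by `a ∈ 𝒜 e`, as a map of complexes `K(d) ⟶ K(e + d)`. -/
def mulC (K : CochainComplex (GrMod 𝒜) ℤ) {e d d' : ℤ} (h : e + d = d') (a : 𝒜 e) :
    (twC d).obj K ⟶ (twC d').obj K where
  f n := mulTw (K.X n) h a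
  comm' m n _ := by
    ext i x
    exact hom_comm (K.d m n) _ a x

/-- The maps `mulC` turn the family of twists K(d) into a graded module in complexes; this and the
next three identities are its axioms, and they supply the action on `homX`. -/
lemma mulC_one (K : CochainComplex (GrMod 𝒜) ℤ) {d : ℤ} (h : 0 + d = d) (a : 𝒜 0)
    (ha : (a : A) = 1) : mulC K h a = 𝟙 _ := by
  ext n i x
  exact (K.X n).one_act _ a ha x

lemma mulC_add (K : CochainComplex (GrMod 𝒜) ℤ) {e d d' : ℤ} (h : e + d = d') (a b : 𝒜 e) :
    mulC K h (a + b) = mulC K h a + mulC K h b := by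
  ext n i x
  exact LinearMap.map_add₂ ((K.X n).act _) a b x

lemma mulC_smul (K : CochainComplex (GrMod 𝒜) ℤ) {e d d' : ℤ} (h : e + d = d') (r : R)
    (a : 𝒜 e) : mulC K h (r • a) = r • mulC K h a := by
  ext n i x
  exact LinearMap.map_smul₂ ((K.X n).act _) r a x

lemma mulC_mul (K : CochainComplex (GrMod 𝒜) ℤ) {i j l m n p : ℤ} (h₁ : p + l = n)
    (h₂ : j + l = m) (h₃ : i + m = n) (a : 𝒜 i) (b : 𝒜 j) (c : 𝒜 p) (hc : (c : A) = a * b) :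
    mulC K h₂ b ≫ mulC K h₃ a = mulC K h₁ c := by
  ext q w x
  exact ((K.X q).mul_act _ _ _ a b c hc x).symm

lemma mulC_map {K L : CochainComplex (GrMod 𝒜) ℤ} (f : K ⟶ L) {e d d' : ℤ} (h : e + d = d')
    (a : 𝒜 e) : (twC d).map f ≫ mulC L h a = mulC K h a ≫ (twC d').map f := by
  ext n i x
  exact (hom_comm (f.f n) _ a x).symm

end GrMod

namespace GrMod
open CochainComplex.HomComplex

variable {R A : Type u} [CommRing R] [CommRing A] [Algebra R A]
  {𝒜 : ℤ → Submodule R A} [GradedAlgebra 𝒜]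

/-! ### The graded Hom complex -/

section Postcomp
variable {G K L N : CochainComplex (GrMod 𝒜) ℤ} {n : ℤ}

lemma grCochain_ext {φ ψ : Cochain K L n}
    (h : ∀ p q (hpq : p + n = q) i (x : (K.X p).X i),
      (φ.v p q hpq).app i x = (ψ.v p q hpq).app i x) : φ = ψ :=
  Cochain.ext _ _ fun p q hpq => hom_ext (h p q hpq)

variable (n) in
/-- Postcomposition of cochains with a map of complexes. -/
def postcomp (f : K ⟶ L) : Cochain G K n →ₗ[R] Cochain G L n where
  toFun z := z.comp (Cochain.ofHom f) (add_zero n)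
  map_add' _ _ := Cochain.add_comp ..
  map_smul' _ _ := Cochain.smul_comp ..

lemma postcomp_v (f : K ⟶ L) (z : Cochain G K n) (p q : ℤ) (hpq : p + n = q) :
    (postcomp n f z).v p q hpq = z.v p q hpq ≫ f.f q := by
  simp [postcomp]

lemma postcomp_comp (f : K ⟶ L) (g : L ⟶ N) (z : Cochain G K n) :
    postcomp n (f ≫ g) z = postcomp n g (postcomp n f z) :=
  Cochain.ext _ _ fun p q hpq => by simp [postcomp_v]

lemma postcomp_id (z : Cochain G K n) : postcomp n (𝟙 K) z = z :=
  Cochain.ext _ _ fun p q hpq => by simp [postcomp_v]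

lemma postcomp_add (f g : K ⟶ L) (z : Cochain G K n) :
    postcomp n (f + g) z = postcomp n f z + postcomp n g z :=
  Cochain.ext _ _ fun p q hpq => by simp [postcomp_v]

lemma postcomp_smul (r : R) (f : K ⟶ L) (z : Cochain G K n) :
    postcomp n (r • f) z = r • postcomp n f z :=
  Cochain.ext _ _ fun p q hpq => by simp [postcomp_v]

lemma δ_postcomp (f : K ⟶ L) (z : Cochain G K n) (m : ℤ) :
    δ n m (postcomp n f z) = postcomp m f (δ n m z) := by
  by_cases h : n + 1 = m
  · exact δ_comp_ofHom z f m
  · rw [δ_shape n m h, δ_shape n m h, map_zero]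

/-- Bridge to the homotopy category: a cocycle of degree n is a map G → K[n], and postcomposition of
cocycles becomes composition with the shifted map. -/
lemma toHom_postcomp (f : K ⟶ L) (z : Cocycle G K n) :
    CohomologyClass.toHom (.mk (z.postcomp f)) = CohomologyClass.toHom (.mk z) ≫
      (HomotopyCategory.quotient _ _).map (f⟦n⟧') := by
  rw [CohomologyClass.toHom_mk, CohomologyClass.toHom_mk, Cocycle.equivHomShift_symm_postcomp,
    Functor.map_comp]

section
variable [G.IsKProjective] (f : K ⟶ L) [QuasiIso f]

-- K-projectivity is left orthogonality to acyclic complexes in the homotopy category, so `G` does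
-- not distinguish the two ends of a quasi-isomorphism.
open HomotopyCategory in
lemma quotient_postcomp_bijective (n : ℤ) : Function.Bijective
    (fun g : (quotient _ (ComplexShape.up ℤ)).obj G ⟶ (quotient _ _).obj (K⟦n⟧) =>
      g ≫ (quotient _ _).map (f⟦n⟧')) := by
  have hG := CochainComplex.IsKProjective.leftOrthogonal G
  rw [← ObjectProperty.isColocal_trW, ← quasiIso_eq_trW_subcategoryAcyclic] at hG
  refine hG _ ((quotient_map_mem_quasiIso_iff _).2 ?_)
  rw [HomologicalComplex.mem_quasiIso_iff]
  infer_instance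

/-- Surjectivity on cohomology in terms of elements, so `w` lifts `z` only up to a coboundary;
`exists_of_postcomp` is the injectivity half. This is the form required by `quasiIso_of_elements`.
-/
lemma exists_postcomp (n m : ℤ) (hnm : n + 1 = m) (l : ℤ) (hl : l + 1 = n) (z : Cochain G L n)
    (hz : δ n m z = 0) :
    ∃ (w : Cochain G K n) (y : Cochain G L l), δ n m w = 0 ∧ postcomp n f w = z + δ l n y := by
  obtain ⟨g, hg⟩ := (quotient_postcomp_bijective (G := G) f n).2
    (CohomologyClass.toHom (.mk (Cocycle.mk z m hnm hz)))
  obtain ⟨w, rfl⟩ := (CohomologyClass.toHom_bijective G K n).2 g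
  obtain ⟨w, rfl⟩ := w.mk_surjective
  dsimp only at hg
  rw [← toHom_postcomp] at hg
  have h := (CohomologyClass.toHom_bijective G L n).1 hg
  rw [← sub_eq_zero, ← CohomologyClass.mk_sub, CohomologyClass.mk_eq_zero_iff,
    mem_coboundaries_iff _ l hl] at h
  obtain ⟨y, hy⟩ := h
  refine ⟨w.1, y, w.δ_eq_zero m, ?_⟩
  rw [hy]
  exact (add_sub_cancel z (postcomp n f w.1)).symm

lemma exists_of_postcomp (n m : ℤ) (hnm : n + 1 = m) (l : ℤ) (hl : l + 1 = n)
    (z : Cochain G K n) (hz : δ n m z = 0) (y : Cochain G L l) (hy : δ l n y = postcomp n f z) :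
    ∃ y' : Cochain G K l, δ l n y' = z := by
  have h : CohomologyClass.mk ((Cocycle.mk z m hnm hz).postcomp f) = 0 := by
    rw [CohomologyClass.mk_eq_zero_iff, mem_coboundaries_iff _ l hl]
    exact ⟨y, hy⟩
  have h2 := toHom_postcomp f (Cocycle.mk z m hnm hz)
  rw [h, map_zero] at h2
  have h3 := (quotient_postcomp_bijective (G := G) f n).1 (h2.symm.trans zero_comp.symm)
  rw [← map_zero CohomologyClass.toHom] at h3
  have h4 := (CohomologyClass.toHom_bijective G K n).1 h3
  rwa [CohomologyClass.mk_eq_zero_iff, mem_coboundaries_iff _ l hl] at h4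

end

end Postcomp

variable (G : CochainComplex (GrMod 𝒜) ℤ)

/-- The graded module of degree `n` cochains: its weight `i` piece is `Hom^n(G, X(i))`. -/
def homX (X : CochainComplex (GrMod 𝒜) ℤ) (n : ℤ) : GrMod 𝒜 where
  X i := ModuleCat.of R (Cochain G ((twC i).obj X) n)
  act h := LinearMap.mk₂ R (fun a z => postcomp n (mulC X h a) z)
    (fun a b z => by rw [mulC_add, postcomp_add])
    (fun r a z => by rw [mulC_smul, postcomp_smul])
    (fun a z w => map_add _ _ _) (fun r a z => map_smul _ _ _)
  one_act h a ha z := by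
    refine Eq.trans ?_ (postcomp_id z)
    exact congr_arg (postcomp n · z) (mulC_one X h a ha)
  mul_act h₁ h₂ h₃ a b c hc z := by
    refine Eq.trans ?_ (postcomp_comp (mulC X h₂ b) (mulC X h₃ a) z)
    exact congr_arg (postcomp n · z) (mulC_mul X h₁ h₂ h₃ a b c hc).symm

/-- The complex of graded modules `Hom(G, X)`. -/
def homObj (X : CochainComplex (GrMod 𝒜) ℤ) : CochainComplex (GrMod 𝒜) ℤ where
  X n := homX G X n
  d n m := { app := fun i => δ_hom R G ((twC i).obj X) n m
             comm := fun h a z => δ_postcomp (mulC X h a) z m }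
  shape n m h := by
    ext i z : 2
    exact δ_shape n m h z
  d_comp_d' n m p _ _ := by
    ext i z : 2
    exact δ_δ n m p z

lemma homX_act (X : CochainComplex (GrMod 𝒜) ℤ) (n : ℤ) {i j k : ℤ} (h : i + j = k) (a : 𝒜 i)
    (z : Cochain G ((twC j).obj X) n) :
    (homX G X n).act h a z = postcomp n (mulC X h a) z := rfl

lemma homX_act_v_app (X : CochainComplex (GrMod 𝒜) ℤ) (n : ℤ) {i j k : ℤ} (h : i + j = k)
    (a : 𝒜 i) (z : Cochain G ((twC j).obj X) n) (p q : ℤ) (hpq : p + n = q) (w : ℤ)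
    (x : (G.X p).X w) :
    (Cochain.v ((homX G X n).act h a z : Cochain G ((twC k).obj X) n) p q hpq).app w x =
      (X.X q).act (show i + (w + j) = w + k by lia) a ((z.v p q hpq).app w x) := by
  rw [homX_act, postcomp_v]
  rfl

/-- The functoriality of `homObj`. -/
def homMap {X Y : CochainComplex (GrMod 𝒜) ℤ} (f : X ⟶ Y) : homObj G X ⟶ homObj G Y where
  f n :=
    { app := fun i => postcomp n ((twC i).map f)
      comm := fun {i j k} h a z => by
        refine (postcomp_comp (mulC X h a) ((twC k).map f) z).symm.trans (Eq.trans ?_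
          (postcomp_comp ((twC j).map f) (mulC Y h a) z))
        exact congr_arg (postcomp n · z) (mulC_map f h a).symm }
  comm' n m _ := hom_ext fun i z => δ_postcomp ((twC i).map f) z m

/-- The functor `X ↦ Hom(G, X)` on complexes of graded modules. -/
def homC : CochainComplex (GrMod 𝒜) ℤ ⥤ CochainComplex (GrMod 𝒜) ℤ where
  obj := homObj G
  map := homMap G
  map_id X := HomologicalComplex.Hom.ext (funext fun n => hom_ext fun i z =>
    (congr_arg (postcomp n · z) ((twC i).map_id X)).trans (postcomp_id z))
  map_comp f g := HomologicalComplex.Hom.ext (funext fun n => hom_ext fun i z =>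
    (congr_arg (postcomp n · z) ((twC i).map_comp f g)).trans (postcomp_comp _ _ z))

/-- In weight i the cohomology of Hom(G, X) consists of homotopy classes of maps from G to shifts of
X(i). Twisting is exact, so K-projectivity of `G` suffices weight by weight. -/
lemma quasiIso_homMap [G.IsKProjective] {X Y : CochainComplex (GrMod 𝒜) ℤ} (f : X ⟶ Y)
    [QuasiIso f] : QuasiIso (homMap G f) := by
  rw [quasiIso_iff]
  intro n
  rw [quasiIsoAt_iff' _ (n - 1) n (n + 1) (by simp) (by simp)]
  refine quasiIso_of_elements _ (fun i x hx y hy => ?_) (fun i x hx => ?_)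
  · exact exists_of_postcomp ((twC i).map f) n (n + 1) rfl (n - 1) (by ring) x hx y hy
  · exact exists_postcomp ((twC i).map f) n (n + 1) rfl (n - 1) (by ring) x hx

/-- The functor `X ↦ RHom(G, X)` on the derived category, for a K-projective complex `G`. -/
noncomputable def homD [G.IsKProjective] :
    DerivedCategory (GrMod 𝒜) ⥤ DerivedCategory (GrMod 𝒜) :=
  Localization.lift (homC G ⋙ DerivedCategory.Q)
    (W := HomologicalComplex.quasiIso (GrMod 𝒜) (ComplexShape.up ℤ))
    (fun _ _ f hf => by
      have : QuasiIso f := hf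
      exact (DerivedCategory.isIso_Q_map_iff_quasiIso _ (homMap G f)).2 (quasiIso_homMap G f))
    DerivedCategory.Q

/-- On complexes, `RHom(G, -)` is computed by `Hom(G, -)`. -/
noncomputable def homDFactors [G.IsKProjective] :
    DerivedCategory.Q ⋙ homD G ≅ homC G ⋙ DerivedCategory.Q :=
  Localization.fac _ _ _

end GrMod

namespace GrMod

variable {R A : Type u} [CommRing R] [CommRing A] [Algebra R A]
  {𝒜 : ℤ → Submodule R A} [GradedAlgebra 𝒜]

/-! ### Bilinear maps and dual bases of graded modules -/

/-- Transport along an equality of weights. -/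
def cst (M : GrMod 𝒜) {i j : ℤ} (h : i = j) : M.X i →ₗ[R] M.X j :=
  M.act (by lia) (hone 𝒜)

@[simp] lemma cst_rfl (M : GrMod 𝒜) {i : ℤ} (h : i = i) (x : M.X i) : M.cst h x = x :=
  M.act_hone _ x

@[simp] lemma cst_cst (M : GrMod 𝒜) {i j k : ℤ} (h : i = j) (h' : j = k) (x : M.X i) :
    M.cst h' (M.cst h x) = M.cst (h.trans h') x := by
  subst h h'
  simp

lemma hom_cst {M N : GrMod 𝒜} (f : M ⟶ N) {i j : ℤ} (h : i = j) (x : M.X i) :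
    f.app j (M.cst h x) = N.cst h (f.app i x) := hom_comm f _ _ x

@[simp] lemma act_cst (M : GrMod 𝒜) {i j j' k : ℤ} (h : i + j = k) (h' : j' = j) (a : 𝒜 i)
    (x : M.X j') : M.act h a (M.cst h' x) = M.act (by lia) a x := by
  subst h'
  simp

@[simp] lemma cst_act (M : GrMod 𝒜) {i j k k' : ℤ} (h : i + j = k) (h' : k = k') (a : 𝒜 i)
    (x : M.X j) : M.cst h' (M.act h a x) = M.act (by lia) a x := by
  subst h'
  simp

lemma cst_injective (M : GrMod 𝒜) {i j : ℤ} (h : i = j) : Function.Injective (M.cst h) := by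
  subst h
  intro x y hxy
  simpa using hxy

/-- Transfers the scalar relation `DualPair.compat` to its action on an element, as needed for the
differential of the coevaluation. -/
lemma smul_act_add (M : GrMod 𝒜) {i j k : ℤ} (h : i + j = k) (s : ℤˣ) (a b : 𝒜 i)
    (hab : a + s • b = 0) (x : M.X j) : s • M.act h b x + M.act h a x = 0 := by
  obtain rfl : a = -(s • b) := eq_neg_of_add_eq_zero_left hab
  rcases Int.units_eq_one_or s with rfl | rfl
  · simp
  · simp

/-- `A`-bilinear maps `M × P → N(i)`. -/
structure BiMap (M P N : GrMod 𝒜) (i : ℤ) where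
  /-- the components -/
  app : ∀ {j l k : ℤ}, j + l + i = k → (M.X j →ₗ[R] P.X l →ₗ[R] N.X k)
  act_left : ∀ {e j j' l k k' : ℤ} (hj : e + j = j') (hk : e + k = k') (h : j + l + i = k)
    (h' : j' + l + i = k') (a : 𝒜 e) (x : M.X j) (y : P.X l),
    app h' (M.act hj a x) y = N.act hk a (app h x y)
  act_right : ∀ {e j l l' k k' : ℤ} (hl : e + l = l') (hk : e + k = k') (h : j + l + i = k)
    (h' : j + l' + i = k') (a : 𝒜 e) (x : M.X j) (y : P.X l),
    app h' x (P.act hl a y) = N.act hk a (app h x y)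

/-- A duality between graded modules `P` and `M`, with dual bases. -/
structure ModPair (P M : GrMod 𝒜) where
  /-- the pairing -/
  ev : ∀ {i j k : ℤ}, i + j = k → (P.X i →ₗ[R] M.X j →ₗ[R] 𝒜 k)
  ev_left : ∀ {e i i' j k k' : ℤ} (hi : e + i = i') (h : i + j = k) (h' : i' + j = k')
    (a : 𝒜 e) (l : P.X i) (g : M.X j), (ev h' (P.act hi a l) g : A) = a * ev h l g
  ev_right : ∀ {e i j j' k k' : ℤ} (hj : e + j = j') (h : i + j = k) (h' : i + j' = k')
    (a : 𝒜 e) (l : P.X i) (g : M.X j), (ev h' l (M.act hj a g) : A) = a * ev h l g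
  /-- the number of generators -/
  n : ℕ
  /-- the weights of the generators -/
  deg : Fin n → ℤ
  /-- the generators of `M` -/
  x : ∀ k, M.X (deg k)
  /-- the dual generators of `P` -/
  φ : ∀ k, P.X (-deg k)
  sum_x : ∀ (i : ℤ) (g : M.X i), ∑ k, M.act (sub_add_cancel i (deg k))
    (ev (by lia : -deg k + i = i - deg k) (φ k) g) (x k) = g
  sum_φ : ∀ (i : ℤ) (l : P.X i), ∑ k, P.act (by lia : (i + deg k) + -deg k = i)
    (ev rfl l (x k)) (φ k) = l

namespace ModPair
variable {P M P' M' N N' : GrMod 𝒜}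

/-- The contraction of a bilinear map with the dual bases. -/
def contr (D : ModPair P M) {i : ℤ} (b : BiMap M P N i) : N.X i :=
  ∑ k, b.app (by lia) (D.x k) (D.φ k)

lemma act_ev_congr (D : ModPair P M) (L : GrMod 𝒜) {i j k k' m n : ℤ} (h : i + j = k)
    (h' : i + j = k') (l : P.X i) (g : M.X j) (hk : k + m = n) (hk' : k' + m = n) (z : L.X m) :
    L.act hk (D.ev h l g) z = L.act hk' (D.ev h' l g) z := by
  obtain rfl : k = k' := h.symm.trans h'
  rfl

/-- Contraction is compatible with adjoint maps. -/
lemma sum_adjoint (D : ModPair P M) (D' : ModPair P' M') (f : M ⟶ M') (f' : P' ⟶ P)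
    (s : ℤˣ) (h : ∀ {i j k : ℤ} (hk : i + j = k) (l : P'.X i) (m : M.X j),
      D.ev hk (f'.app i l) m = s • D'.ev hk l (f.app j m)) {i : ℤ} (b : BiMap M' P N i) :
    ∑ k, b.app (by lia : _ = i) (D'.x k) (f'.app _ (D'.φ k)) =
      s • ∑ k, b.app (by lia : _ = i) (f.app _ (D.x k)) (D.φ k) := by
  -- The matrix of `f` in the two dual bases. Up to the sign `s` the same matrix expands `f'` on the
  -- dual generators and `f` on the generators, so both sides become one double sum.
  let c (k l) : 𝒜 (D.deg k - D'.deg l) :=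
    D'.ev (by lia) (D'.φ l) (f.app _ (D.x k))
  have h1 (l) : f'.app _ (D'.φ l) = s • ∑ k, P.act (by lia) (c k l) (D.φ k) := by
    conv_lhs => rw [← D.sum_φ _ (f'.app _ (D'.φ l))]
    rw [Finset.smul_sum]
    refine Finset.sum_congr rfl fun k _ => ?_
    rw [D.act_ev_congr P _ (by lia : _ = D.deg k - D'.deg l) _ _ _ (by lia), h]
    rcases Int.units_eq_one_or s with rfl | rfl
    · simp [c]
    · simp [c]
  have h2 (k) : f.app _ (D.x k) = ∑ l, M'.act (by lia) (c k l) (D'.x l) :=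
    (D'.sum_x _ _).symm
  have h3 (l) : b.app (by lia : _ = i) (D'.x l) (f'.app _ (D'.φ l)) =
      s • ∑ k, N.act (by lia : D.deg k - D'.deg l + (D'.deg l - D.deg k + i) = i)
        (c k l) (b.app (by lia) (D'.x l) (D.φ k)) := by
    rw [h1]
    have h0 : b.app (by lia : D'.deg l + -D'.deg l + i = i) (D'.x l) (∑ k, P.act (by lia) (c k l) (D.φ k)) =
        ∑ k, N.act (by lia : D.deg k - D'.deg l + (D'.deg l - D.deg k + i) = i)
        (c k l) (b.app (by lia) (D'.x l) (D.φ k)) := by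
      rw [map_sum]
      exact Finset.sum_congr rfl fun k _ => b.act_right _ _ _ _ _ _ _
    rcases Int.units_eq_one_or s with rfl | rfl
    · simpa using h0
    · simpa using h0
  have h4 (k) : b.app (by lia : _ = i) (f.app _ (D.x k)) (D.φ k) =
      ∑ l, N.act (by lia : D.deg k - D'.deg l + (D'.deg l - D.deg k + i) = i)
        (c k l) (b.app (by lia) (D'.x l) (D.φ k)) := by
    conv_lhs => rw [h2]
    rw [map_sum, LinearMap.sum_apply]
    exact Finset.sum_congr rfl fun l _ => b.act_left _ _ _ _ _ _ _
  simp_rw [h3, h4]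
  rw [← Finset.smul_sum, Finset.sum_comm]

/-- The map `g ↦ ev(l, g) f`. -/
def rankOne (D : ModPair P M) {i j d : ℤ} (h : i + j = d) (l : P.X i) (f : N.X j) :
    M ⟶ (tw d).obj N where
  app k := (N.act (by lia : (i + k) + j = k + d)).flip f ∘ₗ D.ev rfl l
  comm {e k k'} hk a g := by
    refine Eq.trans ?_ (N.act_act _ (by lia) (p := i + k') (by lia) a _ (D.ev rfl l _)
      (D.ev_right hk rfl rfl a l g).symm f).symm
    rfl

lemma rankOne_add_left (D : ModPair P M) {i j d : ℤ} (h : i + j = d) (l l' : P.X i)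
    (f : N.X j) : D.rankOne h (l + l') f = D.rankOne h l f + D.rankOne h l' f := by
  ext k g
  exact (congr_arg (fun t => N.act _ t f) (LinearMap.map_add₂ _ _ _ _)).trans (LinearMap.map_add₂ _ _ _ _)

lemma rankOne_smul_left (D : ModPair P M) {i j d : ℤ} (h : i + j = d) (r : R) (l : P.X i)
    (f : N.X j) : D.rankOne h (r • l) f = r • D.rankOne h l f := by
  ext k g
  exact (congr_arg (fun t => N.act _ t f) (LinearMap.map_smul₂ _ _ _ _)).trans (LinearMap.map_smul₂ _ _ _ _)

lemma rankOne_add_right (D : ModPair P M) {i j d : ℤ} (h : i + j = d) (l : P.X i)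
    (f f' : N.X j) : D.rankOne h l (f + f') = D.rankOne h l f + D.rankOne h l f' := by
  ext k g
  exact map_add (N.act _ _) _ _

lemma rankOne_smul_right (D : ModPair P M) {i j d : ℤ} (h : i + j = d) (r : R) (l : P.X i)
    (f : N.X j) : D.rankOne h l (r • f) = r • D.rankOne h l f := by
  ext k g
  exact map_smul (N.act _ _) _ _

/-- A scalar may sit on `l` or on `f`. The two rules give the linearity of the coevaluation in `l`
and in `f` respectively. -/
lemma rankOne_act_left (D : ModPair P M) {e i i' j d d' : ℤ} (h : i + j = d) (hi : e + i = i')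
    (h' : i' + j = d') (a : 𝒜 e) (l : P.X i) (f : N.X j) :
    D.rankOne h' (P.act hi a l) f = D.rankOne h l f ≫ mulTw N (by lia) a := by
  ext k g
  exact (N.act_act _ _ _ _ _ _ (D.ev_left hi rfl rfl a l g).symm f).symm

lemma rankOne_act_right (D : ModPair P M) {e i j j' d d' : ℤ} (h : i + j = d) (hj : e + j = j')
    (h' : i + j' = d') (a : 𝒜 e) (l : P.X i) (f : N.X j) :
    D.rankOne h' l (N.act hj a f) = D.rankOne h l f ≫ mulTw N (by lia) a := by
  ext k g
  exact N.act_comm _ _ _ _ _ _ _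

lemma rankOne_map (D : ModPair P M) {i j d : ℤ} (h : i + j = d) (l : P.X i)
    (f : N.X j) (φ : N ⟶ N') :
    D.rankOne h l (φ.app j f) = D.rankOne h l f ≫ (tw d).map φ := by
  ext k g
  exact (hom_comm φ _ _ _).symm

end ModPair

open CochainComplex.HomComplex

/-! ### Cochains with a single nonzero component -/

section Single
variable {K L N : CochainComplex (GrMod 𝒜) ℤ} {p q : ℤ}

lemma single_add (f g : K.X p ⟶ L.X q) (n : ℤ) :
    Cochain.single (f + g) n = Cochain.single f n + Cochain.single g n := by
  ext p' q' h : 1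
  by_cases hp : p' = p
  · subst hp
    by_cases hq : q' = q
    · subst hq
      simp
    · simp [Cochain.single_v_eq_zero' _ _ _ _ _ hq]
  · simp [Cochain.single_v_eq_zero _ _ _ _ _ hp]

lemma single_smul (r : R) (f : K.X p ⟶ L.X q) (n : ℤ) :
    Cochain.single (r • f) n = r • Cochain.single f n := by
  ext p' q' h : 1
  by_cases hp : p' = p
  · subst hp
    by_cases hq : q' = q
    · subst hq
      simp
    · simp [Cochain.single_v_eq_zero' _ _ _ _ _ hq]
  · simp [Cochain.single_v_eq_zero _ _ _ _ _ hp]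

lemma single_units_smul (r : ℤˣ) (f : K.X p ⟶ L.X q) (n : ℤ) :
    Cochain.single (r • f) n = r • Cochain.single f n := by
  ext p' q' h : 1
  by_cases hp : p' = p
  · subst hp
    by_cases hq : q' = q
    · subst hq
      simp
    · simp [Cochain.single_v_eq_zero' _ _ _ _ _ hq]
  · simp [Cochain.single_v_eq_zero _ _ _ _ _ hp]

lemma postcomp_single (f : K.X p ⟶ L.X q) (n : ℤ) (φ : L ⟶ N) :
    postcomp n φ (Cochain.single f n) = Cochain.single (f ≫ φ.f q) n := by
  ext p' q' h : 1
  rw [postcomp_v]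
  by_cases hp : p' = p
  · subst hp
    by_cases hq : q' = q
    · subst hq
      simp
    · simp [Cochain.single_v_eq_zero' _ _ _ _ _ hq]
  · simp [Cochain.single_v_eq_zero _ _ _ _ _ hp]

end Single

/-- A duality between complexes of graded modules `Q` and `G`. -/
structure DualPair (Q G : CochainComplex (GrMod 𝒜) ℤ) where
  /-- the termwise duality -/
  pair : ∀ m p : ℤ, m + p = 0 → ModPair (Q.X m) (G.X p)
  compat : ∀ (m m' p p' : ℤ) (h : m + p = 0) (h' : m' + p' = 0), m + 1 = m' →
    ∀ {i j k : ℤ} (hk : i + j = k) (l : (Q.X m).X i) (g : (G.X p').X j),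
    (pair m' p' h').ev hk ((Q.d m m').app i l) g +
      m.negOnePow • (pair m p h).ev hk l ((G.d p' p).app j g) = 0
  /-- the degrees in which the complexes may be nonzero -/
  S : Finset ℤ
  isZero : ∀ p ∉ S, IsZero (G.X p)

/-! ### Coevaluation for a duality of complexes -/

namespace DualPair
variable {Q G : CochainComplex (GrMod 𝒜) ℤ} (D : DualPair Q G)

/-- The cochain `l ↦ (g ↦ ev(l, g) f)`. -/
def coevV (F : CochainComplex (GrMod 𝒜) ℤ) (n i : ℤ) (f : (F.X n).X i) (m q : ℤ) :
    Q.X m ⟶ ((twC i).obj (homObj G F)).X q where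
  app j :=
    { toFun := fun l => (Cochain.single ((D.pair m (-m) (by lia)).rankOne rfl l f :
        G.X (-m) ⟶ ((twC (j + i)).obj F).X n) q : Cochain G ((twC (j + i)).obj F) q)
      map_add' := fun l l' => by
        exact (congr_arg (Cochain.single (L := (twC (j + i)).obj F) · q)
          (ModPair.rankOne_add_left _ rfl l l' f)).trans (single_add _ _ _)
      map_smul' := fun r l => by
        exact (congr_arg (Cochain.single (L := (twC (j + i)).obj F) · q)
          (ModPair.rankOne_smul_left _ rfl r l f)).trans (single_smul _ _ _) }
  comm {e j k} h a l := by
    refine Eq.trans ?_ (postcomp_single _ q (mulC F (by lia : e + (j + i) = k + i) a)).symm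
    exact congr_arg (Cochain.single (L := (twC (k + i)).obj F) · q)
      (ModPair.rankOne_act_left _ rfl h rfl a l f)

/-- The coevaluation `F ⟶ Hom(Q, Hom(G, F))`, on the terms of the complex. -/
def coevX (F : CochainComplex (GrMod 𝒜) ℤ) (n : ℤ) : F.X n ⟶ homX Q (homObj G F) n where
  app i :=
    { toFun := fun f => (Cochain.mk (fun m q _ => D.coevV F n i f m q) :
        Cochain Q ((twC i).obj (homObj G F)) n)
      map_add' := fun f f' => Cochain.ext _ _ fun m q h => hom_ext fun j l => by
        exact (congr_arg (Cochain.single (L := (twC (j + i)).obj F) · q)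
          (ModPair.rankOne_add_right _ rfl l f f')).trans (single_add _ _ _)
      map_smul' := fun r f => Cochain.ext _ _ fun m q h => hom_ext fun j l => by
        exact (congr_arg (Cochain.single (L := (twC (j + i)).obj F) · q)
          (ModPair.rankOne_smul_right _ rfl r l f)).trans (single_smul _ _ _) }
  comm {e j k} h a f := Cochain.ext _ _ fun m q hq => hom_ext fun i l => by
    refine Eq.trans ?_ (congr_arg (fun t => Hom.app t i l)
      (postcomp_v (mulC (homObj G F) h a) _ m q hq)).symm
    refine Eq.trans ?_ (postcomp_single _ q (mulC F (by lia : e + (i + j) = i + k) a)).symm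
    exact congr_arg (Cochain.single (L := (twC (i + k)).obj F) · q)
      (ModPair.rankOne_act_right _ rfl h rfl a l f)

/-- The coevaluation `F ⟶ Hom(Q, Hom(G, F))`. -/
def coev (F : CochainComplex (GrMod 𝒜) ℤ) : F ⟶ homObj Q (homObj G F) where
  f n := D.coevX F n
  comm' n n' hn := hom_ext fun i f => Cochain.ext _ _ fun m q hq => hom_ext fun j l => by
    obtain rfl : n + 1 = n' := hn
    obtain rfl : q = m + n + 1 := by lia
    refine (congr_arg (fun t => Hom.app t j l) (δ_v n (n + 1) rfl
      ((D.coevX F n).app i f : Cochain Q ((twC i).obj (homObj G F)) n) m _ hq (m + n) (m + 1)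
        (by lia) rfl)).trans ?_
    rw [add_app, units_smul_app]
    let L : CochainComplex (GrMod 𝒜) ℤ := (twC (j + i)).obj F
    let r1 : G.X (-m) ⟶ L.X n := (D.pair m (-m) (by lia)).rankOne rfl l f
    let r2 : G.X (-(m + 1)) ⟶ L.X n :=
      (D.pair (m + 1) (-(m + 1)) (by lia)).rankOne rfl ((Q.d m (m + 1)).app j l) f
    let r3 : G.X (-m) ⟶ L.X (n + 1) := (D.pair m (-m) (by lia)).rankOne rfl l
      ((F.d n (n + 1)).app i f)
    have e1 : r1 ≫ L.d n (n + 1) = r3 :=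
      ((D.pair m (-m) (by lia)).rankOne_map rfl l f (F.d n (n + 1))).symm
    -- `compat` says exactly that the contributions of the differentials of `G` and `Q` cancel.
    have e2 : m.negOnePow • (G.d (-(m + 1)) (-m) ≫ r1) + r2 = 0 := by
      ext k g
      have h := D.compat m (m + 1) (-m) (-(m + 1)) (by lia) (by lia) rfl rfl l g
      exact (F.X n).smul_act_add (by lia : j + k + i = k + (j + i)) _ _ _ h f
    -- The sign of the inner Hom complex in degree m + n is that of the outer one in degree n times
    -- the sign in `compat`.
    have hs : (m + n + 1).negOnePow = (n + 1).negOnePow * m.negOnePow := by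
      rw [add_assoc, add_comm, Int.negOnePow_add]
    change δ (m + n) (m + n + 1) (Cochain.single r1 (m + n)) +
      (n + 1).negOnePow • Cochain.single r2 (m + n + 1) = Cochain.single r3 (m + n + 1)
    rw [Cochain.δ_single r1 (m + n) (m + n + 1) rfl (-(m + 1)) (n + 1) (by lia) rfl, e1,
      add_assoc (Cochain.single r3 _),
      hs, mul_smul, ← single_units_smul,
      ← smul_add, ← single_add, e2]
    simp

end DualPair

end GrMod

/-! ### Evaluation for a duality of complexes -/

namespace GrMod
open CochainComplex.HomComplex

variable {R A : Type u} [CommRing R] [CommRing A] [Algebra R A]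
  {𝒜 : ℤ → Submodule R A} [GradedAlgebra 𝒜]

lemma cst_units_smul (M : GrMod 𝒜) {i j : ℤ} (h : i = j) (s : ℤˣ) (x : M.X i) :
    M.cst h (s • x) = s • M.cst h x := by
  subst h
  simp

/-- The bilinear map attached to a map `M ⟶ Hom(Q, X)(i)`. -/
def uncurry {M : GrMod 𝒜} {Q X : CochainComplex (GrMod 𝒜) ℤ} {i q : ℤ}
    (Φ : M ⟶ (tw i).obj (homX Q X q)) (m n : ℤ) (h : m + q = n) :
    BiMap M (Q.X m) (X.X n) i where
  app {j l k} hk := LinearMap.mk₂ R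
    (fun x y => (X.X n).cst (by lia : l + (j + i) = k)
      ((Cochain.v (Φ.app j x : Cochain Q ((twC (j + i)).obj X) q) m n h).app l y))
    (fun x x' y => by
      rw [map_add]
      exact map_add ((X.X n).cst _) _ _)
    (fun r x y => by
      rw [map_smul]
      exact map_smul ((X.X n).cst _) _ _)
    (fun x y y' => by
      rw [map_add]
      exact map_add ((X.X n).cst _) _ _)
    (fun r x y => by
      rw [map_smul]
      exact map_smul ((X.X n).cst _) _ _)
  act_left {e j j' l k k'} hj hk h₁ h₂ a x y := by
    have h3 := hom_comm Φ hj a x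
    have h4 := homX_act_v_app Q X q (show e + (j + i) = j' + i by lia) a
      (Φ.app j x : Cochain Q ((twC (j + i)).obj X) q) m n h l y
    refine (congr_arg (fun z : Cochain Q ((twC (j' + i)).obj X) q =>
      (X.X n).cst (by lia : l + (j' + i) = k') ((z.v m n h).app l y)) h3).trans ?_
    refine (congr_arg ((X.X n).cst _) h4).trans ?_
    refine (cst_act ..).trans ?_
    exact (act_cst ..).symm
  act_right {e j l l' k k'} hl hk h₁ h₂ a x y := by
    have h3 := hom_comm (Cochain.v (Φ.app j x : Cochain Q ((twC (j + i)).obj X) q) m n h) hl a y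
    refine (congr_arg ((X.X n).cst (by lia : l' + (j + i) = k')) h3).trans ?_
    exact (cst_act ..).trans (act_cst ..).symm

namespace DualPair
variable {Q G : CochainComplex (GrMod 𝒜) ℤ} (D : DualPair Q G)

/-- The contribution of degree `p` to the evaluation. -/
def evalP (X : CochainComplex (GrMod 𝒜) ℤ) (n i p : ℤ)
    (Φ : Cochain G ((twC i).obj (homObj Q X)) n) : (X.X n).X i :=
  (D.pair (-p) p (by lia)).contr (uncurry (Φ.v p (p + n) rfl) (-p) n (by lia))

/-- The evaluation `Hom(G, Hom(Q, X)) ⟶ X`, on the terms of the complex. -/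
def evalX (X : CochainComplex (GrMod 𝒜) ℤ) (n : ℤ) : homX G (homObj Q X) n ⟶ X.X n where
  app i :=
    { toFun := fun Φ => ∑ p ∈ D.S, D.evalP X n i p Φ
      map_add' := fun Φ Φ' => by
        rw [← Finset.sum_add_distrib]
        refine Finset.sum_congr rfl fun p _ => ?_
        unfold evalP ModPair.contr
        rw [← Finset.sum_add_distrib]
        refine Finset.sum_congr rfl fun k _ => ?_
        exact map_add ((X.X n).cst _) _ _
      map_smul' := fun r Φ => by
        rw [Finset.smul_sum]
        refine Finset.sum_congr rfl fun p _ => ?_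
        unfold evalP ModPair.contr
        rw [Finset.smul_sum]
        refine Finset.sum_congr rfl fun k _ => ?_
        exact map_smul ((X.X n).cst _) _ _ }
  comm {e i i'} h a Φ := by
    refine Eq.trans ?_ (map_sum ((X.X n).act h a) _ _).symm
    refine Finset.sum_congr rfl fun p _ => ?_
    unfold evalP ModPair.contr
    rw [map_sum]
    refine Finset.sum_congr rfl fun k _ => ?_
    let P := D.pair (-p) p (by lia)
    have h1 := homX_act_v_app G (homObj Q X) n h a Φ p (p + n) rfl (P.deg k) (P.x k)
    have h2 := homX_act_v_app Q X (p + n) (show e + (P.deg k + i) = P.deg k + i' by lia) a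
      (Hom.app (Φ.v p (p + n) rfl) (P.deg k) (P.x k) : Cochain Q ((twC (P.deg k + i)).obj X) _)
        (-p) n (by lia) (-P.deg k) (P.φ k)
    refine (congr_arg (fun z : Cochain Q ((twC (P.deg k + i')).obj X) (p + n) =>
      (X.X n).cst (by lia : -P.deg k + (P.deg k + i') = i')
        ((z.v (-p) n (by lia)).app (-P.deg k) (P.φ k))) h1).trans ?_
    refine (congr_arg ((X.X n).cst _) h2).trans ?_
    exact (cst_act ..).trans (act_cst ..).symm

/-- The evaluation `Hom(G, Hom(Q, X)) ⟶ X`. -/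
def eval (X : CochainComplex (GrMod 𝒜) ℤ) : homObj G (homObj Q X) ⟶ X where
  f n := D.evalX X n
  comm' n n' hn := hom_ext fun i Φ => by
    obtain rfl : n + 1 = n' := hn
    change Cochain G ((twC i).obj (homObj Q X)) n at Φ
    change Hom.app (X.d n (n + 1)) i (∑ p ∈ D.S, D.evalP X n i p Φ) =
      ∑ p ∈ D.S, D.evalP X (n + 1) i p (δ n (n + 1) Φ)
    let P (p : ℤ) := D.pair (-p) p (by lia)
    -- `c1` and `c2` are the two boundary terms in the evaluation of δΦ: the differential of `Q` on
    -- the dual generators and that of `G` on the generators. The degree `m` is kept variable so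
    -- that -p + 1 can be replaced.
    let c1 (p m : ℤ) (hm : -p + 1 = m) : (X.X (n + 1)).X i :=
      ∑ k, (uncurry (Φ.v p (p + n) rfl) m (n + 1) (by lia)).app
        (by lia : (P p).deg k + -(P p).deg k + i = i) ((P p).x k)
        ((Q.d (-p) m).app _ ((P p).φ k))
    let c2 (p : ℤ) : (X.X (n + 1)).X i :=
      ∑ k, (uncurry (Φ.v (p + 1) (p + 1 + n) rfl) (-p) (n + 1) (by lia)).app
        (by lia : (P p).deg k + -(P p).deg k + i = i)
        ((G.d p (p + 1)).app _ ((P p).x k)) ((P p).φ k)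
    have h1 (p : ℤ) : D.evalP X (n + 1) i p (δ n (n + 1) Φ) =
        Hom.app (X.d n (n + 1)) i (D.evalP X n i p Φ) +
          ((p + (n + 1)).negOnePow • c1 p (-p + 1) rfl + (n + 1).negOnePow • c2 p) := by
      unfold evalP ModPair.contr
      rw [map_sum, Finset.smul_sum, Finset.smul_sum, ← Finset.sum_add_distrib,
        ← Finset.sum_add_distrib]
      refine Finset.sum_congr rfl fun k _ => ?_
      have h3 := δ_v n (n + 1) rfl Φ p (p + (n + 1)) rfl (p + n) (p + 1) (by lia) rfl
      let L : CochainComplex (GrMod 𝒜) ℤ := (twC ((P p).deg k + i)).obj X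
      let z : Cochain Q L (p + n) := (Φ.v p (p + n) rfl).app _ ((P p).x k)
      let w : Cochain Q L (p + (n + 1)) := (Φ.v (p + 1) (p + (n + 1)) (by lia)).app _
        ((G.d p (p + 1)).app _ ((P p).x k))
      have e1 : (Hom.app ((δ n (n + 1) Φ).v p (p + (n + 1)) rfl) _ ((P p).x k) :
          Cochain Q L (p + (n + 1))) =
          δ (p + n) (p + (n + 1)) z + (n + 1).negOnePow • w := by
        refine (congr_arg (fun t => Hom.app t _ ((P p).x k)) h3).trans ?_
        exact congr_arg (fun t : Cochain Q L (p + (n + 1)) => δ (p + n) (p + (n + 1)) z + t)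
          (units_smul_app _ _ _ _)
      have e2 : Hom.app (Cochain.v (δ (p + n) (p + (n + 1)) z + (n + 1).negOnePow • w) (-p) (n + 1)
          (by lia)) _ ((P p).φ k) = Hom.app (z.v (-p) n (by lia) ≫ L.d n (n + 1)) _ ((P p).φ k) +
          ((p + (n + 1)).negOnePow • Hom.app (z.v (-p + 1) (n + 1) (by lia)) _
            ((Q.d (-p) (-p + 1)).app _ ((P p).φ k)) + (n + 1).negOnePow •
            Hom.app (w.v (-p) (n + 1) (by lia)) _ ((P p).φ k)) := by
        rw [Cochain.add_v, δ_v (p + n) (p + (n + 1)) (by lia) z (-p) (n + 1) (by lia) n (-p + 1)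
          (by lia) rfl, Cochain.units_smul_v, add_app, add_app, units_smul_app, units_smul_app,
          add_assoc]
        rfl
      have e3 (q) (hq : p + 1 + n = q) (hk) :
          (uncurry (Φ.v (p + 1) (p + 1 + n) rfl) (-p) (n + 1) (by lia)).app hk
            ((G.d p (p + 1)).app _ ((P p).x k)) ((P p).φ k) =
          (uncurry (Φ.v (p + 1) q hq) (-p) (n + 1) (by lia)).app
            (by lia : (P p).deg k + -(P p).deg k + i = i)
            ((G.d p (p + 1)).app _ ((P p).x k)) ((P p).φ k) := by
        subst hq
        rfl
      rw [e3 (p + (n + 1)) (by lia)]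
      refine (congr_arg (fun t : Cochain Q L (p + (n + 1)) => (X.X (n + 1)).cst
        (by lia : -(P p).deg k + ((P p).deg k + i) = i)
        (Hom.app (t.v (-p) (n + 1) (by lia)) _ ((P p).φ k))) e1).trans ?_
      refine (congr_arg ((X.X (n + 1)).cst _) e2).trans ?_
      refine (map_add ((X.X (n + 1)).cst _) _ _).trans (congr_arg₂ (· + ·) ?_ ?_)
      · exact (hom_cst (X.d n (n + 1)) _ _).symm
      · refine (map_add ((X.X (n + 1)).cst _) _ _).trans (congr_arg₂ (· + ·) ?_ ?_)
        · exact cst_units_smul ..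
        · exact cst_units_smul ..
    -- By `compat` the differentials of `Q` and `G` are adjoint up to sign, so contraction
    -- identifies the first boundary term at p + 1 with the second one at p.
    have h2 (p : ℤ) : c1 (p + 1) (-p) (by lia) = p.negOnePow • c2 p := by
      refine ModPair.sum_adjoint (P p) (P (p + 1)) (G.d p (p + 1)) (Q.d (-(p + 1)) (-p))
        p.negOnePow (fun {i j k} hk l m => ?_) _
      have h3 := D.compat (-(p + 1)) (-p) (p + 1) p (by lia) (by lia) (by lia) hk l m
      rw [add_eq_zero_iff_eq_neg.1 h3, Int.negOnePow_neg, Int.negOnePow_succ, Units.neg_smul,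
        neg_neg]
    have h3 (p m hm) : c1 p m hm = c1 p (-p + 1) rfl := by
      subst hm
      rfl
    have z1 (p) (hp : p ∉ D.S) : c1 p (-p + 1) rfl = 0 := by
      refine Finset.sum_eq_zero fun k _ => ?_
      rw [(isZero_iff _).1 (D.isZero p hp) _ ((P p).x k), map_zero, LinearMap.zero_apply]
    have z2 (p) (hp : p ∉ D.S) : c2 p = 0 := by
      refine Finset.sum_eq_zero fun k _ => ?_
      rw [(isZero_iff _).1 (D.isZero p hp) _ ((P p).x k), map_zero, map_zero,
        LinearMap.zero_apply]
    -- `D.S` need not be stable under translation. As the terms outside it vanish, the sums are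
    -- extended to all of ℤ, where reindexing by p + 1 makes the boundary terms cancel in pairs.
    rw [map_sum, Finset.sum_congr rfl fun p _ => h1 p, Finset.sum_add_distrib, left_eq_add,
      Finset.sum_add_distrib, ← finsum_eq_sum_of_support_subset, ← finsum_eq_sum_of_support_subset,
      ← finsum_comp_equiv (Equiv.addRight (1 : ℤ)), ← finsum_add_distrib]
    · refine finsum_eq_zero_of_forall_eq_zero fun p => ?_
      rw [Equiv.coe_addRight, ← h3 (p + 1) (-p) (by lia), h2, smul_smul,
        show p + 1 + (n + 1) = (n + 1) + p + 1 by lia, Int.negOnePow_succ, Int.negOnePow_add,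
        neg_mul, mul_assoc, ← Int.negOnePow_add, Int.negOnePow_even _ ⟨p, rfl⟩, mul_one,
        Units.neg_smul, neg_add_cancel]
    · refine (D.S.finite_toSet.preimage
        (Equiv.addRight (1 : ℤ)).injective.injOn).subset ?_
      intro p hp
      by_contra h
      exact hp ((congr_arg _ (z1 (p + 1) h)).trans (smul_zero _))
    · refine D.S.finite_toSet.subset ?_
      intro p hp
      by_contra h
      exact hp ((congr_arg _ (z2 p h)).trans (smul_zero _))
    · intro p hp
      by_contra h
      exact hp ((congr_arg _ (z2 p h)).trans (smul_zero _))
    · intro p hp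
      by_contra h
      exact hp ((congr_arg _ (z1 p h)).trans (smul_zero _))

end DualPair

end GrMod

/-! ### Triangle identities and the adjunction between the two Hom functors -/

namespace GrMod
open CochainComplex.HomComplex

variable {R A : Type u} [CommRing R] [CommRing A] [Algebra R A]
  {𝒜 : ℤ → Submodule R A} [GradedAlgebra 𝒜]

lemma uncurry_map {M : GrMod 𝒜} {Q X X' : CochainComplex (GrMod 𝒜) ℤ} {i q : ℤ}
    (Φ : M ⟶ (tw i).obj (homX Q X q)) (Φ' : M ⟶ (tw i).obj (homX Q X' q)) (φ : X ⟶ X')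
    (hΦ : ∀ j (x : M.X j), (Φ'.app j x : Cochain Q ((twC (j + i)).obj X') q) =
      postcomp q ((twC (j + i)).map φ) (Φ.app j x))
    (m n : ℤ) (h : m + q = n) {j l k : ℤ} (hk : j + l + i = k) (x : M.X j) (y : (Q.X m).X l) :
    (uncurry Φ' m n h).app hk x y = (φ.f n).app k ((uncurry Φ m n h).app hk x y) := by
  have e : Cochain.v (Φ'.app j x : Cochain Q ((twC (j + i)).obj X') q) m n h =
      Cochain.v (Φ.app j x : Cochain Q ((twC (j + i)).obj X) q) m n h ≫ (tw (j + i)).map (φ.f n) :=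
    (congr_arg (fun z : Cochain Q ((twC (j + i)).obj X') q => z.v m n h) (hΦ j x)).trans
      (postcomp_v ..)
  exact (congr_arg (fun t : Q.X m ⟶ (tw (j + i)).obj (X'.X n) =>
    (X'.X n).cst (by lia : l + (j + i) = k) (Hom.app t l y)) e).trans (hom_cst (φ.f n) _ _).symm

/-- `Cochain.single` as a linear map. -/
def singleL (K L : CochainComplex (GrMod 𝒜) ℤ) (p q n : ℤ) :
    (K.X p ⟶ L.X q) →ₗ[R] Cochain K L n where
  toFun f := Cochain.single f n
  map_add' f g := single_add f g n
  map_smul' r f := single_smul r f n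

/-- The components of a cochain, as a linear map. -/
def vL (K L : CochainComplex (GrMod 𝒜) ℤ) (p q n : ℤ) (h : p + n = q) :
    Cochain K L n →ₗ[R] (K.X p ⟶ L.X q) where
  toFun z := z.v p q h
  map_add' _ _ := Cochain.add_v ..
  map_smul' _ _ := Cochain.smul_v ..

lemma sum_single_v {K L : CochainComplex (GrMod 𝒜) ℤ} (S : Finset ℤ)
    (hS : ∀ p ∉ S, IsZero (K.X p)) (n : ℤ) (z : Cochain K L n) :
    ∑ p ∈ S, Cochain.single (z.v p (p + n) rfl) n = z := by
  ext p q hpq : 1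
  subst hpq
  refine (map_sum (vL K L p (p + n) n rfl) _ S).trans ?_
  by_cases hp : p ∈ S
  · rw [Finset.sum_eq_single p]
    · exact Cochain.single_v _ n rfl
    · intro p' _ h
      exact Cochain.single_v_eq_zero _ n _ _ rfl h.symm
    · exact fun h => (h hp).elim
  · exact (hS p hp).eq_of_src _ _

namespace ModPair
variable {P M : GrMod 𝒜}

lemma ev_cst_right (D : ModPair P M) {i j j' k : ℤ}
    (hj : j = j') (h : i + j' = k) (l : P.X i) (g : M.X j) :
    D.ev h l (M.cst hj g) = D.ev (by lia) l g := by
  subst hj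
  simp

/-- The opposite duality. -/
def swap (D : ModPair P M) (s : ℤˣ) : ModPair M P where
  ev {i j k} h := s • (D.ev (by lia : j + i = k)).flip
  ev_left hi h h' a g l := by
    rcases Int.units_eq_one_or s with rfl | rfl
    · simpa using D.ev_right hi _ _ a l g
    · simpa using D.ev_right hi _ _ a l g
  ev_right hi h h' a g l := by
    rcases Int.units_eq_one_or s with rfl | rfl
    · simpa using D.ev_left hi _ _ a l g
    · simpa using D.ev_left hi _ _ a l g
  n := D.n
  deg k := -D.deg k
  x k := s • D.φ k
  φ k := M.cst (by simp) (D.x k)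
  sum_x i l := by
    conv_rhs => rw [← D.sum_φ i l]
    refine Finset.sum_congr rfl fun k _ => ?_
    have h := D.ev_cst_right (by lia : D.deg k = - -D.deg k) (by lia : i + - -D.deg k = i - -D.deg k)
      l (D.x k)
    rcases Int.units_eq_one_or s with rfl | rfl
    · simp [h]
      exact D.act_ev_congr P _ _ _ _ _ _ _
    · simp [h]
      exact D.act_ev_congr P _ _ _ _ _ _ _
  sum_φ i g := by
    conv_rhs => rw [← D.sum_x i g]
    refine Finset.sum_congr rfl fun k _ => ?_
    rcases Int.units_eq_one_or s with rfl | rfl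
    · simp
    · simp

end ModPair

namespace DualPair
variable {Q G : CochainComplex (GrMod 𝒜) ℤ} (D : DualPair Q G)

/-- The definition uses the literal degree -m; allowing any p with m + p = 0 avoids transport.
`evalP_eq` does the same for the evaluation. -/
lemma coevX_v_app' (F : CochainComplex (GrMod 𝒜) ℤ) (n i : ℤ) (f : (F.X n).X i) (m p q j : ℤ)
    (hp : m + p = 0) (h : m + n = q) (l : (Q.X m).X j) :
    (Cochain.v ((D.coevX F n).app i f : Cochain Q ((twC i).obj (homObj G F)) n) m q h).app j l =
      (Cochain.single ((D.pair m p hp).rankOne rfl l f :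
        G.X p ⟶ ((twC (j + i)).obj F).X n) q : Cochain G ((twC (j + i)).obj F) q) := by
  obtain rfl : p = -m := by lia
  rfl

lemma evalP_eq (X : CochainComplex (GrMod 𝒜) ℤ) (n i m p q : ℤ) (h : m + p = 0) (hq : p + n = q)
    (Φ : Cochain G ((twC i).obj (homObj Q X)) n) :
    D.evalP X n i p Φ = (D.pair m p h).contr (uncurry (Φ.v p q hq) m n (by lia)) := by
  obtain rfl : m = -p := by lia
  subst hq
  rfl

lemma coev_naturality {F F' : CochainComplex (GrMod 𝒜) ℤ} (φ : F ⟶ F') :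
    φ ≫ D.coev F' = D.coev F ≫ homMap Q (homMap G φ) := by
  ext n i f : 3
  refine Cochain.ext _ _ fun m q hq => hom_ext fun j l => ?_
  refine Eq.trans ?_ (congr_arg (fun t => Hom.app t j l)
    (postcomp_v ((twC i).map (homMap G φ)) _ m q hq)).symm
  refine Eq.trans ?_ (postcomp_single _ q ((twC (j + i)).map φ)).symm
  exact congr_arg (Cochain.single (L := (twC (j + i)).obj F') · q)
    (ModPair.rankOne_map _ rfl l f (φ.f n))

lemma eval_naturality {X X' : CochainComplex (GrMod 𝒜) ℤ} (φ : X ⟶ X') :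
    homMap G (homMap Q φ) ≫ D.eval X' = D.eval X ≫ φ := by
  ext n i Φ : 3
  change Cochain G ((twC i).obj (homObj Q X)) n at Φ
  change ∑ p ∈ D.S, D.evalP X' n i p (postcomp n ((twC i).map (homMap Q φ)) Φ) =
    Hom.app (φ.f n) i (∑ p ∈ D.S, D.evalP X n i p Φ)
  rw [map_sum]
  refine Finset.sum_congr rfl fun p _ => ?_
  rw [evalP, ModPair.contr, evalP, ModPair.contr, map_sum]
  refine Finset.sum_congr rfl fun k _ => uncurry_map _ _ φ (fun j x => ?_) _ _ _ _ _ _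
  exact congr_arg (fun t => Hom.app t j x) (postcomp_v ((twC i).map (homMap Q φ)) Φ p _ rfl)

/-- First triangle identity. In each degree it is the reconstruction of an element from the
generators, `ModPair.sum_x`, pushed through the cochain. -/
lemma homMap_coev_eval (F : CochainComplex (GrMod 𝒜) ℤ) :
    homMap G (D.coev F) ≫ D.eval (homObj G F) = 𝟙 _ := by
  ext n i z : 3
  change Cochain G ((twC i).obj F) n at z
  change ∑ p ∈ D.S, D.evalP (homObj G F) n i p (postcomp n ((twC i).map (D.coev F)) z) = z
  refine Eq.trans (Finset.sum_congr rfl fun p _ => ?_) (sum_single_v D.S D.isZero n z)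
  let P := D.pair (-p) p (by lia)
  let L : CochainComplex (GrMod 𝒜) ℤ := (twC i).obj F
  let zp : G.X p ⟶ L.X (p + n) := z.v p (p + n) rfl
  have e1 (k) : (uncurry ((postcomp n ((twC i).map (D.coev F)) z).v p (p + n) rfl) (-p) n
      (by lia)).app (by lia : P.deg k + -P.deg k + i = i) (P.x k) (P.φ k) =
      Cochain.single (L := L)
        (P.rankOne (N := F.X (p + n)) rfl (P.φ k) (zp.app (P.deg k) (P.x k)) ≫
          mulTw (F.X (p + n)) (by lia : 0 + (-P.deg k + (P.deg k + i)) = i) (hone 𝒜)) n := by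
    refine Eq.trans ?_ (postcomp_single _ n
      (mulC F (by lia : 0 + (-P.deg k + (P.deg k + i)) = i) (hone 𝒜)))
    refine congr_arg (postcomp n (mulC F (by lia) (hone 𝒜))) ?_
    refine Eq.trans ?_ (D.coevX_v_app' F (p + n) (P.deg k + i) (zp.app (P.deg k) (P.x k))
      (-p) p n (-P.deg k) (by lia) (by lia) (P.φ k))
    have h := congr_arg (fun t => Hom.app t (P.deg k) (P.x k))
      (postcomp_v ((twC i).map (D.coev F)) z p (p + n) rfl)
    exact congr_arg (fun t : Cochain Q ((twC (P.deg k + i)).obj (homObj G F)) (p + n) =>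
      Hom.app (t.v (-p) n (by lia)) _ (P.φ k)) h
  have e2 : ∑ k, (P.rankOne (N := F.X (p + n)) rfl (P.φ k) (zp.app (P.deg k) (P.x k)) ≫
          mulTw (F.X (p + n)) (by lia : 0 + (-P.deg k + (P.deg k + i)) = i) (hone 𝒜)) = zp := by
    ext w g
    rw [sum_app]
    conv_rhs => rw [← P.sum_x w g, map_sum]
    refine Finset.sum_congr rfl fun k _ => ?_
    refine Eq.trans ?_ (hom_comm zp _ _ _).symm
    refine ((F.X (p + n)).cst_act _ (by lia : w + (-P.deg k + (P.deg k + i)) = w + i) _ _).trans ?_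
    exact P.act_ev_congr _ _ _ _ _ _ _ _
  unfold evalP ModPair.contr
  refine Eq.trans (Finset.sum_congr rfl fun k _ => e1 k) ?_
  refine (map_sum (singleL G L p (p + n) n) _ _).symm.trans ?_
  exact congr_arg (singleL G L p (p + n) n) e2

/-- Second triangle identity. Coevaluation at an element of degree m is supported in degree -m of
`G`, and there the claim is `ModPair.sum_φ`. -/
lemma coev_homMap_eval (X : CochainComplex (GrMod 𝒜) ℤ) :
    D.coev (homObj Q X) ≫ homMap Q (D.eval X) = 𝟙 _ := by
  ext n i z : 3
  refine Cochain.ext _ _ fun m q hq => hom_ext fun j l => ?_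
  change Cochain Q ((twC i).obj X) n at z
  refine (congr_arg (fun t => Hom.app t j l)
    (postcomp_v ((twC i).map (D.eval X)) _ m q hq)).trans ?_
  let Φ : Cochain G ((twC (j + i)).obj (homObj Q X)) q :=
    Cochain.v ((D.coevX (homObj Q X) n).app i z : Cochain Q _ n) m q hq |>.app j l
  change ∑ p ∈ D.S, D.evalP X q (j + i) p Φ = (z.v m q hq).app j l
  have h0 (p) (hp : m + p ≠ 0) : D.evalP X q (j + i) p Φ = 0 := by
    have e : Φ.v p (p + q) rfl = 0 := Cochain.single_v_eq_zero _ _ _ _ _ (by lia)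
    unfold evalP ModPair.contr
    refine Finset.sum_eq_zero fun k _ => ?_
    refine (congr_arg (fun t => (uncurry t (-p) q (by lia)).app _ _ _) e).trans ?_
    exact map_zero ((X.X q).cst _)
  have h1 (p) (hp : m + p = 0) : D.evalP X q (j + i) p Φ = (z.v m q hq).app j l := by
    let P := D.pair m p hp
    let r : G.X p ⟶ (tw (j + i)).obj (homX Q X n) := P.rankOne rfl l z
    have e : Φ.v p n (by lia) = r := by
      refine (congr_arg (fun t => Cochain.v t p n (by lia))
        (D.coevX_v_app' (homObj Q X) n i z m p q j hp hq l)).trans ?_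
      exact Cochain.single_v ..
    refine (D.evalP_eq X q (j + i) m p n hp (by lia) Φ).trans ?_
    refine (congr_arg (fun t => P.contr (uncurry t m q hq)) e).trans ?_
    conv_rhs => rw [← P.sum_φ j l, map_sum]
    refine Finset.sum_congr rfl fun k _ => ?_
    refine Eq.trans ?_ (hom_comm (z.v m q hq) _ _ _).symm
    refine (congr_arg ((X.X q).cst _) (homX_act_v_app Q X n (by lia) (P.ev rfl l (P.x k)) z m q hq
      _ (P.φ k))).trans ?_
    exact (X.X q).cst_act _ (by lia) _ _
  by_cases hm : -m ∈ D.S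
  · rw [Finset.sum_eq_single (-m)]
    · exact h1 _ (by lia)
    · intro p _ hp
      exact h0 p (by lia)
    · exact fun h => (h hm).elim
  -- If -m is not in `D.S`, the sum has no term in degree -m; the missing term vanishes too, because
  -- `G` is zero in that degree.
  · rw [← h1 (-m) (by lia)]
    refine Eq.trans (Finset.sum_eq_zero fun p hp => h0 p fun h => ?_) ?_
    · obtain rfl : p = -m := by lia
      exact hm hp
    · symm
      unfold evalP ModPair.contr
      refine Finset.sum_eq_zero fun k _ => ?_
      rw [(isZero_iff _).1 (D.isZero _ hm) _ (ModPair.x _ k), map_zero, LinearMap.zero_apply]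

/-- The adjunction between `Hom(G, -)` and `Hom(Q, -)` on complexes. -/
def adjC : homC G ⊣ homC Q where
  unit := { app := D.coev, naturality := fun _ _ φ => D.coev_naturality φ }
  counit := { app := D.eval, naturality := fun _ _ φ => D.eval_naturality φ }
  left_triangle_components F := D.homMap_coev_eval F
  right_triangle_components X := D.coev_homMap_eval X

section
variable [G.IsKProjective] [Q.IsKProjective]

noncomputable instance : CatCommSq (homC G) (DerivedCategory.Q (C := GrMod 𝒜))
    DerivedCategory.Q (homD G) :=
  ⟨(homDFactors G).symm⟩

/-- The adjunction between `RHom(G, -)` and `RHom(Q, -)`. -/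
noncomputable def adjD : homD G ⊣ homD Q :=
  D.adjC.localization DerivedCategory.Q
    (HomologicalComplex.quasiIso (GrMod 𝒜) (ComplexShape.up ℤ)) DerivedCategory.Q
    (HomologicalComplex.quasiIso (GrMod 𝒜) (ComplexShape.up ℤ)) (homD G) (homD Q)

end

/-- The opposite duality. -/
def swap (S : Finset ℤ) (hS : ∀ p ∉ S, IsZero (Q.X p)) : DualPair G Q where
  -- The sign (-1)^p converts the sign in `compat`, indexed by the degree in `Q`, into one indexed
  -- by the degree in `G`.
  pair p m h := (D.pair m p (by lia)).swap p.negOnePow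
  compat p p' m m' h h' hp {i j k} hk g l := by
    have h1 := D.compat m' m p' p (by lia) (by lia) (by lia) (by lia : j + i = k) l g
    have h2 : p'.negOnePow = m'.negOnePow := by
      rw [show p' = -m' by lia, Int.negOnePow_neg]
    change p'.negOnePow • (D.pair m' p' (by lia)).ev (by lia : j + i = k) l _ + p.negOnePow •
      p.negOnePow • (D.pair m p (by lia)).ev (by lia : j + i = k) _ g = 0
    rw [h2, smul_smul, ← Int.negOnePow_add, Int.negOnePow_even _ ⟨p, rfl⟩, one_smul, add_comm]
    exact h1
  S := S
  isZero := hS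

end DualPair

end GrMod

namespace GrMod
open CochainComplex.HomComplex

variable {R A : Type u} [CommRing R] [CommRing A] [Algebra R A]
  {𝒜 : ℤ → Submodule R A} [GradedAlgebra 𝒜]

/-! ### Dual bases of finitely generated projective modules -/

/-- The map `A(d) ⟶ N` sending the generator to `x`. -/
def genMap {N : GrMod 𝒜} {j d : ℤ} (h : j + d = 0) (x : N.X j) : (tw d).obj (self 𝒜) ⟶ N where
  app i := (N.act (by lia : i + d + j = i)).flip x
  comm {e i k} hk a b := (N.act_act _ _ (p := k + d) (by lia) a _ (hmul (by lia) a b) rfl x).symm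

lemma genMap_comp {N N' : GrMod 𝒜} {j d : ℤ} (h : j + d = 0) (x : N.X j) (f : N ⟶ N') :
    genMap h x ≫ f = genMap h (f.app j x) := by
  ext i a
  exact hom_comm f _ _ _

variable (𝒜) in
/-- The generator of `A(d)`. -/
def gen {j d : ℤ} (h : j + d = 0) : 𝒜 (j + d) :=
  ⟨1, h ▸ SetLike.one_mem_graded 𝒜⟩

lemma genMap_gen {N : GrMod 𝒜} {j d : ℤ} (h : j + d = 0) (x : N.X j) :
    (genMap h x).app j (gen 𝒜 h) = x :=
  (N.act_congr (by lia : j + d + j = j) (zero_add j) (gen 𝒜 h) (hone 𝒜) rfl x).trans (N.act_hone (zero_add j) x)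

lemma genMap_eq {N : GrMod 𝒜} {j d : ℤ} (h : j + d = 0) (f : (tw d).obj (self 𝒜) ⟶ N) :
    genMap h (f.app j (gen 𝒜 h)) = f := by
  ext i a
  refine (hom_comm f _ _ _).symm.trans (congr_arg _ ?_)
  exact Subtype.ext (mul_one _)

/-- A(d) corepresents the piece of weight -d, and epimorphisms are surjective in every weight. -/
instance (d : ℤ) : Projective ((tw d).obj (self 𝒜)) where
  factors {E N} f e _ := by
    obtain ⟨y, hy⟩ := surjective_of_epi e (-d) (f.app (-d) (gen 𝒜 (neg_add_cancel d)))
    exact ⟨genMap (neg_add_cancel d) y, by rw [genMap_comp, hy, genMap_eq]⟩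

lemma epi_of_surjective {M N : GrMod 𝒜} (f : M ⟶ N) (hf : ∀ i, Function.Surjective (f.app i)) :
    Epi f where
  left_cancellation g g' h := by
    ext i x
    obtain ⟨x, rfl⟩ := hf i x
    exact congr_arg (fun t => Hom.app t i x) h

instance : HasFiniteBiproducts (GrMod 𝒜) := Abelian.hasFiniteBiproducts

instance {n : ℕ} (M : Fin n → GrMod 𝒜) [∀ k, Projective (M k)] : Projective (⨁ M) where
  factors f e _ := ⟨biproduct.desc fun k => Projective.factorThru (biproduct.ι M k ≫ f) e,
    biproduct.hom_ext' _ _ fun k => by simp⟩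

/-- A finitely generated projective graded module has a finite dual basis. -/
lemma exists_dualBasis (M : GrMod 𝒜) (hM : IsFG M) [Projective M] :
    ∃ (n : ℕ) (d : Fin n → ℤ) (x : ∀ k, M.X (d k)) (φ : ∀ k, M ⟶ (tw (-d k)).obj (self 𝒜)),
      ∑ k, φ k ≫ genMap (add_neg_cancel (d k)) (x k) = 𝟙 M := by
  obtain ⟨n, d, x, hx⟩ := hM
  -- The generators give an epimorphism from a sum of twists of A. It splits since `M` is
  -- projective, and the components of a section are the dual generators.
  let π := biproduct.desc fun k => genMap (add_neg_cancel (d k)) (x k)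
  have : Epi π := epi_of_surjective _ fun i y => by
    obtain ⟨a, rfl⟩ := hx i y
    refine ⟨∑ k, (biproduct.ι (fun k => (tw (-d k)).obj (self 𝒜)) k).app i (a k), ?_⟩
    rw [map_sum]
    refine Finset.sum_congr rfl fun k _ => ?_
    change Hom.app (biproduct.ι _ k ≫ π) i (a k) = _
    rw [biproduct.ι_desc]
    rfl
  let s := Projective.factorThru (𝟙 M) π
  refine ⟨n, d, x, fun k => s ≫ biproduct.π _ k, ?_⟩
  rw [← biproduct.lift_desc, ← Projective.factorThru_comp (𝟙 M) π]
  congr 1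
  ext
  simp [s]

/-- The left module of a duality is projective. -/
lemma ModPair.projective {P M : GrMod 𝒜} (D : ModPair P M) : Projective P := by
  let l (k : Fin D.n) : P ⟶ (tw (D.deg k)).obj (self 𝒜) :=
    { app := fun i => (D.ev rfl).flip (D.x k)
      comm := fun h a y => Subtype.ext (D.ev_left h rfl rfl a y (D.x k)) }
  refine Retract.projective (Y := ⨁ fun k => (tw (D.deg k)).obj (self 𝒜))
    ⟨biproduct.lift l, biproduct.desc fun k => genMap (neg_add_cancel _) (D.φ k), ?_⟩
  rw [biproduct.lift_desc]
  ext i y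
  exact (sum_app _ _ _ _).trans (D.sum_φ i y)

/-! ### Duals -/

/-- The graded dual `Hom_A(M, A)`. -/
def modDual (M : GrMod 𝒜) : GrMod 𝒜 where
  X i := ModuleCat.of R (M ⟶ (tw i).obj (self 𝒜))
  act {e j k} h := LinearMap.mk₂ R
    (fun a (φ : M ⟶ (tw j).obj (self 𝒜)) => φ ≫ mulTw (self 𝒜) h a)
    (fun a b φ => hom_ext fun i x => LinearMap.map_add₂
      ((self 𝒜).act (by lia : e + (i + j) = i + k)) a b (φ.app i x))
    (fun r a φ => hom_ext fun i x => LinearMap.map_smul₂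
      ((self 𝒜).act (by lia : e + (i + j) = i + k)) r a (φ.app i x))
    (fun a φ ψ => Preadditive.add_comp ..) (fun r a φ => Linear.smul_comp ..)
  one_act {j} h a ha φ := hom_ext fun i x =>
    (self 𝒜).one_act (by lia : 0 + (i + j) = i + j) a ha (Hom.app φ i x)
  mul_act {i j l m n p} h₁ h₂ h₃ a b c hc φ := hom_ext fun w x =>
    (self 𝒜).mul_act (by lia : p + (w + l) = w + n) (by lia : j + (w + l) = w + m) (by lia)
      a b c hc (Hom.app φ w x)

lemma self_cst_val {i j : ℤ} (h : i = j) (x : 𝒜 i) : ((self 𝒜).cst h x : 𝒜 j).1 = x := by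
  exact one_mul _

/-- The evaluation pairing. -/
def evDual (M : GrMod 𝒜) {i j k : ℤ} (h : i + j = k) :
    (modDual M).X i →ₗ[R] M.X j →ₗ[R] 𝒜 k :=
  LinearMap.mk₂ R (fun φ g => ((self 𝒜).cst (by lia : j + i = k) (Hom.app φ j g) : 𝒜 k))
    (fun φ ψ g => map_add ((self 𝒜).cst _) _ _) (fun r φ g => map_smul ((self 𝒜).cst _) _ _)
    (fun φ g g' => (congr_arg ((self 𝒜).cst _) (map_add (Hom.app φ j) g g')).trans
      (map_add ((self 𝒜).cst _) _ _))
    (fun r φ g => (congr_arg ((self 𝒜).cst _) (map_smul (Hom.app φ j) r g)).trans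
      (map_smul ((self 𝒜).cst _) _ _))

lemma evDual_val (M : GrMod 𝒜) {i j k : ℤ} (h : i + j = k)
    (φ : M ⟶ (tw i).obj (self 𝒜)) (g : M.X j) :
    (evDual M h φ g : A) = Subtype.val (p := (· ∈ 𝒜 (j + i))) (φ.app j g) :=
  self_cst_val (by lia : j + i = k) _

/-- The duality between a finitely generated projective graded module and its dual. -/
noncomputable def modPair (M : GrMod 𝒜) (hM : IsFG M) [Projective M] : ModPair (modDual M) M where
  ev := evDual M
  ev_left hi h h' a l g := by
    exact (evDual_val M h' _ g).trans (congr_arg ((a : A) * ·) (evDual_val M h l g).symm)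
  ev_right {e i j j' k k'} hj h h' a l g := by
    refine (evDual_val M h' l _).trans (Eq.trans ?_
      (congr_arg ((a : A) * ·) (evDual_val M h l g).symm))
    exact congr_arg Subtype.val (hom_comm l hj a g)
  n := (exists_dualBasis M hM).choose
  deg := (exists_dualBasis M hM).choose_spec.choose
  x := (exists_dualBasis M hM).choose_spec.choose_spec.choose
  φ := (exists_dualBasis M hM).choose_spec.choose_spec.choose_spec.choose
  sum_x i g := by
    have h := (exists_dualBasis M hM).choose_spec.choose_spec.choose_spec.choose_spec
    conv_rhs => rw [← id_app M i g, ← h]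
    rw [sum_app]
    refine Finset.sum_congr rfl fun k _ => ?_
    exact M.act_congr _ _ _ _ (evDual_val ..) _
  sum_φ i l := by
    have h := (exists_dualBasis M hM).choose_spec.choose_spec.choose_spec.choose_spec
    refine hom_ext fun j g => ?_
    refine Eq.trans ?_ (congr_arg (Hom.app l j) (congr_arg (fun t => Hom.app t j g) h))
    rw [sum_app]
    refine Eq.trans ?_ (map_sum (Hom.app l j) _ _).symm
    refine (sum_app _ _ _ _).trans ?_
    refine Finset.sum_congr rfl fun k _ => ?_
    refine Eq.trans ?_ (hom_comm l _ _ _).symm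
    refine Subtype.ext ?_
    exact (congr_arg (· * _) (evDual_val ..)).trans (mul_comm _ _)

/-- The transpose of a map. -/
def transpose {M N : GrMod 𝒜} (f : M ⟶ N) : modDual N ⟶ modDual M where
  app _ := Linear.leftComp R _ f
  comm _ _ _ := rfl

lemma transpose_zero {M N : GrMod 𝒜} : transpose (0 : M ⟶ N) = 0 :=
  hom_ext fun i (φ : N ⟶ (tw i).obj (self 𝒜)) => (zero_comp : (0 : M ⟶ N) ≫ φ = 0)

lemma transpose_comp {M N P : GrMod 𝒜} (f : M ⟶ N) (g : N ⟶ P) :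
    transpose (f ≫ g) = transpose g ≫ transpose f :=
  hom_ext fun i (φ : P ⟶ (tw i).obj (self 𝒜)) => Category.assoc f g φ

/-- The graded dual of a complex. -/
def dualComplex (G : CochainComplex (GrMod 𝒜) ℤ) : CochainComplex (GrMod 𝒜) ℤ where
  X m := modDual (G.X (-m))
  -- With this sign, ev(d l, g) and (-1)^m ev(l, d g) add up to zero, as `DualPair.compat` demands.
  d m m' := (m + 1).negOnePow • transpose (G.d (-m') (-m))
  shape m m' h := by
    rw [G.shape _ _ (by simp at h ⊢; lia), transpose_zero, smul_zero]
  d_comp_d' m m' m'' _ _ := by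
    rw [Linear.units_smul_comp, Linear.comp_units_smul, ← transpose_comp, G.d_comp_d,
      transpose_zero, smul_zero, smul_zero]

/-- The duality of a bounded complex of finitely generated projective modules. -/
noncomputable def dualPair (G : CochainComplex (GrMod 𝒜) ℤ) (hG : ∀ n, IsFG (G.X n))
    [∀ n, Projective (G.X n)] (a b : ℤ) [G.IsStrictlyGE a] [G.IsStrictlyLE b] :
    DualPair (dualComplex G) G where
  pair m p h :=
    -- The dual complex in degree m is by definition the dual of the term in degree -m; the
    -- transport only renames -m to p and disappears after substitution.
    have hp : -m = p := by lia
    hp ▸ modPair (G.X (-m)) (hG _)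
  compat m m' p p' h h' hm i j k hk l g := by
    obtain rfl : p = -m := by lia
    obtain rfl : p' = -m' := by lia
    change (modDual (G.X (-m))).X i at l
    change evDual (G.X (-m')) hk (Hom.app ((m + 1).negOnePow • transpose (G.d (-m') (-m))) i l) g +
      m.negOnePow • evDual (G.X (-m)) hk l ((G.d (-m') (-m)).app j g) = 0
    have h1 : evDual (G.X (-m')) hk (Hom.app (transpose (G.d (-m') (-m))) i l) g =
      evDual (G.X (-m)) hk l ((G.d (-m') (-m)).app j g) := rfl
    rw [units_smul_app, ← h1, Int.negOnePow_succ]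
    rcases Int.units_eq_one_or m.negOnePow with h | h
    · rw [h]
      simp
    · rw [h]
      simp
  S := Finset.Icc a b
  isZero p hp := by
    rw [Finset.mem_Icc, not_and_or, not_le, not_le] at hp
    rcases hp with hp | hp
    · exact G.isZero_of_isStrictlyGE a p
    · exact G.isZero_of_isStrictlyLE b p

lemma isKProjective_dualComplex (G : CochainComplex (GrMod 𝒜) ℤ) (hG : ∀ n, IsFG (G.X n))
    [∀ n, Projective (G.X n)] (a b : ℤ) [G.IsStrictlyGE a] [G.IsStrictlyLE b] :
    (dualComplex G).IsKProjective := by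
  -- Duality reverses degrees: the lower bound of `G` becomes the upper bound that a complex of
  -- projectives needs to be K-projective.
  have : (dualComplex G).IsStrictlyLE (-a) := by
    rw [CochainComplex.isStrictlyLE_iff]
    intro m hm
    have h := (isZero_iff _).1 (G.isZero_of_isStrictlyGE a (-m))
    exact (isZero_iff _).2 fun i φ => hom_ext fun j x => by
      rw [h j x, map_zero, map_zero]
  have hp : ∀ m, Projective ((dualComplex G).X m) := fun m => (modPair (G.X (-m)) (hG _)).projective
  exact CochainComplex.isKProjective_of_projective _ (-a)

end GrMod

namespace GrMod
open CochainComplex.HomComplex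

variable {R A : Type u} [CommRing R] [CommRing A] [Algebra R A]
  {𝒜 : ℤ → Submodule R A} [GradedAlgebra 𝒜]

/-! ### Corepresentability -/

variable (𝒜) in
/-- The complex `A(d)`, in degree `0`. -/
noncomputable abbrev selfC (d : ℤ) : CochainComplex (GrMod 𝒜) ℤ :=
  (HomologicalComplex.single (GrMod 𝒜) (ComplexShape.up ℤ) 0).obj ((tw d).obj (self 𝒜))

/-- The image of the generator. -/
noncomputable def genVal {j d : ℤ} (h : j + d = 0) {Y : CochainComplex (GrMod 𝒜) ℤ}
    (φ : selfC 𝒜 d ⟶ Y) : (Y.X 0).X j :=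
  Hom.app ((HomologicalComplex.singleObjXSelf (ComplexShape.up ℤ) 0 _).inv ≫ φ.f 0) j (gen 𝒜 h)

lemma d_genVal {j d : ℤ} (h : j + d = 0) {Y : CochainComplex (GrMod 𝒜) ℤ}
    (φ : selfC 𝒜 d ⟶ Y) (n : ℤ) : (Y.d 0 n).app j (genVal h φ) = 0 := by
  have : φ.f 0 ≫ Y.d 0 n = 0 := by rw [φ.comm, HomologicalComplex.single_obj_d, zero_comp]
  have h2 : ((HomologicalComplex.singleObjXSelf (ComplexShape.up ℤ) 0 _).inv ≫ φ.f 0) ≫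
      Y.d 0 n = 0 := by rw [Category.assoc, this, comp_zero]
  exact congr_arg (fun t => Hom.app t j (gen 𝒜 h)) h2

/-- The map of complexes with given value on the generator. -/
noncomputable def ofGenVal {j d : ℤ} (h : j + d = 0) {Y : CochainComplex (GrMod 𝒜) ℤ}
    (y : (Y.X 0).X j) (hy : (Y.d 0 1).app j y = 0) : selfC 𝒜 d ⟶ Y :=
  HomologicalComplex.mkHomFromSingle (genMap h y) (by
    rintro k hk
    obtain rfl : 1 = k := by simpa using hk
    rw [genMap_comp, hy]
    exact hom_ext fun i x => map_zero ((Y.X 1).act _ _))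

lemma genVal_ofGenVal {j d : ℤ} (h : j + d = 0) {Y : CochainComplex (GrMod 𝒜) ℤ}
    (y : (Y.X 0).X j) (hy : (Y.d 0 1).app j y = 0) : genVal h (ofGenVal h y hy) = y := by
  unfold genVal ofGenVal
  rw [HomologicalComplex.mkHomFromSingle_f, Iso.inv_hom_id_assoc, genMap_gen]

lemma ofGenVal_genVal {j d : ℤ} (h : j + d = 0) {Y : CochainComplex (GrMod 𝒜) ℤ}
    (φ : selfC 𝒜 d ⟶ Y) : ofGenVal h (genVal h φ) (d_genVal h φ 1) = φ := by
  apply HomologicalComplex.from_single_hom_ext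
  unfold genVal ofGenVal
  rw [HomologicalComplex.mkHomFromSingle_f, genMap_eq, Iso.hom_inv_id_assoc]

/-- Maps from `A(d)` are cocycles. -/
noncomputable def genEquiv {j d : ℤ} (h : j + d = 0) (Y : CochainComplex (GrMod 𝒜) ℤ) :
    (selfC 𝒜 d ⟶ Y) ≃ {y : (Y.X 0).X j // (Y.d 0 1).app j y = 0} where
  toFun φ := ⟨genVal h φ, d_genVal h φ 1⟩
  invFun y := ofGenVal h y.1 y.2
  left_inv φ := ofGenVal_genVal h φ
  right_inv y := Subtype.ext (genVal_ofGenVal h y.1 y.2)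

/-- The twist by `0` is the identity. -/
def twZero (X : CochainComplex (GrMod 𝒜) ℤ) : (twC 0).obj X ≅ X where
  hom := { f := fun n => { app := fun i => (X.X n).cst (add_zero i)
                           comm := fun h a x => ((X.X n).cst_act _ _ _ _).trans
                              ((X.X n).act_cst _ _ _ _).symm }
           comm' := fun m n _ => hom_ext fun i x =>
             hom_cst (X.d m n) (add_zero i) x }
  inv := { f := fun n => { app := fun i => (X.X n).cst (add_zero i).symm
                           comm := fun h a x => ((X.X n).cst_act _ _ _ _).trans
                              ((X.X n).act_cst (by lia) _ _ _).symm }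
           comm' := fun m n _ => hom_ext fun i x =>
             hom_cst (X.d m n) (add_zero i).symm x }
  hom_inv_id := HomologicalComplex.Hom.ext (funext fun n => hom_ext fun i x =>
    ((X.X n).cst_cst (add_zero i) (add_zero i).symm x).trans ((X.X n).cst_rfl rfl x))
  inv_hom_id := HomologicalComplex.Hom.ext (funext fun n => hom_ext fun i x =>
    ((X.X n).cst_cst (add_zero i).symm (add_zero i) x).trans ((X.X n).cst_rfl rfl x))

lemma twZero_naturality {X Y : CochainComplex (GrMod 𝒜) ℤ} (f : X ⟶ Y) :
    (twC 0).map f ≫ (twZero Y).hom = (twZero X).hom ≫ f := by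
  refine HomologicalComplex.Hom.ext (funext fun n => hom_ext fun i x => ?_)
  exact (hom_cst (f.f n) (add_zero i) x).symm

namespace DualPair
variable {Q G : CochainComplex (GrMod 𝒜) ℤ}

/-- Degree zero cocycles of `Hom(G, X)` are maps of complexes. -/
def cocycleEquiv (G X : CochainComplex (GrMod 𝒜) ℤ) :
    {z : ((homObj G X).X 0).X 0 // ((homObj G X).d 0 1).app 0 z = 0} ≃ (G ⟶ X) where
  toFun z := (Cocycle.equivHom G ((twC 0).obj X)).symm (Cocycle.mk z.1 1 rfl z.2) ≫ (twZero X).hom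
  invFun f := ⟨Cochain.ofHom (f ≫ (twZero X).inv), δ_ofHom (f ≫ (twZero X).inv)⟩
  left_inv z := by
    refine Subtype.ext ?_
    dsimp only
    rw [Category.assoc, Iso.hom_inv_id, Category.comp_id]
    exact congr_arg Subtype.val ((Cocycle.equivHom G ((twC 0).obj X)).apply_symm_apply
      (Cocycle.mk z.1 1 rfl z.2))
  right_inv f := by
    dsimp only
    rw [← Iso.eq_comp_inv]
    exact (Cocycle.equivHom G ((twC 0).obj X)).symm_apply_apply (f ≫ (twZero X).inv)

/-- Naturality in the target, needed for the Yoneda argument in `homSelfIso`. -/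
lemma cocycleEquiv_comp {X Y : CochainComplex (GrMod 𝒜) ℤ} (ψ : X ⟶ Y)
    (z : {z : ((homObj G X).X 0).X 0 // ((homObj G X).d 0 1).app 0 z = 0})
    (z' : {z : ((homObj G Y).X 0).X 0 // ((homObj G Y).d 0 1).app 0 z = 0})
    (h : z'.1 = ((homMap G ψ).f 0).app 0 z.1) :
    cocycleEquiv G Y z' = cocycleEquiv G X z ≫ ψ := by
  refine ((cocycleEquiv G Y).symm_apply_eq (x := cocycleEquiv G X z ≫ ψ) (y := z')).1 ?_ |>.symm
  refine Subtype.ext (Eq.trans ?_ h.symm)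
  obtain ⟨f, rfl⟩ := (cocycleEquiv G X).symm.surjective z
  rw [Equiv.apply_symm_apply]
  change Cochain.ofHom ((f ≫ ψ) ≫ (twZero Y).inv) =
    postcomp 0 ((twC 0).map ψ) (Cochain.ofHom (f ≫ (twZero X).inv))
  have : (f ≫ ψ) ≫ (twZero Y).inv = (f ≫ (twZero X).inv) ≫ (twC 0).map ψ := by
    rw [Iso.comp_inv_eq, Category.assoc, Category.assoc, twZero_naturality,
      Iso.inv_hom_id_assoc]
  rw [this, Cochain.ofHom_comp]
  rfl

/-- `Hom(Q, A)` is isomorphic to `G`. -/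
noncomputable def homSelfIso (D : DualPair G Q) : homObj Q (selfC 𝒜 0) ≅ G := by
  -- By adjunction, maps Hom(Q, A) → X are maps A → Hom(G, X), that is, cocycles of degree and
  -- weight zero, that is, maps G → X. The isomorphism follows by Yoneda.
  let e (X : CochainComplex (GrMod 𝒜) ℤ) : (homObj Q (selfC 𝒜 0) ⟶ X) ≃ (G ⟶ X) :=
    (D.adjC.homEquiv (selfC 𝒜 0) X).trans ((genEquiv (zero_add 0) _).trans (cocycleEquiv G X))
  have he {X Y} (φ : homObj Q (selfC 𝒜 0) ⟶ X) (ψ : X ⟶ Y) : e Y (φ ≫ ψ) = e X φ ≫ ψ := by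
    change cocycleEquiv G Y (genEquiv (zero_add 0) _
      (D.adjC.homEquiv (selfC 𝒜 0) Y (φ ≫ ψ))) = cocycleEquiv G X (genEquiv (zero_add 0) _
      (D.adjC.homEquiv (selfC 𝒜 0) X φ)) ≫ ψ
    have h : D.adjC.homEquiv (selfC 𝒜 0) Y (φ ≫ ψ) =
        D.adjC.homEquiv (selfC 𝒜 0) X φ ≫ (homC G).map ψ :=
      D.adjC.homEquiv_naturality_right φ ψ
    refine (congr_arg (fun t : selfC 𝒜 0 ⟶ homObj G Y =>
      cocycleEquiv G Y (genEquiv (zero_add 0) _ t)) h).trans ?_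
    exact cocycleEquiv_comp ψ _ _ rfl
  exact
    { hom := (e _).symm (𝟙 _)
      inv := e _ (𝟙 _)
      hom_inv_id := by
        apply (e _).injective
        rw [he, Equiv.apply_symm_apply, Category.id_comp]
      inv_hom_id := by
        rw [← he, Category.id_comp, Equiv.apply_symm_apply] }

end DualPair

end GrMod

/-! ### Coreflections and decomposition triangles -/

section Decomposition
variable {C : Type u} [Category.{v} C]

/-- `i : T ⟶ X` is the coreflection of `X` in the full subcategory `P`. -/
structure IsCoreflection (P : ObjectProperty C) {T X : C} (i : T ⟶ X) : Prop where
  prop : P T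
  bijective (S : C) (hS : P S) : Function.Bijective (fun g : S ⟶ T => g ≫ i)

namespace IsCoreflection
variable {P : ObjectProperty C} {T T' X : C} {i : T ⟶ X} {i' : T' ⟶ X}

lemma exists_iso (h : IsCoreflection P i) (h' : IsCoreflection P i') :
    ∃ e : T ≅ T', e.hom ≫ i' = i := by
  obtain ⟨a, ha⟩ := (h'.bijective T h.prop).2 i
  obtain ⟨b, hb⟩ := (h.bijective T' h'.prop).2 i'
  dsimp only at ha hb
  refine ⟨⟨a, b, (h.bijective T h.prop).1 ?_, (h'.bijective T' h'.prop).1 ?_⟩, ha⟩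
  · simp [ha, hb]
  · simp [ha, hb]

/-- A right adjoint of a functor preserving `P`, which itself preserves `P`, preserves
coreflections. -/
lemma map (h : IsCoreflection P i) {F G : C ⥤ C} (adj : F ⊣ G) (hF : ∀ S, P S → P (F.obj S))
    (hG : ∀ S, P S → P (G.obj S)) : IsCoreflection P (G.map i) where
  prop := hG _ h.prop
  bijective S hS := by
    have := (adj.homEquiv S X).bijective.comp
      ((h.bijective _ (hF S hS)).comp (adj.homEquiv S T).symm.bijective)
    convert this using 1
    ext g
    simp [Adjunction.homEquiv_unit, Adjunction.homEquiv_counit]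

end IsCoreflection

variable [HasZeroObject C] [HasShift C ℤ] [Preadditive C]
  [∀ n : ℤ, (shiftFunctor C n).Additive] [Pretriangulated C] {P : ObjectProperty C}
  [P.IsStableUnderShift ℤ]

/-- Long exact sequence for maps out of an object of `P`: neither the third vertex nor its shift by
-1 receives nonzero ones. -/
lemma isCoreflection_of_triangle (t : Triangle C) (ht : t ∈ distTriang C) (h₁ : P t.obj₁)
    (h₃ : P.rightOrthogonal t.obj₃) : IsCoreflection P t.mor₁ where
  prop := h₁
  bijective S hS := by
    constructor
    · intro g g' hg
      obtain ⟨φ, hφ⟩ := Triangle.coyoneda_exact₂ _ (inv_rot_of_distTriang _ ht)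
        (g - g') ((Preadditive.sub_comp g g' t.mor₁).trans (sub_eq_zero.2 hg))
      have : φ = 0 := P.rightOrthogonal.le_shift (-1) _ h₃ φ hS
      rw [← sub_eq_zero, hφ, this]
      exact zero_comp
    · intro g
      obtain ⟨φ, hφ⟩ := Triangle.coyoneda_exact₂ _ ht g (h₃ _ hS)
      exact ⟨φ, hφ.symm⟩

/-- Coreflections are unique up to isomorphism, so any given one may replace the first map of the
decomposition triangle. -/
lemma HasDecomposition.exists_triangle (h : HasDecomposition P) {T X : C} {i : T ⟶ X}
    (hi : IsCoreflection P i) : ∃ (Z : C) (p : X ⟶ Z) (δ : Z ⟶ T⟦(1 : ℤ)⟧),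
      P.rightOrthogonal Z ∧ Triangle.mk i p δ ∈ distTriang C := by
  obtain ⟨T', Z, i', p, δ, hT, hZ, hd⟩ := h X
  obtain ⟨e, he⟩ : ∃ e : T ≅ T', e.hom ≫ i' = i :=
    hi.exists_iso (isCoreflection_of_triangle _ hd hT hZ)
  exact ⟨Z, p, δ ≫ e.inv⟦1⟧', hZ, isomorphic_distinguished _ hd _
    (Triangle.isoMk _ _ e (Iso.refl _) (Iso.refl _) ((Category.comp_id i).trans he.symm)
      ((Category.comp_id p).trans (Category.id_comp p).symm) (by
        change (δ ≫ e.inv⟦1⟧') ≫ e.hom⟦1⟧' = 𝟙 Z ≫ δ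
        rw [Category.assoc, ← CategoryTheory.Functor.map_comp, e.inv_hom_id, CategoryTheory.Functor.map_id, Category.comp_id,
          Category.id_comp]))⟩

lemma HasDecomposition.isCoreflection_shift (h : HasDecomposition P) {T X : C} {i : T ⟶ X}
    (hi : IsCoreflection P i) (n : ℤ) :
    ∃ j : T⟦n⟧ ⟶ X⟦n⟧, IsCoreflection P j := by
  obtain ⟨Z, p, δ, hZ, hd⟩ := h.exists_triangle hi
  exact ⟨_, isCoreflection_of_triangle _ (Triangle.shift_distinguished _ hd n)
    (P.le_shift n _ hi.prop) (P.rightOrthogonal.le_shift n _ hZ)⟩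

end Decomposition

/-! ### Local cohomology and the criterion for full faithfulness -/

namespace GrMod

variable {R A : Type u} [CommRing R] [CommRing A] [IsNoetherianRing A] [Algebra R A]
  {𝒜 : ℤ → Submodule R A} [GradedAlgebra 𝒜] (I : HomogeneousIdeal 𝒜)

/-- The counit `RΓ_I X ⟶ X`. -/
noncomputable def lcCounit (X : DerivedCategory (GrMod 𝒜)) : (localCohomology I).obj X ⟶ X :=
  (Adjunction.ofIsLeftAdjoint (dTor I).ι).counit.app X

/-- Restates the adjunction inside the ambient category, so that uniqueness of coreflections applies
to `localCohomology`. -/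
lemma isCoreflection_lcCounit (X : DerivedCategory (GrMod 𝒜)) :
    IsCoreflection (dTor I) (lcCounit I X) where
  prop := ((dTor I).ι.rightAdjoint.obj X).property
  bijective S hS := by
    have h := ((Adjunction.ofIsLeftAdjoint (dTor I).ι).homEquiv ⟨S, hS⟩ X).symm.bijective
    constructor
    · intro g g' hg
      have := @h.1 (ObjectProperty.homMk g) (ObjectProperty.homMk g') (by
        rw [Adjunction.homEquiv_counit, Adjunction.homEquiv_counit]
        exact hg)
      exact congr_arg (fun t => t.hom) this
    · intro g
      obtain ⟨φ, hφ⟩ := h.2 g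
      rw [Adjunction.homEquiv_counit] at hφ
      exact ⟨φ.hom, hφ⟩

variable {I}

/-- The means of computing RΓ_I throughout: exhibit some coreflection. -/
lemma nonempty_lc_iso {T X : DerivedCategory (GrMod 𝒜)} {i : T ⟶ X}
    (hi : IsCoreflection (dTor I) i) : Nonempty ((localCohomology I).obj X ≅ T) :=
  ⟨((isCoreflection_lcCounit I X).exists_iso hi).choose⟩

lemma nonempty_lc_shift_iso (X : DerivedCategory (GrMod 𝒜)) (n : ℤ) :
    Nonempty ((localCohomology I).obj (X⟦n⟧) ≅ ((localCohomology I).obj X)⟦n⟧) :=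
  nonempty_lc_iso ((hasDecomposition_dTor I).isCoreflection_shift
    (isCoreflection_lcCounit I X) n).choose_spec

/-- The unit of the reflection onto `I`-trivial objects sits in the decomposition triangle. -/
lemma exists_cech_triangle (G : DerivedCategory (GrMod 𝒜)) :
    ∃ (Z : DerivedCategory (GrMod 𝒜)) (p : G ⟶ Z) (δ : Z ⟶ ((localCohomology I).obj G)⟦(1 : ℤ)⟧)
      (e : Z ≅ ((cech I).obj G).obj), Triangle.mk (lcCounit I G) p δ ∈ distTriang _ ∧
        p ≫ e.hom = (Adjunction.ofIsRightAdjoint (dTriv I).ι).unit.app G := by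
  let adj := Adjunction.ofIsRightAdjoint (dTriv I).ι
  obtain ⟨Z, p, δ, hZ, hd⟩ :=
    (hasDecomposition_dTor I).exists_triangle (isCoreflection_lcCounit I G)
  -- Torsion objects and their shifts have no nonzero maps to `Y`, so `Z` has the universal property
  -- of the reflection of `G`.
  have key (Y : (dTriv I).FullSubcategory) : Function.Bijective (fun g : Z ⟶ Y.obj => p ≫ g) := by
    constructor
    · intro g g' hg
      obtain ⟨φ, hφ⟩ := Triangle.yoneda_exact₃ _ hd (g - g')
        ((Preadditive.comp_sub p g g').trans (sub_eq_zero.2 hg))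
      have : φ = 0 := Y.property φ ((dTor I).le_shift 1 _ (isCoreflection_lcCounit I G).prop)
      rw [← sub_eq_zero, hφ, this]
      exact comp_zero
    · intro g
      obtain ⟨φ, hφ⟩ := Triangle.yoneda_exact₂ _ hd g
        (Y.property _ (isCoreflection_lcCounit I G).prop)
      exact ⟨φ, hφ.symm⟩
  let L := (dTriv I).ι.leftAdjoint.obj G
  let Z' : (dTriv I).FullSubcategory := ⟨Z, hZ⟩
  let a : L ⟶ Z' := (adj.homEquiv G Z').symm p
  have ha : adj.unit.app G ≫ a.hom = p := by
    have := (adj.homEquiv G Z').apply_symm_apply p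
    rwa [Adjunction.homEquiv_unit] at this
  obtain ⟨b, hb⟩ := (key L).2 (adj.unit.app G)
  dsimp only at hb
  have hba : b ≫ a.hom = 𝟙 Z := (key Z').1 (by
    change p ≫ b ≫ a.hom = p ≫ 𝟙 Z
    rw [← Category.assoc, hb, ha, Category.comp_id])
  have hab : a ≫ ObjectProperty.homMk b = 𝟙 L := (adj.homEquiv G L).injective (by
    rw [Adjunction.homEquiv_unit, Adjunction.homEquiv_unit]
    change adj.unit.app G ≫ a.hom ≫ b = adj.unit.app G ≫ 𝟙 _
    rw [← Category.assoc, ha, hb, Category.comp_id])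
  exact ⟨Z, p, δ, ⟨b, a.hom, hba, congr_arg (fun t => t.hom) hab⟩, hd, hb⟩

/-- On maps, `Č_I` is composition with the unit of the reflection. -/
lemma cech_map_bijective_iff (F G : DerivedCategory (GrMod 𝒜)) :
    Function.Bijective (fun f : F ⟶ G => (cech I).map f) ↔ Function.Bijective (fun f : F ⟶ G =>
      f ≫ (Adjunction.ofIsRightAdjoint (dTriv I).ι).unit.app G) := by
  let adj := Adjunction.ofIsRightAdjoint (dTriv I).ι
  have h : (fun f : F ⟶ G => f ≫ adj.unit.app G) =
      adj.homEquiv F ((cech I).obj G) ∘ (fun f : F ⟶ G => (cech I).map f) := by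
    ext f
    exact (adj.unit.naturality f).trans
      (Adjunction.homEquiv_unit (adj := adj) (Y := (cech I).obj G) (f := (cech I).map f)).symm
  change _ ↔ Function.Bijective (fun f : F ⟶ G => f ≫ adj.unit.app G)
  rw [h]
  exact ((adj.homEquiv F ((cech I).obj G)).comp_bijective _).symm

/-- The functor `Č_I` is fully faithful on a subcategory stable under shifts if and only if there
are no nonzero maps to local cohomology. -/
lemma cech_full_faithful_iff (E : ObjectProperty (DerivedCategory (GrMod 𝒜)))
    [E.IsStableUnderShift ℤ] :
    ((E.ι ⋙ cech I).Full ∧ (E.ι ⋙ cech I).Faithful) ↔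
      ∀ F G, E F → E G → ∀ f : F ⟶ (localCohomology I).obj G, f = 0 := by
  have h1 : ((E.ι ⋙ cech I).Full ∧ (E.ι ⋙ cech I).Faithful) ↔
      ∀ F G, E F → E G → Function.Bijective (fun f : F ⟶ G => (cech I).map f) := by
    constructor
    · rintro ⟨hfull, hfaith⟩ F G hF hG
      constructor
      · intro f f' hf
        exact congr_arg (fun t => t.hom) (hfaith.map_injective (X := ⟨F, hF⟩)
          (Y := ⟨G, hG⟩) (a₁ := ObjectProperty.homMk f) (a₂ := ObjectProperty.homMk f') hf)
      · intro g
        obtain ⟨f, hf⟩ := hfull.map_surjective (X := ⟨F, hF⟩) (Y := ⟨G, hG⟩) g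
        exact ⟨f.hom, hf⟩
    · intro h
      refine ⟨⟨fun {F G} g => ?_⟩, ⟨fun {F G} f f' hf => ?_⟩⟩
      · obtain ⟨f, hf⟩ := (h _ _ F.2 G.2).2 g
        exact ⟨ObjectProperty.homMk f, hf⟩
      · exact ObjectProperty.hom_ext _ ((h _ _ F.2 G.2).1 hf)
  rw [h1]
  have h2 (F G : DerivedCategory (GrMod 𝒜)) (Z : DerivedCategory (GrMod 𝒜)) (p : G ⟶ Z)
      (e : Z ≅ ((cech I).obj G).obj)
      (he : p ≫ e.hom = (Adjunction.ofIsRightAdjoint (dTriv I).ι).unit.app G) :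
      Function.Bijective (fun f : F ⟶ G => (cech I).map f) ↔
        Function.Bijective (fun f : F ⟶ G => f ≫ p) := by
    rw [cech_map_bijective_iff, ← he]
    have : (fun f : F ⟶ G => f ≫ p ≫ e.hom) = e.homToEquiv ∘ (fun f : F ⟶ G => f ≫ p) := by
      ext f
      exact (Category.assoc _ _ _).symm
    refine (Eq.to_iff (congr_arg Function.Bijective this)).trans ?_
    exact e.homToEquiv.comp_bijective _
  constructor
  · intro h F G hF hG f
    obtain ⟨Z, p, δ, e, hd, he⟩ := exists_cech_triangle (I := I) G
    have hb := fun F hF => (h2 F G Z p e he).1 (h F G hF hG)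
    -- Two consecutive maps of the triangle compose to zero, so injectivity of composition with `p`
    -- applies. It follows that f[1] factors through δ.
    have h0 : f ≫ lcCounit I G = 0 := (hb F hF).1 (by
      change (f ≫ lcCounit I G) ≫ p = 0 ≫ p
      rw [zero_comp, Category.assoc]
      exact (congr_arg (f ≫ ·) (comp_distTriang_mor_zero₁₂ _ hd)).trans comp_zero)
    obtain ⟨φ, hφ⟩ := Triangle.coyoneda_exact₁ _ hd (f⟦(1 : ℤ)⟧') (by
      change f⟦(1 : ℤ)⟧' ≫ (lcCounit I G)⟦(1 : ℤ)⟧' = 0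
      rw [← Functor.map_comp, h0, Functor.map_zero])
    -- Surjectivity is used for F[1], which is why `E` must be stable under shifts: the factor goes
    -- through `p`, and `p` followed by δ is zero.
    obtain ⟨ψ, rfl⟩ := (hb (F⟦(1 : ℤ)⟧) (E.le_shift 1 _ hF)).2 φ
    refine (shiftFunctor _ (1 : ℤ)).map_injective (hφ.trans (Eq.trans ?_
      (Functor.map_zero _ _ _).symm))
    refine (Category.assoc _ _ _).trans ?_
    exact (congr_arg (ψ ≫ ·) (comp_distTriang_mor_zero₂₃ _ hd)).trans comp_zero
  · intro h F G hF hG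
    obtain ⟨Z, p, δ, e, hd, he⟩ := exists_cech_triangle (I := I) G
    rw [h2 F G Z p e he]
    constructor
    · intro f f' hf
      obtain ⟨φ, hφ⟩ := Triangle.coyoneda_exact₂ _ hd (f - f')
        ((Preadditive.sub_comp _ _ _).trans (sub_eq_zero.2 hf))
      rw [← sub_eq_zero, hφ, h F G hF hG φ]
      exact zero_comp
    · intro g
      -- The obstruction to lifting `g` lies in Hom(F, RΓ_I G[1]) = Hom(F[-1], RΓ_I G).
      have h0 : g ≫ δ = 0 := by
        have := h (F⟦(-1 : ℤ)⟧) G (E.le_shift (-1) _ hF)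
          (by exact hG) ((g ≫ δ)⟦(-1 : ℤ)⟧' ≫ (shiftShiftNeg _ (1 : ℤ)).hom)
        rw [Preadditive.IsIso.comp_right_eq_zero] at this
        exact (shiftFunctor _ (-1 : ℤ)).map_injective (this.trans (Functor.map_zero _ _ _).symm)
      obtain ⟨φ, hφ⟩ := Triangle.coyoneda_exact₃ _ hd g h0
      exact ⟨φ, hφ.symm⟩

end GrMod

namespace GrMod
open CochainComplex.HomComplex

variable {R A : Type u} [CommRing R] [CommRing A] [Algebra R A]
  {𝒜 : ℤ → Submodule R A} [GradedAlgebra 𝒜]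

/-! ### Local objects -/

section
variable {d : ℤ} (f : 𝒜 d)

lemma isIso_ηD_iff (K : CochainComplex (GrMod 𝒜) ℤ) :
    IsIso ((ηD f).app (DerivedCategory.Q.obj K)) ↔ QuasiIso ((ηC f).app K) := by
  rw [ηD_Q, ← DerivedCategory.isIso_Q_map_iff_quasiIso]
  exact isIso_comp_right_iff _ _

lemma act_loc_bijective (M : GrMod 𝒜) (k : ℕ) {n m : ℤ} (h : (k : ℤ) * d + n = m) :
    Function.Bijective ((locObj f M).act h (pw f k)) := by
  obtain rfl : m = n + k * d := by lia
  exact locAct_bijective f M n k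

variable {K : CochainComplex (GrMod 𝒜) ℤ}

/-- Multiplication by f^k is invertible on K_f, and K → K_f is a quasi-isomorphism; the rest is two
out of three. `quasiIso_actC` is the same on weight pieces. -/
lemma quasiIso_mulC (hK : QuasiIso ((ηC f).app K)) (k : ℕ) {e e' : ℤ}
    (h : (k : ℤ) * d + e = e') : QuasiIso (mulC K h (pw f k)) := by
  have h1 : (twC e).map ((ηC f).app K) ≫ mulC _ h (pw f k) =
      mulC K h (pw f k) ≫ (twC e').map ((ηC f).app K) := mulC_map ((ηC f).app K) h (pw f k)
  have h2 : IsIso (mulC (((loc f).mapHomologicalComplex (ComplexShape.up ℤ)).obj K) h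
      (pw f k)) := by
    have : ∀ n, IsIso ((mulC (((loc f).mapHomologicalComplex (ComplexShape.up ℤ)).obj K) h
      (pw f k)).f n) := fun n =>
        isIso_of_bijective _ fun i => act_loc_bijective f (K.X n) k (by lia)
    exact HomologicalComplex.Hom.isIso_of_components _
  have h3 : QuasiIso (mulC K h (pw f k) ≫ (twC e').map ((ηC f).app K)) := by
    rw [← h1]
    infer_instance
  exact quasiIso_of_comp_right _ ((twC e').map ((ηC f).app K))

lemma quasiIso_actC (hK : QuasiIso ((ηC f).app K)) (k : ℕ) {e e' : ℤ}
    (h : (k : ℤ) * d + e = e') : QuasiIso (actC K h (pw f k)) := by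
  have h1 : (wtC e).map ((ηC f).app K) ≫ actC _ h (pw f k) =
      actC K h (pw f k) ≫ (wtC e').map ((ηC f).app K) := actC_map ((ηC f).app K) h (pw f k)
  have h2 : IsIso (actC (((loc f).mapHomologicalComplex (ComplexShape.up ℤ)).obj K) h
      (pw f k)) := by
    have : ∀ n, IsIso ((actC (((loc f).mapHomologicalComplex (ComplexShape.up ℤ)).obj K) h
      (pw f k)).f n) := fun n =>
        (ConcreteCategory.isIso_iff_bijective _).2 (act_loc_bijective f (K.X n) k h)
    exact HomologicalComplex.Hom.isIso_of_components _
  have h3 : QuasiIso (actC K h (pw f k) ≫ (wtC e').map ((ηC f).app K)) := by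
    rw [← h1]
    infer_instance
  exact quasiIso_of_comp_right _ ((wtC e').map ((ηC f).app K))

/-- The hypotheses say in elements that powers of `f` act bijectively on cohomology. Then all
transition maps of the direct limit computing the cohomology of K_f are bijective, and so is the map
from its first term. -/
lemma quasiIso_ηC_of_elements
    (inj : ∀ (k : ℕ) (l n : ℤ) {i j : ℤ} (h : (k : ℤ) * d + i = j) (x : (K.X n).X i),
      (K.d n (n + 1)).app i x = 0 → l + 1 = n → ∀ y : (K.X l).X j,
      (K.d l n).app j y = (K.X n).act h (pw f k) x → ∃ y', (K.d l n).app i y' = x)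
    (surj : ∀ (k : ℕ) (l n : ℤ) {i j : ℤ} (h : (k : ℤ) * d + i = j) (x : (K.X n).X j),
      (K.d n (n + 1)).app j x = 0 → l + 1 = n → ∃ w y, (K.d n (n + 1)).app i w = 0 ∧
      (K.X n).act h (pw f k) w = x + (K.d l n).app j y) :
    QuasiIso ((ηC f).app K) := by
  rw [quasiIso_iff]
  intro n
  rw [quasiIsoAt_iff' _ (n - 1) n (n + 1) (by simp) (by simp)]
  refine quasiIso_of_elements _ (fun i x hx y hy => ?_) (fun i z hz => ?_)
  · change (K.d n (n + 1)).app i x = 0 at hx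
    change locX f (K.X (n - 1)) i at y
    obtain ⟨k, y, rfl⟩ := exists_frac f _ i y
    have hy' : frac f (K.X n) i k ((K.d (n - 1) n).app _ y) = frac f (K.X n) i k
        ((K.X n).act (add_comm _ _) (pw f k) x) :=
      (locMap_frac f (K.d (n - 1) n) i k y).symm.trans (hy.trans (η_app f (K.X n) i x k))
    rw [← sub_eq_zero, ← map_sub] at hy'
    obtain ⟨l, hl, h⟩ := (frac_eq_zero_iff f _ _ _ _).1 hy'
    rw [map_sub, sub_eq_zero] at h
    refine inj l (n - 1) n (by lia : (l : ℤ) * d + i = i + l * d) x hx (by lia)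
      (trans f _ i k l hl y) ?_
    refine (hom_comm _ _ _ _).trans (h.trans ?_)
    exact (K.X n).act_act _ _ _ _ _ _ (by simp [← pow_add, hl]) x
  · change locX f (K.X n) i at z
    obtain ⟨k, x, rfl⟩ := exists_frac f _ i z
    obtain ⟨l, hl, h⟩ := (frac_eq_zero_iff f _ _ _ _).1
      ((locMap_frac f (K.d n (n + 1)) i k x).symm.trans hz)
    obtain ⟨w, y, hw, h'⟩ := surj l (n - 1) n (by lia : (l : ℤ) * d + i = i + l * d)
      (trans f _ i k l hl x) ((hom_comm _ _ _ _).trans h) (by lia)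
    refine ⟨w, frac f _ i l y, hw, ?_⟩
    refine (η_app f (K.X n) i w l).trans ?_
    refine Eq.trans ?_ (congr_arg₂ (fun a b : locX f (K.X n) i => a + b)
      (frac_trans f (K.X n) i hl x) (locMap_frac f (K.d (n - 1) n) i l y).symm)
    exact (congr_arg (frac f (K.X n) i l) h').trans (map_add _ _ _)

/-- Powers of `f` act on Hom(G, K) by postcomposition with their action on K, a quasi-isomorphism by
locality; K-projectivity of `G` keeps it bijective on cohomology. -/
lemma quasiIso_ηC_homObj (G : CochainComplex (GrMod 𝒜) ℤ) [G.IsKProjective]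
    (hK : QuasiIso ((ηC f).app K)) : QuasiIso ((ηC f).app (homObj G K)) := by
  refine quasiIso_ηC_of_elements f (fun k l n i j h x hx hl y hy => ?_)
    (fun k l n i j h x hx hl => ?_)
  · have := quasiIso_mulC f hK k h
    exact exists_of_postcomp (mulC K h (pw f k)) n (n + 1) rfl l hl x hx y hy
  · have := quasiIso_mulC f hK k h
    exact exists_postcomp (mulC K h (pw f k)) n (n + 1) rfl l hl x hx

/-- As for `quasiIso_ηC_homObj`, with precomposition and K-injectivity of `J`. Dualizing negates
weights, so the action needed goes from weight -j to weight -i. -/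
lemma quasiIso_ηC_dualObj (J : CochainComplex (ModuleCat.{u} R) ℤ) [J.IsKInjective]
    (hK : QuasiIso ((ηC f).app K)) : QuasiIso ((ηC f).app (dualObj J K)) := by
  refine quasiIso_ηC_of_elements f (fun k l n i j h x hx hl y hy => ?_)
    (fun k l n i j h x hx hl => ?_)
  · have := quasiIso_actC f hK k (by lia : (k : ℤ) * d + -j = -i)
    exact exists_of_precomp (actC K _ (pw f k)) n (n + 1) rfl l hl x hx y hy
  · have := quasiIso_actC f hK k (by lia : (k : ℤ) * d + -j = -i)
    exact exists_precomp (actC K _ (pw f k)) n (n + 1) rfl l hl x hx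

/-- `X` is local with respect to `f` if `X ⟶ X_f` is an isomorphism. -/
def IsLocal : ObjectProperty (DerivedCategory (GrMod 𝒜)) := fun X => IsIso ((ηD f).app X)

instance : (IsLocal f).IsClosedUnderIsomorphisms where
  of_iso e h := (NatTrans.isIso_app_iff_of_iso (ηD f) e).1 h

lemma isLocal_locD (X : DerivedCategory (GrMod 𝒜)) : IsLocal f ((locD f).obj X) :=
  inferInstanceAs (IsIso ((ηD f).app ((locD f).obj X)))

lemma isLocal_homD (G : CochainComplex (GrMod 𝒜) ℤ) [G.IsKProjective]
    (X : DerivedCategory (GrMod 𝒜)) (hX : IsLocal f X) : IsLocal f ((homD G).obj X) := by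
  let e := DerivedCategory.Q.objObjPreimageIso X
  refine (IsLocal f).prop_of_iso ((homDFactors G).symm.app _ ≪≫ (homD G).mapIso e) ?_
  exact (isIso_ηD_iff f _).2 (quasiIso_ηC_homObj f G
    ((isIso_ηD_iff f _).1 ((IsLocal f).prop_of_iso e.symm hX)))

/-- On complexes, the dualizing functor is computed by `dual`. -/
noncomputable def dualDFactors (J : CochainComplex (ModuleCat.{u} R) ℤ) [J.IsKInjective] :
    (DerivedCategory.Q (C := GrMod 𝒜)).op ⋙ dualD J ≅ dual J ⋙ DerivedCategory.Q :=
  Localization.fac _ _ _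

lemma isLocal_dualD (J : CochainComplex (ModuleCat.{u} R) ℤ) [J.IsKInjective]
    (X : DerivedCategory (GrMod 𝒜)) (hX : IsLocal f X) : IsLocal f ((dualD J).obj (op X)) := by
  let e := DerivedCategory.Q.objObjPreimageIso X
  refine (IsLocal f).prop_of_iso ((dualDFactors J).symm.app (op _) ≪≫
    (dualD J).mapIso e.symm.op) ?_
  exact (isIso_ηD_iff f _).2 (quasiIso_ηC_dualObj f J
    ((isIso_ηD_iff f _).1 ((IsLocal f).prop_of_iso e.symm hX)))

/-- A left adjoint of a functor preserving local objects preserves objects with `X_f = 0`. -/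
lemma isZero_locD_obj {L G : DerivedCategory (GrMod 𝒜) ⥤ DerivedCategory (GrMod 𝒜)}
    (adj : L ⊣ G) (hG : ∀ X, IsLocal f X → IsLocal f (G.obj X)) (X : DerivedCategory (GrMod 𝒜))
    (hX : IsZero ((locD f).obj X)) : IsZero ((locD f).obj (L.obj X)) := by
  have h0 : (ηD f).app (L.obj X) = 0 := by
    -- The adjoint map has the local target G((L X)_f), so it factors through X_f = 0.
    apply (adj.homEquiv X ((locD f).obj (L.obj X))).injective
    have : ∀ g g' : X ⟶ G.obj ((locD f).obj (L.obj X)), g = g' := fun g g' => by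
      have hl := hG _ (isLocal_locD f (L.obj X))
      have : IsIso ((ηD f).app (G.obj ((locD f).obj (L.obj X)))) := hl
      rw [← cancel_mono ((ηD f).app (G.obj ((locD f).obj (L.obj X))))]
      have h1 := (ηD f).naturality g
      have h2 := (ηD f).naturality g'
      refine h1.trans (Eq.trans ?_ h2.symm)
      exact congr_arg ((ηD f).app X ≫ ·) (hX.eq_of_src _ _)
    exact this _ _
  have h1 : IsIso ((locD f).map ((ηD f).app (L.obj X))) := inferInstance
  -- Localizing L X → (L X)_f gives an isomorphism; as this map is zero, (L X)_f = 0.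
  rw [h0, Functor.map_zero] at h1
  exact (IsZero.iff_id_eq_zero _).2 (isIsoZeroEquiv _ _ h1).1

end

/-- The objects of `D_{I^∞-Tor}` are those killed by localization at generators of `I`. -/
lemma exists_dTor_eq [IsNoetherianRing A] (I : HomogeneousIdeal 𝒜) :
    ∃ l : List (Σ d, 𝒜 d), dTor I = torL l := by
  obtain ⟨l, hl⟩ := exists_generators I
  refine ⟨l, ?_⟩
  ext X
  simp only [dTor, hl, isTorsion_span_iff, torL, isZero_locD_iff]
  exact ⟨fun h f hf n => h n f hf, fun h n f hf => h f hf n⟩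

lemma dTor_obj [IsNoetherianRing A] (I : HomogeneousIdeal 𝒜)
    {L G : DerivedCategory (GrMod 𝒜) ⥤ DerivedCategory (GrMod 𝒜)}
    (adj : L ⊣ G) (hG : ∀ {d : ℤ} (f : 𝒜 d) X, IsLocal f X → IsLocal f (G.obj X))
    (X : DerivedCategory (GrMod 𝒜)) (hX : dTor I X) : dTor I (L.obj X) := by
  obtain ⟨l, hl⟩ := exists_dTor_eq I
  rw [hl] at hX ⊢
  exact fun f hf => isZero_locD_obj f.2 adj (hG f.2) X (hX f hf)

/-- `RHom(G, -)` commutes with local cohomology for a dualizable complex `G`. -/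
lemma nonempty_lc_homD_iso [IsNoetherianRing A] (I : HomogeneousIdeal 𝒜)
    {Q G : CochainComplex (GrMod 𝒜) ℤ} [Q.IsKProjective] [G.IsKProjective]
    (D : DualPair Q G) (D' : DualPair G Q) (X : DerivedCategory (GrMod 𝒜)) :
    Nonempty ((localCohomology I).obj ((homD G).obj X) ≅
      (homD G).obj ((localCohomology I).obj X)) :=
  -- Each of RHom(G, -) and RHom(Q, -) is left adjoint to the other, which preserves local objects;
  -- hence both preserve torsion objects, and RHom(G, -) preserves coreflections.
  nonempty_lc_iso ((isCoreflection_lcCounit I X).map D'.adjD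
    (dTor_obj I D'.adjD (fun f => isLocal_homD f G))
    (dTor_obj I D.adjD (fun f => isLocal_homD f Q)))

/-- The decomposition triangles can be built by extensions from `f`-local objects, `f ∈ l`. -/
lemma exists_triangle_torL (l : List (Σ d, 𝒜 d))
    (P : ObjectProperty (DerivedCategory (GrMod 𝒜))) [P.IsTriangulatedClosed₂]
    [P.IsClosedUnderIsomorphisms] (h₀ : ∀ X, IsZero X → P X) (hP : ∀ f ∈ l, ∀ X, IsLocal f.2 X → P X) :
    ∀ X : DerivedCategory (GrMod 𝒜), ∃ (T Z : DerivedCategory (GrMod 𝒜)) (i : T ⟶ X)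
      (p : X ⟶ Z) (δ : Z ⟶ T⟦(1 : ℤ)⟧), torL l T ∧ (torL l).rightOrthogonal Z ∧ P Z ∧
        Triangle.mk i p δ ∈ distTriang _ := by
  induction l with
  | nil =>
    intro X
    have hz := isZero_zero (DerivedCategory (GrMod 𝒜))
    refine ⟨X, _, 𝟙 X, 0, 0, by simp [torL], fun T φ _ => hz.eq_of_tgt _ _, ?_,
      contractible_distinguished X⟩
    exact h₀ _ hz
  | cons f l ih =>
    intro X
    obtain ⟨T, Z, i, p, δ, hT, hZ, hPZ, hd⟩ := ih (fun g hg => hP g (List.mem_cons_of_mem _ hg)) X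
    -- `K` is the fibre of T → T_f, so it is killed by localization at `f` as well. The octahedron
    -- exhibits the new third vertex as an extension of `Z` and T_f, both in `P`.
    obtain ⟨K, j, w, hK⟩ := distinguished_cocone_triangle₁ ((ηD f.2).app T)
    obtain ⟨Z', p', δ', hZ'⟩ := distinguished_cocone_triangle (j ≫ i)
    have o := Triangulated.someOctahedron rfl hK hd hZ'
    have hle : torL (f :: l) ≤ torL l := fun X hX g hg => hX g (List.mem_cons_of_mem _ hg)
    refine ⟨K, Z', j ≫ i, p', δ', ?_, ?_, ?_, hZ'⟩
    · intro g hg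
      have ht := (locD g.2).map_distinguished _ hK
      rcases List.mem_cons.1 hg with rfl | hg
      · exact Triangle.isZero₁_of_isIso₂ _ ht
          (inferInstanceAs (IsIso ((locD g.2).map ((ηD g.2).app T))))
      · exact Triangle.isZero₁_of_isZero₂₃ _ ht (hT g hg) (isZero_locD_locD f.2 g.2 T (hT g hg))
    · exact ObjectProperty.ext_of_isTriangulatedClosed₂ _ _ o.mem
        (torL_locD f.2 _ List.mem_cons_self T) (fun T' φ hT' => hZ φ (hle _ hT'))
    · exact ObjectProperty.ext_of_isTriangulatedClosed₂ _ _ o.mem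
        (hP f List.mem_cons_self _ (isLocal_locD f.2 T)) hPZ

end GrMod

namespace GrMod
open CochainComplex.HomComplex

variable {R A : Type u} [CommRing R] [CommRing A] [Algebra R A]
  {𝒜 : ℤ → Submodule R A} [GradedAlgebra 𝒜]

/-! ### Biduality -/

section
variable (J : CochainComplex (ModuleCat.{u} R) ℤ)

lemma modCochain_δ_v {K : CochainComplex (ModuleCat.{u} R) ℤ} (n : ℤ) (z : Cochain K J n)
    (p q r : ℤ) (h : p + (n + 1) = q) (hr : p + n = r) (x : K.X p) :
    (δ n (n + 1) z).v p q h x = J.d r q (z.v p r hr x) +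
      (n + 1).negOnePow • z.v (p + 1) q (by lia) (K.d p (p + 1) x) := by
  rw [δ_v n (n + 1) rfl z p q h r (p + 1) (by lia) rfl]
  rfl

/-- The signs in `bidual`: the sign (-1)^(np) for interchanging degrees n and p makes the two terms
in d a cancel. -/
lemma bidual_sign {M N : Type*} [AddCommGroup M] [AddCommGroup N] [Module R M] [Module R N]
    (n p : ℤ) (d : M →ₗ[R] N) (a : M) (b : N) : d ((n * p).negOnePow • a) +
      (n + 1).negOnePow • (n * (p + 1)).negOnePow • (d a + (p + 1).negOnePow • b) =
        ((n + 1) * p).negOnePow • b := by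
  have h1 : d ((n * p).negOnePow • a) = (n * p).negOnePow • d a := by
    rcases Int.units_eq_one_or (n * p).negOnePow with h | h <;> simp [h]
  have h2 : (n + 1).negOnePow * (n * (p + 1)).negOnePow = -(n * p).negOnePow := by
    rw [← Int.negOnePow_add, show n + 1 + n * (p + 1) = (n * p + 1) + (n + n) by ring,
      Int.negOnePow_add, Int.negOnePow_even _ (Even.add_self n), mul_one, Int.negOnePow_succ]
  have h3 : (n * p).negOnePow * (p + 1).negOnePow = -((n + 1) * p).negOnePow := by
    rw [← Int.negOnePow_add, show n * p + (p + 1) = (n + 1) * p + 1 by ring, Int.negOnePow_succ]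
  rw [h1, smul_smul, h2, smul_add, smul_smul, neg_mul, h3, neg_neg, Units.neg_smul]
  abel

/-- The components of the evaluation of cochains at `v`. -/
def bidualV (V : CochainComplex (GrMod 𝒜) ℤ) (n i : ℤ) (v : (V.X n).X i) (p q : ℤ)
    (h : p + n = q) : ((wtC (-i)).obj (dualObj J V)).X p ⟶ J.X q :=
  ModuleCat.ofHom
    { toFun := fun (z : Cochain ((wtC (- -i)).obj V) J p) =>
        (n * p).negOnePow • z.v n q (by lia) ((V.X n).cst (neg_neg i).symm v)
      map_add' := fun z z' => smul_add _ _ _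
      map_smul' := fun r z => smul_comm _ _ _ }

lemma bidualV_apply (V : CochainComplex (GrMod 𝒜) ℤ) (n i : ℤ) (v : (V.X n).X i) (p q : ℤ)
    (h : p + n = q) (z : Cochain ((wtC (- -i)).obj V) J p) :
    bidualV J V n i v p q h z =
      (n * p).negOnePow • z.v n q (by lia) ((V.X n).cst (neg_neg i).symm v) := rfl

/-- The terms of the biduality map. -/
def bidualX (V : CochainComplex (GrMod 𝒜) ℤ) (n : ℤ) : V.X n ⟶ dualX J (dualObj J V) n where
  app i :=
    { toFun := fun v => (Cochain.mk (fun p q h => bidualV J V n i v p q h) :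
        Cochain ((wtC (-i)).obj (dualObj J V)) J n)
      map_add' := fun v v' => cochain_ext fun p q h (z : Cochain ((wtC (- -i)).obj V) J p) => by
        change (n * p).negOnePow • z.v n q _ _ = (n * p).negOnePow • z.v n q _ _ +
          (n * p).negOnePow • z.v n q _ _
        rw [← smul_add]
        exact congr_arg _ ((congr_arg (z.v n q (by lia)) (map_add _ _ _)).trans
          (map_add (z.v n q (by lia)).hom _ _))
      map_smul' := fun r v => cochain_ext fun p q h (z : Cochain ((wtC (- -i)).obj V) J p) => by
        change (n * p).negOnePow • z.v n q _ _ = r • ((n * p).negOnePow • z.v n q _ _)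
        rw [smul_comm r]
        exact congr_arg _ ((congr_arg (z.v n q (by lia)) (map_smul _ _ _)).trans
          (map_smul (z.v n q (by lia)).hom _ _)) }
  comm {i j k} h a v := cochain_ext fun p q hq (z : Cochain ((wtC (- -k)).obj V) J p) => by
    refine Eq.trans ?_ (precomp_v (J := J) (actC (dualObj J V) (by lia : i + -k = -j) a)
      (Cochain.mk (fun p q h => bidualV J V n j v p q h)) p q hq z).symm
    change (n * p).negOnePow • z.v n q _ _ = (n * p).negOnePow •
      (precomp J p (actC V (by lia : i + - -j = - -k) a) z).v n q _ _
    refine congr_arg ((n * p).negOnePow • ·) (Eq.trans ?_ (precomp_v _ z n q _ _).symm)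
    refine congr_arg (z.v n q (by lia)) ?_
    exact ((V.X n).cst_act h (neg_neg k).symm a v).trans
      ((V.X n).act_cst (by lia) (neg_neg j).symm a v).symm

lemma bidualX_v (V : CochainComplex (GrMod 𝒜) ℤ) (n i : ℤ) (v : (V.X n).X i) (p q : ℤ)
    (h : p + n = q) (z : Cochain ((wtC (- -i)).obj V) J p) :
    Cochain.v ((bidualX J V n).app i v : Cochain ((wtC (-i)).obj (dualObj J V)) J n) p q h z =
      (n * p).negOnePow • z.v n q (by lia) ((V.X n).cst (neg_neg i).symm v) := rfl

/-- The biduality map. -/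
def bidual (V : CochainComplex (GrMod 𝒜) ℤ) : V ⟶ dualObj J (dualObj J V) where
  f n := bidualX J V n
  comm' n n' hn := hom_ext fun i v => cochain_ext
      fun p q hq (z : Cochain ((wtC (- -i)).obj V) J p) => by
    obtain rfl : n + 1 = n' := hn
    refine (modCochain_δ_v J n ((bidualX J V n).app i v) p q (p + n) hq rfl z).trans ?_
    refine Eq.trans ?_ (bidualX_v J V (n + 1) i ((V.d n (n + 1)).app i v) p q hq z).symm
    have h1 := bidualX_v J V n i v p (p + n) rfl z
    have h2 := bidualX_v J V n i v (p + 1) q (by lia) (δ p (p + 1) z)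
    have h3 := modCochain_δ_v J p z n q (p + n) (by lia) (by lia)
      ((V.X n).cst (neg_neg i).symm v)
    have h4 := hom_cst (V.d n (n + 1)) (neg_neg i).symm v
    refine (congr_arg₂ (fun a b => J.d (p + n) q a + (n + 1).negOnePow • b) h1 h2).trans ?_
    have h5 : ((wtC (- -i)).obj V).d n (n + 1) ((V.X n).cst (neg_neg i).symm v) =
      (V.X (n + 1)).cst (neg_neg i).symm ((V.d n (n + 1)).app i v) := h4
    have h6 := h3.trans (congr_arg (fun t => J.d (p + n) q (z.v n (p + n) (by lia) _) +
      (p + 1).negOnePow • z.v (n + 1) q (by lia) t) h5)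
    refine (congr_arg (fun t => _ + (n + 1).negOnePow • (n * (p + 1)).negOnePow • t) h6).trans ?_
    exact bidual_sign n p (J.d (p + n) q).hom _ _

lemma bidual_naturality {V W : CochainComplex (GrMod 𝒜) ℤ} (f : V ⟶ W) :
    f ≫ bidual J W = bidual J V ≫ dualMap J (dualMap J f) := by
  refine HomologicalComplex.Hom.ext (funext fun n => hom_ext fun i v => cochain_ext
    fun p q hq (z : Cochain ((wtC (- -i)).obj W) J p) => ?_)
  refine (bidualX_v J W n i ((f.f n).app i v) p q hq z).trans (Eq.trans ?_
    (precomp_v (J := J) ((wtC (-i)).map (dualMap J f)) ((bidualX J V n).app i v) p q hq z).symm)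
  refine Eq.trans ?_ (bidualX_v J V n i v p q hq (precomp J p ((wtC (- -i)).map f) z)).symm
  refine congr_arg ((n * p).negOnePow • ·) (Eq.trans ?_ (precomp_v _ z n q _ _).symm)
  refine congr_arg (z.v n q (by lia)) ?_
  exact (hom_cst (f.f n) (neg_neg i).symm v).symm

/-- Triangle identity for the duality functor as its own adjoint. The signs (-1)^(np) and (-1)^(pn)
multiply to one. -/
lemma bidual_dualMap_bidual (V : CochainComplex (GrMod 𝒜) ℤ) :
    bidual J (dualObj J V) ≫ dualMap J (bidual J V) = 𝟙 _ := by
  refine HomologicalComplex.Hom.ext (funext fun n => hom_ext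
    fun i (ψ : Cochain ((wtC (-i)).obj V) J n) => cochain_ext
    fun p q hq (v : (V.X p).X (-i)) => ?_)
  refine (precomp_v (J := J) ((wtC (-i)).map (bidual J V))
    ((bidualX J (dualObj J V) n).app i ψ) p q hq v).trans ?_
  refine (bidualX_v J (dualObj J V) n i ψ p q hq ((bidualX J V p).app (-i) v)).trans ?_
  refine (congr_arg ((n * p).negOnePow • ·) (bidualX_v J V p (-i) v n q (by lia)
    ((dualX J V n).cst (neg_neg i).symm ψ))).trans ?_
  dsimp only
  rw [smul_smul, ← Int.negOnePow_add, mul_comm p n, Int.negOnePow_even _ (Even.add_self _),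
    one_smul]
  refine (precomp_v (J := J) (actC V (by lia : 0 + - - -i = -i) (hone 𝒜)) ψ p q hq _).trans ?_
  refine congr_arg (ψ.v p q hq) ?_
  exact ((V.X p).cst_cst (neg_neg (-i)).symm (neg_neg (-i)) v).trans ((V.X p).cst_rfl rfl v)

end

end GrMod

namespace GrMod
open CochainComplex.HomComplex ZeroObject

variable {R A : Type u} [CommRing R] [CommRing A] [Algebra R A]
  {𝒜 : ℤ → Submodule R A} [GradedAlgebra 𝒜]

/-! ### The dualizing functor and torsion -/

section
variable (J : CochainComplex (ModuleCat.{u} R) ℤ)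

lemma dualMap_zero {V W : CochainComplex (GrMod 𝒜) ℤ} : dualMap J (0 : V ⟶ W) = 0 := by
  refine HomologicalComplex.Hom.ext (funext fun n => hom_ext
    fun i (ψ : Cochain ((wtC (-i)).obj W) J n) => cochain_ext fun p q hq (v : (V.X p).X (-i)) => ?_)
  exact (precomp_v (J := J) ((wtC (-i)).map (0 : V ⟶ W)) ψ p q hq v).trans
    (map_zero (ψ.v p q hq).hom)

variable [J.IsKInjective]

lemma isZero_dualD {Z : DerivedCategory (GrMod 𝒜)} (hZ : IsZero Z) :
    IsZero ((dualD J).obj (op Z)) := by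
  let K : CochainComplex (GrMod 𝒜) ℤ := 0
  have hK : IsZero K := isZero_zero _
  have h1 : IsZero (dualObj J K) := by
    rw [IsZero.iff_id_eq_zero]
    refine ((dual J).map_id (op K)).symm.trans ?_
    exact (congr_arg (dualMap J) (hK.eq_of_src (𝟙 K) 0)).trans (dualMap_zero J)
  have e : Z ≅ DerivedCategory.Q.obj K := hZ.iso (DerivedCategory.Q.map_isZero hK)
  exact (DerivedCategory.Q.map_isZero h1).of_iso
    ((dualD J).mapIso e.symm.op ≪≫ (dualDFactors J).app (op K))

/-- A zero map factors through a zero object, whose dual is zero; additivity of `dualD` is not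
needed. -/
lemma dualD_map_zero (V W : DerivedCategory (GrMod 𝒜)) :
    (dualD J).map (0 : V ⟶ W).op = 0 := by
  have hz := isZero_zero (DerivedCategory (GrMod 𝒜))
  have : (0 : V ⟶ W) = (0 : V ⟶ 0) ≫ (0 : 0 ⟶ W) := by simp
  rw [this, op_comp, Functor.map_comp, (isZero_dualD J hz).eq_of_tgt ((dualD J).map _) 0, zero_comp]

/-- The dual of a complex computes the dualizing functor. -/
noncomputable def dualDIso (K : CochainComplex (GrMod 𝒜) ℤ) :
    (dualD J).obj (op (DerivedCategory.Q.obj K)) ≅ DerivedCategory.Q.obj (dualObj J K) :=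
  (dualDFactors J).app (op K)

lemma dualDIso_naturality {V W : CochainComplex (GrMod 𝒜) ℤ} (φ : V ⟶ W) :
    (dualD J).map (DerivedCategory.Q.map φ).op ≫ (dualDIso J V).hom =
      (dualDIso J W).hom ≫ DerivedCategory.Q.map (dualMap J φ) :=
  (dualDFactors J).hom.naturality φ.op

lemma exists_Q_iso (X : DerivedCategory (GrMod 𝒜)) :
    ∃ K : CochainComplex (GrMod 𝒜) ℤ, Nonempty (DerivedCategory.Q.obj K ≅ X) :=
  ⟨_, ⟨DerivedCategory.Q.objObjPreimageIso X⟩⟩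

lemma Q_map_dualMap_eq_zero {V W : CochainComplex (GrMod 𝒜) ℤ} (φ : V ⟶ W)
    (hφ : DerivedCategory.Q.map φ = 0) : DerivedCategory.Q.map (dualMap J φ) = 0 := by
  rw [← cancel_epi (dualDIso J W).hom, comp_zero, ← dualDIso_naturality, hφ, dualD_map_zero,
    zero_comp]

/-- Write `g` as a fraction with numerator g' : L' → D K, where L' → L is a quasi-isomorphism. The
transpose K → D L' of g' vanishes by hypothesis, and the triangle identity recovers g' from the dual
of its transpose. -/
lemma eq_zero_of_dual_aux (K L : CochainComplex (GrMod 𝒜) ℤ)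
    (h : ∀ g : DerivedCategory.Q.obj K ⟶ (dualD J).obj (op (DerivedCategory.Q.obj L)), g = 0)
    (g : DerivedCategory.Q.obj L ⟶ DerivedCategory.Q.obj (dualObj J K)) : g = 0 := by
  obtain ⟨L', s, hs, g', rfl⟩ := DerivedCategory.right_fac g
  have h1 : DerivedCategory.Q.map (bidual J K ≫ dualMap J g') = 0 := by
    let e : DerivedCategory.Q.obj (dualObj J L') ≅
        (dualD J).obj (op (DerivedCategory.Q.obj L)) :=
      (dualDIso J L').symm ≪≫ (dualD J).mapIso (asIso (DerivedCategory.Q.map s)).symm.op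
    rw [← cancel_mono e.hom, zero_comp]
    exact h _
  have h2 : g' = bidual J L' ≫ dualMap J (bidual J K ≫ dualMap J g') := by
    have h4 : dualMap J (bidual J K ≫ dualMap J g') =
        dualMap J (dualMap J g') ≫ dualMap J (bidual J K) :=
      (dual J).map_comp (dualMap J g').op (bidual J K).op
    rw [h4, ← Category.assoc, ← bidual_naturality, Category.assoc, bidual_dualMap_bidual,
      Category.comp_id]
  rw [h2, Functor.map_comp, Q_map_dualMap_eq_zero J _ h1, comp_zero, comp_zero]

/-- Maps `W ⟶ D V` correspond to maps `V ⟶ D W`; this is the case of no nonzero maps. -/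
lemma eq_zero_of_dual (V W : DerivedCategory (GrMod 𝒜))
    (h : ∀ g : V ⟶ (dualD J).obj (op W), g = 0) (g : W ⟶ (dualD J).obj (op V)) : g = 0 := by
  obtain ⟨K, ⟨eV⟩⟩ := exists_Q_iso V
  obtain ⟨L, ⟨eW⟩⟩ := exists_Q_iso W
  let e : (dualD J).obj (op V) ≅ DerivedCategory.Q.obj (dualObj J K) :=
    (dualD J).mapIso eV.op ≪≫ dualDIso J K
  have h1 := eq_zero_of_dual_aux J K L (fun g => by
    rw [← cancel_epi eV.inv, ← cancel_mono ((dualD J).mapIso eW.symm.op).hom, comp_zero, zero_comp]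
    exact h _) (eW.hom ≫ g ≫ e.hom)
  rwa [Preadditive.IsIso.comp_left_eq_zero, Preadditive.IsIso.comp_right_eq_zero] at h1

/-- There are no nonzero maps from `I`-trivial objects to duals of torsion objects. -/
lemma eq_zero_of_torL (l : List (Σ d, 𝒜 d)) (Z T : DerivedCategory (GrMod 𝒜))
    (hZ : (torL l).rightOrthogonal Z) (hT : torL l T) (g : Z ⟶ (dualD J).obj (op T)) : g = 0 := by
  -- `P` consists of the objects without nonzero maps to D T. It contains every f-local X with `f`
  -- in `l`: by duality it is enough that maps T → D X vanish, and they do since D X is f-local and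
  -- T_f = 0.
  let P : ObjectProperty (DerivedCategory (GrMod 𝒜)) :=
    fun X => ∀ g : X ⟶ (dualD J).obj (op T), g = 0
  have : P.IsClosedUnderIsomorphisms := ⟨fun e h g => by
    rw [← cancel_epi e.hom, comp_zero]
    exact h _⟩
  have : P.IsTriangulatedClosed₂ := ⟨fun t ht h₁ h₃ => P.le_isoClosure _ fun g => by
    obtain ⟨φ, hφ⟩ := Triangle.yoneda_exact₂ _ ht g (h₁ _)
    rw [hφ, h₃ φ, comp_zero]⟩
  obtain ⟨T', Z', i, p, δ, hT', -, hPZ', hd⟩ := exists_triangle_torL l P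
    (fun X hX g => hX.eq_of_src _ _) (fun f hf X hX => eq_zero_of_dual J _ _ fun g => by
      have hl := isLocal_dualD f.2 J X hX
      have : IsIso ((ηD f.2).app ((dualD J).obj (op X))) := hl
      rw [← cancel_mono ((ηD f.2).app ((dualD J).obj (op X))), zero_comp]
      refine ((ηD f.2).naturality g).trans ?_
      rw [(hT f hf).eq_of_tgt ((ηD f.2).app T) 0, zero_comp]) Z
  -- T' is torsion and `Z` is orthogonal to torsion objects, so T' → Z is zero and `g` factors
  -- through Z', which lies in `P`.
  obtain ⟨φ, hφ⟩ := Triangle.yoneda_exact₂ _ hd g (by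
    change i ≫ g = 0
    rw [hZ i hT', zero_comp])
  rw [hφ, hPZ' φ]
  exact comp_zero

variable [IsNoetherianRing A] (I : HomogeneousIdeal 𝒜)

/-- Trivial objects have no nonzero maps to duals of torsion objects, so vanishing of Hom(V, D RΓ W)
passes to Hom(RΓ V, D RΓ W), by duality to Hom(RΓ W, D RΓ V), and from there to Hom(W, D RΓ V). -/
lemma eq_zero_dual_lc (V W : DerivedCategory (GrMod 𝒜))
    (h : ∀ g : V ⟶ (dualD J).obj (op ((localCohomology I).obj W)), g = 0)
    (g : W ⟶ (dualD J).obj (op ((localCohomology I).obj V))) : g = 0 := by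
  have key (Z T) (hZ : dTriv I Z) (hT : dTor I T) (g : Z ⟶ (dualD J).obj (op T)) : g = 0 := by
    obtain ⟨l, hl⟩ := exists_dTor_eq I
    rw [dTriv, hl] at hZ
    rw [hl] at hT
    exact eq_zero_of_torL J l Z T hZ hT g
  have hV := isCoreflection_lcCounit I V
  have hW := isCoreflection_lcCounit I W
  obtain ⟨Z, p, δ, hZ, hd⟩ := (hasDecomposition_dTor I).exists_triangle hV
  obtain ⟨Z', p', δ', hZ', hd'⟩ := (hasDecomposition_dTor I).exists_triangle hW
  have h1 : ∀ g : (localCohomology I).obj V ⟶ (dualD J).obj (op ((localCohomology I).obj W)),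
      g = 0 := fun g => by
    obtain ⟨φ, hφ⟩ := Triangle.yoneda_exact₂ _ (inv_rot_of_distTriang _ hd) g
      (key _ _ ((dTor I).rightOrthogonal.le_shift (-1) _ hZ) hW.prop _)
    rw [hφ, h φ]
    exact comp_zero
  obtain ⟨φ, hφ⟩ := Triangle.yoneda_exact₂ _ hd' g (eq_zero_of_dual J _ _ h1 _)
  rw [hφ, key _ _ hZ' hV.prop φ]
  exact comp_zero

end

end GrMod

namespace GrMod
open CochainComplex.HomComplex

variable {R A : Type u} [CommRing R] [CommRing A] [Algebra R A]
  {𝒜 : ℤ → Submodule R A} [GradedAlgebra 𝒜]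

/-! ### Shifts -/

section
variable (G X : CochainComplex (GrMod 𝒜) ℤ) (a : ℤ)

lemma rightUnshift_v' {Y : CochainComplex (GrMod 𝒜) ℤ} (n : ℤ) (z : Cochain G (Y⟦a⟧) n) (p : ℤ) :
    (z.rightUnshift (n + a) rfl).v p (p + n + a) (by lia) = z.v p (p + n) rfl := by
  rw [Cochain.rightUnshift_v z (n + a) rfl p (p + n + a) (by lia) (p + n) rfl]
  exact Category.comp_id _

/-- The comparison of `Hom(G, X[a])` and `Hom(G, X)[a]`. -/
def homShift : homObj G (X⟦a⟧) ⟶ (homObj G X)⟦a⟧ where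
  f n :=
    { app := fun i =>
        { toFun := fun (z : Cochain G (((twC i).obj X)⟦a⟧) n) => z.rightUnshift (n + a) rfl
          map_add' := fun z z' => Cochain.rightUnshift_add _ _ _ _
          map_smul' := fun r z => Cochain.rightUnshift_smul _ _ _ _ }
      comm := fun {i j k} h b (z : Cochain G (((twC j).obj X)⟦a⟧) n) =>
        grCochain_ext fun p q hpq w x => by
          obtain rfl : p + n + a = q := by lia
          refine (congr_arg (fun t : G.X p ⟶ ((twC k).obj X).X (p + n + a) => Hom.app t w x)
            (rightUnshift_v' (Y := (twC k).obj X) G a n (postcomp n (mulC (X⟦a⟧) h b) z :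
              Cochain G (((twC k).obj X)⟦a⟧) n) p)).trans ?_
          refine Eq.trans ?_ (homX_act_v_app G X (n + a) h b (z.rightUnshift (n + a) rfl) p
            (p + n + a) hpq w x).symm
          refine Eq.trans ?_ (congr_arg (fun t : G.X p ⟶ ((twC j).obj X).X (p + n + a) =>
            (X.X (p + n + a)).act (by lia : i + (w + j) = w + k) b (Hom.app t w x))
            (rightUnshift_v' (Y := (twC j).obj X) G a n z p)).symm
          rfl }
  comm' n m hnm := hom_ext fun i (z : Cochain G (((twC i).obj X)⟦a⟧) n) => by
    -- The sign (-1)^a from moving the shift past δ cancels the sign in the differential of a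
    -- shifted complex.
    have h := Cochain.δ_rightUnshift z (n + a) rfl (m + a) m rfl
    refine (units_smul_app a.negOnePow ((homObj G X).d (n + a) (m + a)) i
      (z.rightUnshift (n + a) rfl)).trans ?_
    refine (congr_arg (a.negOnePow • ·) h).trans ?_
    refine (smul_smul a.negOnePow a.negOnePow ((δ n m z).rightUnshift (m + a) rfl)).trans ?_
    rw [Int.units_mul_self, one_smul]
    rfl

instance : IsIso (homShift G X a) := by
  have : ∀ n, IsIso ((homShift G X a).f n) := fun n => isIso_of_bijective _ fun i =>
    (Cochain.rightShiftAddEquiv G ((twC i).obj X) (n + a) a n rfl).symm.bijective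
  exact HomologicalComplex.Hom.isIso_of_components _

lemma nonempty_homD_shift_iso [G.IsKProjective] (X : DerivedCategory (GrMod 𝒜)) :
    Nonempty ((homD G).obj (X⟦a⟧) ≅ ((homD G).obj X)⟦a⟧) := by
  obtain ⟨K, ⟨e⟩⟩ := exists_Q_iso X
  exact ⟨(homD G).mapIso ((shiftFunctor _ a).mapIso e.symm ≪≫
      ((DerivedCategory.Q (C := GrMod 𝒜)).commShiftIso a).symm.app K) ≪≫
    (homDFactors G).app (K⟦a⟧) ≪≫ DerivedCategory.Q.mapIso (asIso (homShift G K a)) ≪≫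
    ((DerivedCategory.Q (C := GrMod 𝒜)).commShiftIso a).app (homObj G K) ≪≫
    (shiftFunctor _ a).mapIso ((homDFactors G).symm.app K ≪≫ (homD G).mapIso e)⟩

end

/-! ### Perfect complexes -/

/-- A bounded complex of finitely generated projective graded modules. -/
structure IsPerf (K : CochainComplex (GrMod 𝒜) ℤ) : Prop where
  bounded : ∃ a b : ℤ, K.IsStrictlyGE a ∧ K.IsStrictlyLE b
  projective (n : ℤ) : Projective (K.X n)
  isFG (n : ℤ) : IsFG (K.X n)

lemma dPerf.exists_isPerf {X : DerivedCategory (GrMod 𝒜)} (hX : dPerf 𝒜 X) :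
    ∃ K : CochainComplex (GrMod 𝒜) ℤ, IsPerf K ∧ Nonempty (X ≅ DerivedCategory.Q.obj K) := by
  obtain ⟨K, hb, h, e⟩ := hX
  exact ⟨K, ⟨hb, fun n => (h n).1, fun n => (h n).2⟩, e⟩

lemma IsPerf.isKProjective {K : CochainComplex (GrMod 𝒜) ℤ} (hK : IsPerf K) :
    K.IsKProjective := by
  obtain ⟨a, b, _, _⟩ := hK.bounded
  have := hK.projective
  exact CochainComplex.isKProjective_of_projective _ b

/-- Both directions of the duality are recorded, since both adjunctions between RHom(K, -) and
RHom(Q, -) are used. -/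
lemma IsPerf.exists_dual {K : CochainComplex (GrMod 𝒜) ℤ} (hK : IsPerf K) :
    ∃ Q : CochainComplex (GrMod 𝒜) ℤ, Q.IsKProjective ∧ Nonempty (DualPair Q K) ∧
      Nonempty (DualPair K Q) := by
  obtain ⟨a, b, _, _⟩ := hK.bounded
  have := hK.projective
  let D := dualPair K hK.isFG a b
  refine ⟨dualComplex K, isKProjective_dualComplex K hK.isFG a b, ⟨D⟩,
    ⟨D.swap (Finset.Icc (-b) (-a)) fun p hp => (isZero_iff _).2 fun i φ => ?_⟩⟩
  have h : IsZero (K.X (-p)) := by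
    rw [Finset.mem_Icc, not_and_or, not_le, not_le] at hp
    rcases hp with hp | hp
    · exact K.isZero_of_isStrictlyLE b (-p)
    · exact K.isZero_of_isStrictlyGE a (-p)
  exact hom_ext fun j x => by
    rw [(isZero_iff _).1 h j x, map_zero, map_zero]

lemma nonempty_selfD_iso : Nonempty (selfD 𝒜 ≅ DerivedCategory.Q.obj (selfC 𝒜 0)) := by
  have e : self 𝒜 ≅ (tw 0).obj (self 𝒜) :=
    { hom := { app := fun i => (self 𝒜).cst (add_zero i).symm
               comm := fun h a x => ((self 𝒜).cst_act _ _ _ _).trans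
                  ((self 𝒜).act_cst (by lia) _ _ _).symm }
      inv := { app := fun i => (self 𝒜).cst (add_zero i)
               comm := fun h a x => ((self 𝒜).cst_act (by lia) _ _ _).trans
                  ((self 𝒜).act_cst h _ _ _).symm }
      hom_inv_id := hom_ext fun i x =>
        ((self 𝒜).cst_cst (add_zero i).symm (add_zero i) x).trans ((self 𝒜).cst_rfl rfl x)
      inv_hom_id := hom_ext fun i x =>
        ((self 𝒜).cst_cst (add_zero i) (add_zero i).symm x).trans ((self 𝒜).cst_rfl rfl x) }
  exact ⟨(DerivedCategory.singleFunctor _ 0).mapIso e ≪≫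
    (DerivedCategory.singleFunctorIsoCompQ _ 0).app _⟩

lemma DualPair.nonempty_homD_selfD_iso {Q K : CochainComplex (GrMod 𝒜) ℤ} [Q.IsKProjective]
    (D : DualPair K Q) : Nonempty ((homD Q).obj (selfD 𝒜) ≅ DerivedCategory.Q.obj K) :=
  ⟨(homD Q).mapIso nonempty_selfD_iso.some ≪≫ (homDFactors Q).app _ ≪≫
    DerivedCategory.Q.mapIso D.homSelfIso⟩

end GrMod

namespace GrMod
open CochainComplex.HomComplex

variable {R A : Type u} [CommRing R] [CommRing A] [Algebra R A]
  {𝒜 : ℤ → Submodule R A} [GradedAlgebra 𝒜]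

/-! ### The main chain of isomorphisms -/

lemma subsingleton_shift_iff (X Y : DerivedCategory (GrMod 𝒜)) (n : ℤ) :
    Subsingleton (X⟦n⟧ ⟶ Y⟦n⟧) ↔ Subsingleton (X ⟶ Y) :=
  ((Functor.FullyFaithful.ofFullyFaithful (shiftFunctor _ n)).homEquiv).symm.subsingleton_congr

lemma subsingleton_congr {X Y X' Y' : DerivedCategory (GrMod 𝒜)} (e : X ≅ X') (e' : Y ≅ Y') :
    Subsingleton (X ⟶ Y) ↔ Subsingleton (X' ⟶ Y') :=
  (e.homCongr e').subsingleton_congr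

lemma subsingleton_iff (X Y : DerivedCategory (GrMod 𝒜)) :
    Subsingleton (X ⟶ Y) ↔ ∀ f : X ⟶ Y, f = 0 :=
  ⟨fun _ _ => Subsingleton.elim _ _, fun h => ⟨fun f g => (h f).trans (h g).symm⟩⟩

section
variable {K : CochainComplex (GrMod 𝒜) ℤ} (hK : IsPerf K) [K.IsKProjective]

include hK

/-- `Hom(K, X) = 0` if and only if `Hom(A, RHom(K, X)) = 0`. -/
lemma IsPerf.subsingleton_iff (X : DerivedCategory (GrMod 𝒜)) :
    Subsingleton (DerivedCategory.Q.obj K ⟶ X) ↔ Subsingleton (selfD 𝒜 ⟶ (homD K).obj X) := by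
  obtain ⟨Q, hQ, ⟨D⟩, ⟨D'⟩⟩ := hK.exists_dual
  -- K is RHom(Q, A), and RHom(Q, -) is left adjoint to RHom(K, -).
  exact (subsingleton_congr D'.nonempty_homD_selfD_iso.some (Iso.refl X)).symm.trans
    (D'.adjD.homEquiv (selfD 𝒜) X).subsingleton_congr

variable [IsNoetherianRing A] (I : HomogeneousIdeal 𝒜)

lemma IsPerf.nonempty_lc_iso (X : DerivedCategory (GrMod 𝒜)) :
    Nonempty ((localCohomology I).obj ((homD K).obj X) ≅
      (homD K).obj ((localCohomology I).obj X)) := by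
  obtain ⟨Q, hQ, ⟨D⟩, ⟨D'⟩⟩ := hK.exists_dual
  exact nonempty_lc_homD_iso I D D' X

/-- RΓ_I K = RΓ_I RHom(Q, A) = RHom(Q, RΓ_I A), and RHom(K, -) is left adjoint to RHom(Q, -). -/
lemma IsPerf.subsingleton_lc_iff (F : DerivedCategory (GrMod 𝒜)) :
    Subsingleton (F ⟶ (localCohomology I).obj (DerivedCategory.Q.obj K)) ↔
      Subsingleton ((homD K).obj F ⟶ (localCohomology I).obj (selfD 𝒜)) := by
  obtain ⟨Q, hQ, ⟨D⟩, ⟨D'⟩⟩ := hK.exists_dual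
  let e : (localCohomology I).obj (DerivedCategory.Q.obj K) ≅
      (homD Q).obj ((localCohomology I).obj (selfD 𝒜)) :=
    (localCohomology I).mapIso D'.nonempty_homD_selfD_iso.some.symm ≪≫
      (nonempty_lc_homD_iso I D' D (selfD 𝒜)).some
  exact (subsingleton_congr (Iso.refl F) e).trans (D.adjD.homEquiv F _).subsingleton_congr.symm

/-- The two vanishing conditions, in terms of `RHom(K, RΓ_I F)` and its dual. -/
lemma IsPerf.subsingleton_lc_iff_dual (I' : HomogeneousIdeal 𝒜)
    (J : CochainComplex (ModuleCat.{u} R) ℤ) [J.IsKInjective]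
    (e : ((localCohomology I).obj (selfD 𝒜))⟦(1 : ℤ)⟧ ≅
      (dualD J).obj (op ((localCohomology I').obj (selfD 𝒜)))) (F : DerivedCategory (GrMod 𝒜)) :
    Subsingleton (F ⟶ (localCohomology I).obj (DerivedCategory.Q.obj K)) ↔
      Subsingleton (selfD 𝒜 ⟶
        (dualD J).obj (op (((homD K).obj ((localCohomology I').obj F))⟦(1 : ℤ)⟧))) := by
  -- Shifting by one produces the object RΓ_I(A)[1] to which `e` applies.
  rw [hK.subsingleton_lc_iff I, ← subsingleton_shift_iff _ _ 1, subsingleton_congr (Iso.refl _) e]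
  -- The symmetry of `eq_zero_dual_lc` exchanges A with RHom(K, F)[1].
  have h : Subsingleton (((homD K).obj F)⟦(1 : ℤ)⟧ ⟶
      (dualD J).obj (op ((localCohomology I').obj (selfD 𝒜)))) ↔
      Subsingleton (selfD 𝒜 ⟶
        (dualD J).obj (op ((localCohomology I').obj (((homD K).obj F)⟦(1 : ℤ)⟧)))) := by
    rw [GrMod.subsingleton_iff, GrMod.subsingleton_iff]
    exact ⟨fun h => eq_zero_dual_lc J I' _ _ h, fun h => eq_zero_dual_lc J I' _ _ h⟩
  rw [h]
  exact subsingleton_congr (Iso.refl _) ((dualD J).mapIso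
    ((nonempty_lc_shift_iso (I := I') ((homD K).obj F) 1).some ≪≫
      (shiftFunctor _ (1 : ℤ)).mapIso (hK.nonempty_lc_iso I' F).some).symm.op)

end

end GrMod

/-! ### Reduction to a comparison of V with its dual -/

open GrMod in
-- Both conditions are expressed through V = RHom(K, RΓ_{I^-} F) for the same pairs (K, F). For I^-
-- the object K is the source of the maps, for I^+ it is the object whose local cohomology is taken.
-- The hypothesis `key` is then the only missing comparison.
theorem full_faithful_iff_of_key {R A : Type u} [CommRing R] [IsNoetherianRing R] [CommRing A]
    [IsNoetherianRing A] [Algebra R A] (𝒜 : ℤ → Submodule R A) [GradedAlgebra 𝒜]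
    [Module.Finite R (𝒜 0)]
    (ω : CochainComplex (ModuleCat.{u} R) ℤ) [GrMod.IsDualizingComplex ω]
    (hΨ : Nonempty (((GrMod.localCohomology (GrMod.posIdeal 𝒜)).obj (GrMod.selfD 𝒜))⟦(1 : ℤ)⟧ ≅
      (GrMod.dualD ω).obj (op ((GrMod.localCohomology (GrMod.negIdeal 𝒜)).obj (GrMod.selfD 𝒜)))))
    (key : ∀ (K : CochainComplex (GrMod 𝒜) ℤ) (_ : IsPerf K) [K.IsKProjective]
      (F : DerivedCategory (GrMod 𝒜)) (_ : dPerf 𝒜 F),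
      (∀ n : ℤ, Subsingleton (selfD 𝒜 ⟶
        ((homD K).obj ((localCohomology (negIdeal 𝒜)).obj F))⟦n⟧)) ↔
      (∀ n : ℤ, Subsingleton (selfD 𝒜 ⟶
        (dualD ω).obj (op (((homD K).obj ((localCohomology (negIdeal 𝒜)).obj F))⟦n⟧)))))
    (E : ObjectProperty (DerivedCategory (GrMod 𝒜))) [E.IsTriangulated]
    (hE : E ≤ GrMod.dPerf 𝒜) :
    ((E.ι ⋙ GrMod.cech (GrMod.posIdeal 𝒜)).Full ∧
        (E.ι ⋙ GrMod.cech (GrMod.posIdeal 𝒜)).Faithful) ↔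
      ((E.ι ⋙ GrMod.cech (GrMod.negIdeal 𝒜)).Full ∧
        (E.ι ⋙ GrMod.cech (GrMod.negIdeal 𝒜)).Faithful) := by
  obtain ⟨e⟩ := hΨ
  rw [cech_full_faithful_iff, cech_full_faithful_iff]
  have shift (K : CochainComplex (GrMod 𝒜) ℤ) [K.IsKProjective] (F : DerivedCategory (GrMod 𝒜))
      (n : ℤ) : Nonempty ((homD K).obj ((localCohomology (negIdeal 𝒜)).obj (F⟦n⟧)) ≅
        ((homD K).obj ((localCohomology (negIdeal 𝒜)).obj F))⟦n⟧) :=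
    ⟨(homD K).mapIso (nonempty_lc_shift_iso F n).some ≪≫ (nonempty_homD_shift_iso K n _).some⟩
  -- The shift by one in `hΨ` is absorbed by applying the vanishing to F[n - 1].
  have shift' (K : CochainComplex (GrMod 𝒜) ℤ) [K.IsKProjective] (F : DerivedCategory (GrMod 𝒜))
      (n : ℤ) : Nonempty (((homD K).obj ((localCohomology (negIdeal 𝒜)).obj (F⟦n - 1⟧)))⟦(1 : ℤ)⟧ ≅
        ((homD K).obj ((localCohomology (negIdeal 𝒜)).obj F))⟦n⟧) :=
    ⟨(shiftFunctor _ (1 : ℤ)).mapIso (shift K F (n - 1)).some ≪≫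
      ((shiftFunctorAdd' _ (n - 1) 1 n (by ring)).app _).symm⟩
  -- An object of `E` is only isomorphic to a bounded complex of finitely generated projectives,
  -- hence the isomorphism closure. All shifts are included because `E` is stable under them.
  have hneg : (∀ F G, E F → E G → ∀ f : F ⟶ (localCohomology (negIdeal 𝒜)).obj G, f = 0) ↔
      ∀ (K : CochainComplex (GrMod 𝒜) ℤ) (hK : IsPerf K) [K.IsKProjective]
        (F : DerivedCategory (GrMod 𝒜)), E.isoClosure (DerivedCategory.Q.obj K) → E F → ∀ n : ℤ,
        Subsingleton (selfD 𝒜 ⟶ ((homD K).obj ((localCohomology (negIdeal 𝒜)).obj F))⟦n⟧) := by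
    constructor
    · rintro h K hK _ F ⟨F', hF', ⟨e'⟩⟩ hF n
      rw [← subsingleton_congr (Iso.refl _) (shift K F n).some, ← hK.subsingleton_iff,
        subsingleton_congr e' (Iso.refl _), GrMod.subsingleton_iff]
      exact h _ _ hF' (E.le_shift n _ hF)
    · intro h F G hF hG
      obtain ⟨K, hK, ⟨eF⟩⟩ := dPerf.exists_isPerf (hE _ hF)
      have := hK.isKProjective
      rw [← GrMod.subsingleton_iff, subsingleton_congr eF (Iso.refl _), hK.subsingleton_iff]
      have h0 := h K hK G ⟨F, hF, ⟨eF.symm⟩⟩ hG 0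
      exact (subsingleton_congr (Iso.refl _) ((shiftFunctorZero _ ℤ).app _)).1 h0
  have hpos : (∀ F G, E F → E G → ∀ f : F ⟶ (localCohomology (posIdeal 𝒜)).obj G, f = 0) ↔
      ∀ (K : CochainComplex (GrMod 𝒜) ℤ) (hK : IsPerf K) [K.IsKProjective]
        (F : DerivedCategory (GrMod 𝒜)), E.isoClosure (DerivedCategory.Q.obj K) → E F → ∀ n : ℤ,
        Subsingleton (selfD 𝒜 ⟶ (dualD ω).obj
          (op (((homD K).obj ((localCohomology (negIdeal 𝒜)).obj F))⟦n⟧))) := by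
    constructor
    · rintro h K hK _ F ⟨F', hF', ⟨e'⟩⟩ hF n
      rw [subsingleton_congr (Iso.refl _) ((dualD ω).mapIso (shift' K F n).some.op),
        ← hK.subsingleton_lc_iff_dual (posIdeal 𝒜) (negIdeal 𝒜) ω e,
        subsingleton_congr (Iso.refl _) ((GrMod.localCohomology _).mapIso e'),
        GrMod.subsingleton_iff]
      exact h _ _ (E.le_shift _ _ hF) hF'
    · intro h F G hF hG
      obtain ⟨K, hK, ⟨eG⟩⟩ := dPerf.exists_isPerf (hE _ hG)
      have := hK.isKProjective
      rw [← GrMod.subsingleton_iff, subsingleton_congr (Iso.refl _)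
        ((GrMod.localCohomology _).mapIso eG),
        hK.subsingleton_lc_iff_dual (posIdeal 𝒜) (negIdeal 𝒜) ω e]
      exact h K hK F ⟨G, hG, ⟨eG.symm⟩⟩ hF 1
  rw [hneg, hpos]
  exact ⟨fun h K hK _ F hE' hF => (key K hK F (hE _ hF)).2 (h K hK F hE' hF),
    fun h K hK _ F hE' hF => (key K hK F (hE _ hF)).1 (h K hK F hE' hF)⟩

namespace GrMod
open CochainComplex.HomComplex

variable {R A : Type u} [CommRing R] [CommRing A] [Algebra R A]
  {𝒜 : ℤ → Submodule R A} [GradedAlgebra 𝒜]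

/-! ### Maps from `A` in the derived category -/

/-- The source lives in degree 0, so a homotopy has a single component, given by the value `z` on
the generator. -/
lemma ofGenVal_homotopy {C : CochainComplex (GrMod 𝒜) ℤ} (y : (C.X 0).X 0)
    (hy : (C.d 0 1).app 0 y = 0) (z : (C.X (-1)).X 0) (hz : (C.d (-1) 0).app 0 z = y) :
    Nonempty (Homotopy (ofGenVal (zero_add 0) y hy : selfC 𝒜 0 ⟶ C) 0) := by
  let h : (selfC 𝒜 0).X 0 ⟶ C.X (-1) :=
    (HomologicalComplex.singleObjXSelf (ComplexShape.up ℤ) 0 _).hom ≫ genMap (zero_add 0) z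
  refine ⟨(Cochain.equivHomotopy _ _).symm ⟨Cochain.single h (-1), ?_⟩⟩
  have h1 : δ (-1) 0 (Cochain.single h (-1)) = Cochain.ofHom (ofGenVal (zero_add 0) y hy) := by
    refine Cochain.ext₀ _ _ fun p => ?_
    rw [δ_v (-1) 0 (by lia) _ p p (by lia) (p - 1) (p + 1) (by lia) (by lia)]
    by_cases hp : p = 0
    · subst hp
      have h2 : (selfC 𝒜 0).d 0 (0 + 1) = 0 := HomologicalComplex.single_obj_d ..
      rw [h2, zero_comp, smul_zero, add_zero]
      have h3 : (Cochain.single h (-1)).v 0 (0 - 1) (by lia) = h :=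
        Cochain.single_v h (-1) (by lia)
      rw [h3, Cochain.ofHom_v]
      unfold ofGenVal
      rw [HomologicalComplex.mkHomFromSingle_f, Category.assoc, genMap_comp]
      exact congr_arg (fun t => (HomologicalComplex.singleObjXSelf (ComplexShape.up ℤ) 0
        ((tw 0).obj (self 𝒜))).hom ≫ genMap (zero_add 0) t) hz
    · exact (HomologicalComplex.isZero_single_obj_X _ _ _ _ hp).eq_of_src _ _
  rw [h1, Cochain.ofHom_zero, add_zero]

lemma Q_map_surjective (K L : CochainComplex (GrMod 𝒜) ℤ) [K.IsKProjective]
    (f : DerivedCategory.Q.obj K ⟶ DerivedCategory.Q.obj L) :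
    ∃ g : K ⟶ L, DerivedCategory.Q.map g = f := by
  obtain ⟨g, hg⟩ := (CochainComplex.IsKProjective.Qh_map_bijective K
    ((HomotopyCategory.quotient _ _).obj L)).2 f
  obtain ⟨g, rfl⟩ := (HomotopyCategory.quotient _ _).map_surjective g
  exact ⟨g, hg⟩

lemma homotopy_of_Q_map_eq_zero {K L : CochainComplex (GrMod 𝒜) ℤ} [K.IsKProjective]
    (f : K ⟶ L) (hf : DerivedCategory.Q.map f = 0) : Nonempty (Homotopy f 0) := by
  refine ⟨HomotopyCategory.homotopyOfEq _ _ ?_⟩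
  apply (CochainComplex.IsKProjective.Qh_map_bijective K _).1
  exact hf.trans (by rw [CategoryTheory.Functor.map_zero, CategoryTheory.Functor.map_zero]; rfl)

lemma Q_map_eq_zero_of_homotopy {K L : CochainComplex (GrMod 𝒜) ℤ} (f : K ⟶ L)
    (h : Homotopy f 0) : DerivedCategory.Q.map f = 0 := by
  have h1 := congr_arg DerivedCategory.Qh.map (HomotopyCategory.eq_of_homotopy f 0 h)
  exact h1.trans (by rw [CategoryTheory.Functor.map_zero, CategoryTheory.Functor.map_zero]; rfl)

lemma isKProjective_selfC (d : ℤ) : (selfC 𝒜 d).IsKProjective := by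
  have (n : ℤ) : Projective ((selfC 𝒜 d).X n) := by
    by_cases h : n = 0
    · subst h
      exact Projective.of_iso (HomologicalComplex.singleObjXSelf (ComplexShape.up ℤ) 0 _).symm
        inferInstance
    · exact (HomologicalComplex.isZero_single_obj_X _ _ _ _ h).projective
  have : (selfC 𝒜 d).IsStrictlyLE 0 := inferInstance
  exact CochainComplex.isKProjective_of_projective _ 0

/-- `Hom(A, C)` vanishes in the derived category if and only if `C` is exact in degree and weight
`0`. -/
lemma subsingleton_selfD_iff (C : CochainComplex (GrMod 𝒜) ℤ) :
    Subsingleton (selfD 𝒜 ⟶ DerivedCategory.Q.obj C) ↔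
      ∀ y : (C.X 0).X 0, (C.d 0 1).app 0 y = 0 → ∃ z, (C.d (-1) 0).app 0 z = y := by
  have := isKProjective_selfC (𝒜 := 𝒜) 0
  rw [subsingleton_congr nonempty_selfD_iso.some (Iso.refl _), subsingleton_iff]
  constructor
  -- A cocycle `y` is a map from A; a null-homotopy of it, evaluated at the generator, is a
  -- primitive of `y`.
  · intro h y hy
    obtain ⟨e⟩ := homotopy_of_Q_map_eq_zero _ (h (DerivedCategory.Q.map
      (ofGenVal (zero_add 0) y hy)))
    have h1 := e.comm 0
    rw [dNext_eq _ (show (ComplexShape.up ℤ).Rel 0 1 by simp),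
      prevD_eq _ (show (ComplexShape.up ℤ).Rel (-1) 0 by simp), HomologicalComplex.single_obj_d,
      zero_comp, zero_add, HomologicalComplex.zero_f, add_zero] at h1
    refine ⟨(e.hom 0 (-1)).app 0 ((HomologicalComplex.singleObjXSelf (ComplexShape.up ℤ) 0
      ((tw 0).obj (self 𝒜))).inv.app 0 (gen 𝒜 (zero_add 0))), ?_⟩
    refine Eq.trans ?_ (genVal_ofGenVal (zero_add 0) y hy)
    exact (congr_arg (fun t : (selfC 𝒜 0).X 0 ⟶ C.X 0 => t.app 0
      ((HomologicalComplex.singleObjXSelf (ComplexShape.up ℤ) 0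
      ((tw 0).obj (self 𝒜))).inv.app 0 (gen 𝒜 (zero_add 0)))) h1).symm
  · intro h f
    obtain ⟨g, rfl⟩ := Q_map_surjective _ _ f
    obtain ⟨⟨y, hy⟩, rfl⟩ := (genEquiv (zero_add 0) C).symm.surjective g
    obtain ⟨z, hz⟩ := h y hy
    exact Q_map_eq_zero_of_homotopy _ (ofGenVal_homotopy y hy z hz).some

/-- The weight `i` piece commutes with shifts. -/
noncomputable def wtCShift (i : ℤ) (C : CochainComplex (GrMod 𝒜) ℤ) (n : ℤ) :
    (wtC i).obj (C⟦n⟧) ≅ ((wtC i).obj C)⟦n⟧ :=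
  ((wtC i).commShiftIso n).app C

lemma exactAt_shift_iff (K : CochainComplex (ModuleCat.{u} R) ℤ) (n : ℤ) :
    (K⟦n⟧).ExactAt 0 ↔ K.ExactAt n := by
  rw [HomologicalComplex.exactAt_iff_isZero_homology, HomologicalComplex.exactAt_iff_isZero_homology]
  exact ((CochainComplex.ShiftSequence.shiftIso (ModuleCat.{u} R) n 0 n (by simp)).app K).isZero_iff

lemma exactAt_iff_of_iso {K L : CochainComplex (ModuleCat.{u} R) ℤ} (e : K ≅ L) (n : ℤ) :
    K.ExactAt n ↔ L.ExactAt n := by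
  rw [HomologicalComplex.exactAt_iff_isZero_homology, HomologicalComplex.exactAt_iff_isZero_homology]
  exact ((HomologicalComplex.homologyFunctor _ _ n).mapIso e).isZero_iff

/-- `Hom(A, C[n])` vanishes for all `n` if and only if the weight `0` piece of `C` is acyclic. -/
lemma subsingleton_selfD_shift_iff (C : CochainComplex (GrMod 𝒜) ℤ)
    (V : DerivedCategory (GrMod 𝒜)) (e : V ≅ DerivedCategory.Q.obj C) :
    (∀ n : ℤ, Subsingleton (selfD 𝒜 ⟶ V⟦n⟧)) ↔ ((wtC 0).obj C).Acyclic := by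
  refine forall_congr' fun n => ?_
  rw [subsingleton_congr (Iso.refl _) (show V⟦n⟧ ≅ DerivedCategory.Q.obj (C⟦n⟧) from
      (shiftFunctor _ n).mapIso e ≪≫ ((DerivedCategory.Q.commShiftIso n).app C).symm),
    subsingleton_selfD_iff, ← exactAt_shift_iff, ← exactAt_iff_of_iso (wtCShift 0 C n),
    HomologicalComplex.exactAt_iff' _ (-1) 0 1 (by simp) (by simp),
    ShortComplex.moduleCat_exact_iff]
  rfl

/-- `Hom(A, D(C[n]))` vanishes for all `n` if and only if all maps from a shift of the weight `0`
piece of `C` to `J` are null-homotopic. -/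
lemma subsingleton_selfD_dual_iff (J : CochainComplex (ModuleCat.{u} R) ℤ) [J.IsKInjective]
    (C : CochainComplex (GrMod 𝒜) ℤ) (V : DerivedCategory (GrMod 𝒜))
    (e : V ≅ DerivedCategory.Q.obj C) :
    (∀ n : ℤ, Subsingleton (selfD 𝒜 ⟶ (dualD J).obj (op (V⟦n⟧)))) ↔
      ∀ (n : ℤ) (f : ((wtC 0).obj C)⟦n⟧ ⟶ J), Nonempty (Homotopy f 0) := by
  refine forall_congr' fun n => ?_
  let e' : V⟦n⟧ ≅ DerivedCategory.Q.obj (C⟦n⟧) :=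
    (shiftFunctor _ n).mapIso e ≪≫ ((DerivedCategory.Q.commShiftIso n).app C).symm
  rw [subsingleton_congr (Iso.refl _) (show (dualD J).obj (op (V⟦n⟧)) ≅
      DerivedCategory.Q.obj (dualObj J (C⟦n⟧)) from
      (dualD J).mapIso e'.symm.op ≪≫ dualDIso J (C⟦n⟧)), subsingleton_selfD_iff]
  -- Weight 0 of the dual is built from weight -0 of the complex.
  have e0 : (wtC 0).obj (C⟦n⟧) = (wtC (-0)).obj (C⟦n⟧) := by rw [neg_zero]
  constructor
  · intro h f
    let g : (wtC (-0)).obj (C⟦n⟧) ⟶ J := eqToHom e0.symm ≫ (wtCShift 0 C n).hom ≫ f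
    obtain ⟨z, hz⟩ := h (Cochain.ofHom g) (δ_ofHom g)
    have hg : Homotopy g 0 := (Cochain.equivHomotopy _ _).symm ⟨z, by
      rw [Cochain.ofHom_zero, add_zero]
      exact hz.symm⟩
    have hf : f = ((wtCShift 0 C n).inv ≫ eqToHom e0) ≫ g := by
      simp only [g, Category.assoc, eqToHom_refl, Category.id_comp, Iso.inv_hom_id_assoc]
    rw [hf]
    exact ⟨(hg.compLeft _).trans (Homotopy.ofEq comp_zero)⟩
  · intro h y hy
    obtain ⟨g, rfl⟩ : ∃ g : (wtC (-0)).obj (C⟦n⟧) ⟶ J, Cochain.ofHom g = y :=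
      ⟨(Cocycle.mk y 1 rfl hy).homOf, Cocycle.cochain_ofHom_homOf_eq_coe (Cocycle.mk y 1 rfl hy)⟩
    obtain ⟨hf⟩ := h ((wtCShift 0 C n).inv ≫ eqToHom e0 ≫ g)
    have hg : g = (eqToHom e0.symm ≫ (wtCShift 0 C n).hom) ≫
        (wtCShift 0 C n).inv ≫ eqToHom e0 ≫ g := by
      simp only [Iso.hom_inv_id_assoc, eqToHom_refl, Category.id_comp]
    have hg' : Homotopy g 0 := (Homotopy.ofEq hg).trans
      ((hf.compLeft _).trans (Homotopy.ofEq comp_zero))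
    obtain ⟨z, hz⟩ := Cochain.equivHomotopy _ _ hg'
    rw [Cochain.ofHom_zero, add_zero] at hz
    exact ⟨z, hz.symm⟩

end GrMod

namespace GrMod
open CochainComplex.HomComplex

variable {R A : Type u} [CommRing R] [CommRing A] [Algebra R A]
  {𝒜 : ℤ → Submodule R A} [GradedAlgebra 𝒜]

/-! ### Constant graded modules -/

section
variable (ε : A →ₐ[R] R)

/-- The graded module all of whose pieces are `M`, on which `A` acts through `ε : A → R`. -/
def constObj (M : ModuleCat.{u} R) : GrMod 𝒜 where
  X _ := M
  act _ := LinearMap.mk₂ R (fun a x => ε a • x)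
    (fun a b x => by rw [Submodule.coe_add, map_add, add_smul])
    (fun r a x => by rw [Submodule.coe_smul, map_smul, smul_assoc])
    (fun a x y => smul_add _ _ _) (fun r a x => smul_comm _ _ _)
  one_act _ a ha x := by
    change ε a • x = x
    rw [ha, map_one, one_smul]
  mul_act _ _ _ a b c hc x := by
    change ε c • x = ε a • ε b • x
    rw [hc, map_mul, mul_smul]

/-- The functor of constant graded modules. -/
def const : ModuleCat.{u} R ⥤ GrMod 𝒜 where
  obj := constObj ε
  map f := { app := fun _ => f.hom, comm := fun _ a x => map_smul f.hom (ε a) x }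

instance : (const (𝒜 := 𝒜) ε).Additive where

lemma const_exact (S : ShortComplex (ModuleCat.{u} R)) (hS : S.Exact) :
    (S.map (const (𝒜 := 𝒜) ε)).Exact := by
  rw [exact_iff]
  exact fun _ => (ShortComplex.moduleCat_exact_iff S).1 hS

instance : PreservesFiniteLimits (const (𝒜 := 𝒜) ε) := by
  have := ((const (𝒜 := 𝒜) ε).exact_tfae.out 1 3).1 (const_exact ε)
  exact this.1

instance : PreservesFiniteColimits (const (𝒜 := 𝒜) ε) := by
  have := ((const (𝒜 := 𝒜) ε).exact_tfae.out 1 3).1 (const_exact ε)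
  exact this.2

/-- The functor of constant complexes. -/
abbrev constC : CochainComplex (ModuleCat.{u} R) ℤ ⥤ CochainComplex (GrMod 𝒜) ℤ :=
  (const ε).mapHomologicalComplex _

end

section
variable {K J : CochainComplex (ModuleCat.{u} R) ℤ} {n : ℤ}

/-- A cocycle of degree n is a chain map K → J[n], and a null-homotopy is a primitive. The left
version uses K[-n] → J, at the cost of the signs of `δ_leftShift`. -/
lemma exists_δ_of_homotopy_right (h : ∀ f : K ⟶ J⟦n⟧, Nonempty (Homotopy f 0)) (z : Cochain K J n)
    (hz : δ n (n + 1) z = 0) : ∃ y : Cochain K J (n - 1), δ (n - 1) n y = z := by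
  have h1 : CohomologyClass.mk (Cocycle.mk z (n + 1) rfl hz) = 0 := by
    apply (CohomologyClass.toHom_bijective K J n).1
    rw [CohomologyClass.toHom_mk, map_zero]
    exact (HomotopyCategory.eq_of_homotopy _ _ (h _).some).trans
      (CategoryTheory.Functor.map_zero _ _ _)
  rwa [CohomologyClass.mk_eq_zero_iff, mem_coboundaries_iff _ (n - 1) (by lia)] at h1

lemma exists_δ_of_homotopy_left (h : ∀ f : K⟦-n⟧ ⟶ J, Nonempty (Homotopy f 0)) (z : Cochain K J n)
    (hz : δ n (n + 1) z = 0) : ∃ y : Cochain K J (n - 1), δ (n - 1) n y = z := by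
  let z' := z.leftShift (-n) 0 (by lia)
  have hz' : δ 0 1 z' = 0 := by
    rw [z.δ_leftShift (-n) 0 1 (by lia) (n + 1) (by lia), hz, Cochain.leftShift_zero, smul_zero]
  obtain ⟨w, hw⟩ := Cochain.equivHomotopy _ _ (h (Cocycle.mk z' 1 rfl hz').homOf).some
  rw [Cochain.ofHom_zero, add_zero, Cocycle.cochain_ofHom_homOf_eq_coe] at hw
  let y := w.leftUnshift (n - 1) (by lia)
  have h1 : δ (-1) 0 w = (-n).negOnePow • (δ (n - 1) n y).leftShift (-n) 0 (by lia) := by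
    rw [← y.δ_leftShift (-n) (-1) 0 (by lia) n (by lia), Cochain.leftShift_leftUnshift]
  refine ⟨(-n).negOnePow • y, ?_⟩
  rw [δ_units_smul]
  have h2 : z.leftShift (-n) 0 (by lia) =
      ((-n).negOnePow • δ (n - 1) n y).leftShift (-n) 0 (by lia) := by
    rw [Cochain.leftShift_units_smul]
    exact hw.trans h1
  exact ((Cochain.leftShiftAddEquiv K J n (-n) 0 (by lia)).injective h2).symm

end

section
variable (J K : CochainComplex (ModuleCat.{u} R) ℤ) (ε : A →ₐ[R] R)

lemma isZero_Q_obj (C : CochainComplex (GrMod 𝒜) ℤ)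
    (h : ∀ (n i : ℤ) (x : (C.X n).X i), (C.d n (n + 1)).app i x = 0 →
      ∃ y, (C.d (n - 1) n).app i y = x) : IsZero (DerivedCategory.Q.obj C) := by
  rw [derived_isZero_iff]
  intro n
  refine IsZero.of_iso ?_ ((DerivedCategory.homologyFunctorFactors (GrMod 𝒜) n).app C)
  have : C.ExactAt n := by
    rw [HomologicalComplex.exactAt_iff' _ (n - 1) n (n + 1) (by simp) (by simp), exact_iff]
    exact h n
  exact this.isZero_homology

/-- If all maps from shifts of `K` to `J` are null-homotopic, the dual of the constant complex
`K` is zero. -/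
lemma isZero_dual_constC (h : ∀ (n : ℤ) (f : K⟦n⟧ ⟶ J), Nonempty (Homotopy f 0)) :
    IsZero (DerivedCategory.Q.obj (dualObj J ((constC (𝒜 := 𝒜) ε).obj K))) :=
  isZero_Q_obj _ fun n _ x hx => exists_δ_of_homotopy_left (K := K) (h (-n)) x hx

end

section
variable {ω : CochainComplex (ModuleCat.{u} R) ℤ} [hω : IsDualizingComplex ω] (ε : A →ₐ[R] R)

variable (ω) in
/-- The map from `R` to the endomorphisms of `ω`. -/
noncomputable def scalarMap : (const (𝒜 := 𝒜) ε).obj (ModuleCat.of R R) ⟶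
    (dualObj ω ((constC (𝒜 := 𝒜) ε).obj ω)).X 0 where
  app _ := LinearMap.toSpanSingleton R (Cochain ω ω 0) (Cochain.ofHom (𝟙 ω))
  comm {i j k} h a (r : R) := by
    change (ε a * r) • Cochain.ofHom (𝟙 ω) = precomp ω 0
      (actC ((constC (𝒜 := 𝒜) ε).obj ω) (show i + -k = -j by lia) a) (r • Cochain.ofHom (𝟙 ω))
    refine cochain_ext fun p q hq (x : ω.X p) => ?_
    obtain rfl : p = q := by lia
    refine Eq.trans ?_ (precomp_v (J := ω) _ _ p p hq x).symm
    change (ε a * r) • x = r • ε a • x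
    rw [mul_comm, mul_smul]

variable (ω) in
/-- The map from `R` to the endomorphism complex of `ω`. -/
noncomputable def scalarMapC :
    (HomologicalComplex.single (GrMod 𝒜) (ComplexShape.up ℤ) 0).obj
      ((const ε).obj (ModuleCat.of R R)) ⟶ dualObj ω ((constC (𝒜 := 𝒜) ε).obj ω) :=
  HomologicalComplex.mkHomFromSingle (scalarMap ω ε) (by
    rintro k -
    refine hom_ext fun i (r : R) => ?_
    change δ 0 k (r • Cochain.ofHom (𝟙 ω)) = 0
    rw [δ_smul, δ_ofHom, smul_zero])

/-- The defining property R = RHom(ω, ω) of a dualizing complex, read in each weight: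
`existsUnique_smul` is the statement in degree 0, `homotopy_zero` the one in the other degrees. -/
instance : QuasiIso (scalarMapC ω (𝒜 := 𝒜) ε) := by
  have hs (r : R) : r • Cochain.ofHom (𝟙 ω) = Cochain.ofHom (r • 𝟙 ω) := by
    refine cochain_ext fun p q hq x => ?_
    obtain rfl : p = q := by lia
    exact (congr_arg (fun t : ω.X p ⟶ ω.X p => t.hom x) (show (r • Cochain.ofHom (𝟙 ω)).v p p hq =
      (Cochain.ofHom (r • 𝟙 ω)).v p p hq by simp))
  have hzero (n i : ℤ) (hn : n ≠ 0) (x : (((HomologicalComplex.single (GrMod 𝒜)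
      (ComplexShape.up ℤ) 0).obj ((const ε).obj (ModuleCat.of R R))).X n).X i) : x = 0 :=
    (isZero_iff _).1 (HomologicalComplex.isZero_single_obj_X _ _ _ _ hn) i x
  rw [quasiIso_iff]
  intro n
  rw [quasiIsoAt_iff' _ (n - 1) n (n + 1) (by simp) (by simp)]
  by_cases hn : n = 0
  · subst hn
    let e := HomologicalComplex.singleObjXSelf (ComplexShape.up ℤ) 0
      ((const (𝒜 := 𝒜) ε).obj (ModuleCat.of R R))
    have key (i : ℤ) (r : R) : Hom.app (e.inv ≫ (scalarMapC ω (𝒜 := 𝒜) ε).f 0) i r =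
        r • Cochain.ofHom (𝟙 ω) := by
      rw [scalarMapC, HomologicalComplex.mkHomFromSingle_f, Iso.inv_hom_id_assoc]
      rfl
    have hsurj (i : ℤ) (x) : ∃ r : R, e.inv.app i r = x :=
      ⟨_, congr_arg (fun t => Hom.app t i x) e.hom_inv_id⟩
    refine quasiIso_of_elements _ (fun i x hx y hy => ?_) (fun i z hz => ?_)
    · obtain ⟨r, rfl⟩ := hsurj i x
      let y' : Cochain ω ω (-1) := y
      have h1 : δ (-1) 0 y' = Cochain.ofHom (r • 𝟙 ω) := hy.trans ((key i r).trans (hs r))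
      have h2 : Homotopy (r • 𝟙 ω) 0 := (Cochain.equivHomotopy _ _).symm ⟨y', by
        rw [Cochain.ofHom_zero, add_zero, h1]⟩
      -- Both r and 0 represent the zero endomorphism up to homotopy, so uniqueness gives r = 0.
      obtain ⟨r', -, hr'⟩ := hω.existsUnique_smul 0
      have h3 : r = 0 := (hr' r ⟨h2.symm⟩).trans
        (hr' 0 ⟨Homotopy.ofEq (zero_smul R (𝟙 ω)).symm⟩).symm
      subst h3
      exact ⟨0, (map_zero _).trans (map_zero _).symm⟩
    · obtain ⟨f, rfl⟩ : ∃ f : ω ⟶ ω, Cochain.ofHom f = z :=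
        ⟨(Cocycle.mk z 1 rfl hz).homOf, Cocycle.cochain_ofHom_homOf_eq_coe (Cocycle.mk z 1 rfl hz)⟩
      obtain ⟨r, ⟨hr⟩, -⟩ := hω.existsUnique_smul f
      obtain ⟨y, hy⟩ := Cochain.equivHomotopy _ _ hr.symm
      refine ⟨e.inv.app i r, y, ?_, ?_⟩
      · exact congr_arg (fun t => Hom.app t i (e.inv.app i r)) (HomologicalComplex.single_obj_d
          (ComplexShape.up ℤ) 0 ((const (𝒜 := 𝒜) ε).obj (ModuleCat.of R R)) 0 1)
      · exact ((key i r).trans (hs r)).trans (hy.trans (add_comm _ _))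
  · refine quasiIso_of_elements _ (fun i x hx y hy => ⟨0, ?_⟩)
      (fun i x hx => ⟨0, ?_⟩)
    · exact (map_zero _).trans (hzero n i hn x).symm
    · obtain ⟨y, hy⟩ := exists_δ_of_homotopy_right (hω.homotopy_zero n hn) x hx
      refine ⟨-y, map_zero _, (map_zero _).trans ?_⟩
      have h1 : δ (n - 1) n (-y) = -x := (δ_neg _ _ y).trans (congr_arg Neg.neg hy)
      exact ((add_neg_cancel x).symm).trans (congr_arg (x + ·) h1.symm)

/-- `R` is the dual of `ω`. -/
lemma nonempty_dual_constC_iso : Nonempty (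
    (DerivedCategory.singleFunctor (GrMod 𝒜) 0).obj ((const ε).obj (ModuleCat.of R R)) ≅
    DerivedCategory.Q.obj (dualObj ω ((constC (𝒜 := 𝒜) ε).obj ω))) := by
  have hq : QuasiIso (scalarMapC ω (𝒜 := 𝒜) ε) := inferInstance
  have : IsIso (DerivedCategory.Q.map (scalarMapC ω (𝒜 := 𝒜) ε)) :=
    (DerivedCategory.isIso_Q_map_iff_quasiIso _ _).2 hq
  exact ⟨(DerivedCategory.singleFunctorIsoCompQ _ 0).app _ ≪≫
    @asIso _ _ _ _ (DerivedCategory.Q.map (scalarMapC ω (𝒜 := 𝒜) ε)) this⟩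

end

end GrMod

/-- A nonzero finitely generated module `L` over a Noetherian ring has a nonzero map to some
`R ⧸ J` in every family of ideals containing `0` and closed under adding nonzerodivisors. -/
lemma IsNoetherianRing.exists_linearMap_ne_zero {R : Type u} [CommRing R] [IsNoetherianRing R]
    {L : Type u} [AddCommGroup L] [Module R L] [Module.Finite R L] [Nontrivial L]
    (S : Set (Ideal R)) (h0 : ⊥ ∈ S)
    (hS : ∀ J ∈ S, ∀ x : R, (∀ y : R ⧸ J, x • y = 0 → y = 0) → J ⊔ Ideal.span {x} ∈ S) :
    ∃ J ∈ S, ∃ l : L →ₗ[R] R ⧸ J, l ≠ 0 := by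
  by_contra! hL
  -- A finitely generated nonzero module has a simple quotient.
  obtain ⟨m, hm, ⟨q, hq⟩⟩ : ∃ m : Ideal R, m.IsMaximal ∧
      ∃ q : L →ₗ[R] R ⧸ m, Function.Surjective q := by
    obtain ⟨N, hN⟩ := IsCoatomic.exists_coatom (Submodule R L)
    have : IsSimpleModule R (L ⧸ N) := (isSimpleModule_iff_isCoatom ..).2 hN
    obtain ⟨m, hm, ⟨e⟩⟩ := isSimpleModule_iff_quot_maximal.1 this
    exact ⟨m, hm, e.toLinearMap ∘ₗ N.mkQ, e.surjective.comp N.mkQ_surjective⟩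
  obtain ⟨J, ⟨hJ, hJm⟩, hmax⟩ := set_has_maximal_iff_noetherian.2
    (inferInstanceAs (IsNoetherian R R)) {J : Ideal R | J ∈ S ∧ J ≤ m} ⟨⊥, h0, bot_le⟩
  -- Otherwise `m` consists of zerodivisors on R/J. By prime avoidance it is then an associated
  -- prime, so R/m embeds in R/J, and composing with `q` gives a nonzero map L → R/J.
  obtain ⟨x, hxm, hx⟩ : ∃ x ∈ m, ∀ y : R ⧸ J, x • y = 0 → y = 0 := by
    by_contra! h
    have hsub : (m : Set R) ⊆ ⋃ p ∈ associatedPrimes R (R ⧸ J), p := by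
      rw [biUnion_associatedPrimes_eq_zero_divisors]
      intro x hx
      obtain ⟨y, hy, hy0⟩ := h x hx
      exact ⟨y, hy0, hy⟩
    obtain ⟨p, hp, hmp⟩ := (Ideal.subset_union_prime_finite (associatedPrimes.finite R (R ⧸ J))
      (f := id) 0 0 fun _ h _ _ => h.1).1 hsub
    rw [AssociatedPrimes.mem_iff, isAssociatedPrime_iff] at hp
    obtain ⟨hp, y, hy⟩ := hp
    obtain rfl : m = p := hm.eq_of_le hp.ne_top hmp
    have hl := hL J hJ ((Submodule.liftQ m (LinearMap.toSpanSingleton R _ y) fun a ha => by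
      rw [hy, Submodule.mem_colon_singleton, Submodule.mem_bot] at ha
      exact ha) ∘ₗ q)
    obtain ⟨z, hz⟩ := hq (Submodule.Quotient.mk 1)
    have hy0 : y = 0 := by
      have h1 := congr_arg (fun t : L →ₗ[R] R ⧸ J => t z) hl
      dsimp only [LinearMap.comp_apply] at h1
      rw [hz] at h1
      refine Eq.trans ?_ h1
      exact (one_smul R y).symm
    refine hp.ne_top (hy.trans ?_)
    rw [Ideal.eq_top_iff_one, hy0, Submodule.mem_colon_singleton, smul_zero]
    exact zero_mem _
  -- J + (x) contradicts the maximality of J among members of `S` below `m`. It is strictly larger: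
  -- if x were in J, then x would kill 1 in R/J, forcing J = R.
  refine hmax _ ⟨hS J hJ x hx, sup_le hJm ((Ideal.span_singleton_le_iff_mem m).2 hxm)⟩
    (lt_of_le_of_ne le_sup_left fun h => ?_)
  have hxJ : x ∈ J := h ▸ Ideal.mem_sup_right (Ideal.mem_span_singleton_self x)
  have h1 := hx (Submodule.Quotient.mk 1) (by
    rw [← Submodule.Quotient.mk_smul, smul_eq_mul, mul_one]
    exact (Submodule.Quotient.mk_eq_zero _).2 hxJ)
  exact hm.ne_top (top_le_iff.1 (((Ideal.eq_top_iff_one J).2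
    ((Submodule.Quotient.mk_eq_zero _).1 h1)) ▸ hJm))

/-! ### Detection of acyclicity by a dualizing complex -/

namespace GrMod
open CochainComplex.HomComplex

variable {R A : Type u} [CommRing R] [CommRing A] [Algebra R A]
  {𝒜 : ℤ → Submodule R A} [GradedAlgebra 𝒜]

section
variable (X : DerivedCategory (GrMod 𝒜))

/-- The objects `Y` such that all maps from `X` to shifts of `Y` vanish. -/
def orth : ObjectProperty (DerivedCategory (GrMod 𝒜)) := fun Y => ∀ n : ℤ, Subsingleton (X ⟶ Y⟦n⟧)

lemma orth_of_iso {Y Y' : DerivedCategory (GrMod 𝒜)} (e : Y ≅ Y') (h : orth X Y) : orth X Y' :=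
  fun n => (subsingleton_congr (Iso.refl X) ((shiftFunctor _ n).mapIso e)).1 (h n)

lemma orth_shift {Y : DerivedCategory (GrMod 𝒜)} (h : orth X Y) (a : ℤ) : orth X (Y⟦a⟧) :=
  fun n => (subsingleton_congr (Iso.refl X) ((shiftFunctorAdd' _ a n (a + n) rfl).app Y)).1
    (h (a + n))

lemma orth_ext₃ (T : Triangle (DerivedCategory (GrMod 𝒜))) (hT : T ∈ distTriang _)
    (h₁ : orth X T.obj₁) (h₂ : orth X T.obj₂) : orth X T.obj₃ := fun n => by
  rw [subsingleton_iff]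
  intro f
  have h3 : Subsingleton (X ⟶ T.obj₁⟦n⟧⟦(1 : ℤ)⟧) := orth_shift X h₁ n 1
  obtain ⟨g, rfl⟩ := Triangle.coyoneda_exact₃ _ (Triangle.shift_distinguished T hT n) f
    (h3.elim _ _)
  have h4 : g = 0 := (h₂ n).elim _ _
  rw [h4]
  exact zero_comp

end

section
variable (ε : A →ₐ[R] R)

/-- The constant graded module `M`, in the derived category. -/
noncomputable abbrev constD (M : ModuleCat.{u} R) : DerivedCategory (GrMod 𝒜) :=
  (DerivedCategory.singleFunctor (GrMod 𝒜) 0).obj ((const ε).obj M)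

/-- Multiplication by `x` on R/J is injective with cokernel R/(J + (x)), so the latter is a cone of
two orthogonal objects. -/
lemma orth_constD_sup (X : DerivedCategory (GrMod 𝒜)) (J : Ideal R) (x : R)
    (hx : ∀ y : R ⧸ J, x • y = 0 → y = 0) (h : orth X (constD ε (ModuleCat.of R (R ⧸ J)))) :
    orth X (constD ε (ModuleCat.of R (R ⧸ J ⊔ Ideal.span {x}))) := by
  let f : R ⧸ J →ₗ[R] R ⧸ J := LinearMap.lsmul R _ x
  let g : R ⧸ J →ₗ[R] R ⧸ J ⊔ Ideal.span {x} := Submodule.factor le_sup_left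
  have hfg : g ∘ₗ f = 0 := LinearMap.ext fun y => by
    obtain ⟨y, rfl⟩ := Submodule.mkQ_surjective _ y
    refine (Submodule.Quotient.mk_eq_zero (J ⊔ Ideal.span {x}) (x := x * y)).2 ?_
    exact Ideal.mul_mem_right _ _ (Ideal.mem_sup_right (Ideal.mem_span_singleton_self x))
  let S : ShortComplex (ModuleCat.{u} R) :=
    { f := ModuleCat.ofHom f, g := ModuleCat.ofHom g, zero := ModuleCat.hom_ext hfg }
  have hex : S.Exact := by
    refine (ShortComplex.moduleCat_exact_iff S).2 fun y hy => ?_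
    obtain ⟨y, rfl⟩ := Submodule.mkQ_surjective _ y
    obtain ⟨a, ha, b, hb, hab⟩ := Submodule.mem_sup.1 ((Submodule.Quotient.mk_eq_zero
      (J ⊔ Ideal.span {x})).1 hy)
    obtain ⟨c, rfl⟩ := Ideal.mem_span_singleton'.1 hb
    refine ⟨Submodule.mkQ J c, (Submodule.Quotient.eq J (x := x * c) (y := y)).2 ?_⟩
    have hab' : a + c * x = y := hab
    rw [← hab', mul_comm, sub_add_cancel_right]
    exact neg_mem ha
  have : Mono S.f := (ModuleCat.mono_iff_injective _).2 ((injective_iff_map_eq_zero f).2 hx)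
  have : Epi S.g := (ModuleCat.epi_iff_surjective _).2 (Submodule.factor_surjective le_sup_left)
  have hS : S.ShortExact := ⟨hex⟩
  exact orth_ext₃ X _ (hS.map_of_exact (const (𝒜 := 𝒜) ε)).singleTriangle_distinguished h h

variable (N : CochainComplex (ModuleCat.{u} R) ℤ)

/-- Maps from the top cohomology of `N` extend to `N`. -/
lemma eq_zero_of_orth (t : ℤ) [N.IsStrictlyLE t] (M : ModuleCat.{u} R)
    (h : orth (DerivedCategory.Q.obj ((constC (𝒜 := 𝒜) ε).obj N)) (constD ε M))
    (l : N.homology t ⟶ M) : l = 0 := by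
  have hN : IsZero (N.X (t + 1)) := N.isZero_of_isStrictlyLE t (t + 1)
  let i : N.cycles t ≅ N.X t := N.iCyclesIso t (t + 1) (by simp) (hN.eq_of_tgt _ _)
  -- Since `N` ends in degree t, its last cohomology is a quotient of its last term, so `l` induces
  -- a chain map to M placed in degree t.
  let φ : N ⟶ (HomologicalComplex.single _ (ComplexShape.up ℤ) t).obj M :=
    HomologicalComplex.mkHomToSingle (i.inv ≫ N.homologyπ t ≫ l) (by
      intro k hk
      have : N.d k t = N.toCycles k t ≫ i.hom := (N.toCycles_i k t).symm
      rw [this, Category.assoc, Iso.hom_inv_id_assoc, HomologicalComplex.toCycles_comp_homologyπ_assoc,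
        zero_comp])
  suffices hφ : φ.f t = 0 by
    have h1 : i.inv ≫ N.homologyπ t ≫ l = 0 := by
      rw [← cancel_mono (HomologicalComplex.singleObjXSelf (ComplexShape.up ℤ) t M).inv, zero_comp]
      exact (HomologicalComplex.mkHomToSingle_f ..).symm.trans hφ
    rw [← cancel_epi (N.homologyπ t), comp_zero, ← cancel_epi i.inv, comp_zero]
    exact h1
  let ψ := (constC (𝒜 := 𝒜) ε).map φ
  have hQ : DerivedCategory.Q.map ψ = 0 := by
    let e : DerivedCategory.Q.obj ((constC (𝒜 := 𝒜) ε).obj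
        ((HomologicalComplex.single _ (ComplexShape.up ℤ) t).obj M)) ≅ (constD ε M)⟦-t⟧ :=
      DerivedCategory.Q.mapIso ((HomologicalComplex.singleMapHomologicalComplex (const ε)
        (ComplexShape.up ℤ) t).app M) ≪≫
        (DerivedCategory.singleFunctorIsoCompQ (GrMod 𝒜) t).symm.app ((const ε).obj M) ≪≫
        (((DerivedCategory.singleFunctors (GrMod 𝒜)).shiftIso (-t) t 0 (by ring)).app _).symm
    rw [← cancel_mono e.hom, zero_comp]
    exact (h (-t)).elim _ _
  have hH : HomologicalComplex.homologyMap ψ t = 0 := by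
    have h1 := (DerivedCategory.homologyFunctorFactors (GrMod 𝒜) t).hom.naturality ψ
    refine (cancel_epi ((DerivedCategory.homologyFunctorFactors (GrMod 𝒜) t).hom.app _)).1 ?_
    refine h1.symm.trans (Eq.trans ?_ comp_zero.symm)
    have h2 : (DerivedCategory.homologyFunctor (GrMod 𝒜) t).map (DerivedCategory.Q.map ψ) = 0 := by
      rw [hQ, CategoryTheory.Functor.map_zero]
    exact (congr_arg (· ≫ _) h2).trans zero_comp
  -- In degree t every element of the source is a cycle and the target equals its cohomology, so ψ
  -- in degree t is determined by its effect on cohomology.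
  have hψ : ψ.f t = 0 := by
    have i1 : IsIso (HomologicalComplex.iCycles ((constC (𝒜 := 𝒜) ε).obj N) t) :=
      HomologicalComplex.isIso_iCycles _ t (t + 1) (by simp)
        (((const ε).map_isZero hN).eq_of_tgt _ _)
    have i2 : IsIso (HomologicalComplex.homologyπ ((constC (𝒜 := 𝒜) ε).obj
        ((HomologicalComplex.single _ (ComplexShape.up ℤ) t).obj M)) t) :=
      HomologicalComplex.isIso_homologyπ _ (t - 1) t (by simp)
        (((const ε).map_isZero (HomologicalComplex.isZero_single_obj_X _ _ _ _
          (by lia))).eq_of_src _ _)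
    have h1 : HomologicalComplex.cyclesMap ψ t = 0 := by
      rw [← cancel_mono (HomologicalComplex.homologyπ _ t), zero_comp,
        ← HomologicalComplex.homologyπ_naturality, hH, comp_zero]
    rw [← cancel_epi (HomologicalComplex.iCycles _ t), comp_zero,
      ← HomologicalComplex.cyclesMap_i, h1, zero_comp]
  exact ModuleCat.hom_ext (congr_arg (fun t => Hom.app t 0) hψ)

end

/-- A complex of `R`-modules `N` with finitely generated cohomology, bounded above, is acyclic as
soon as all maps from its shifts to a dualizing complex are null-homotopic. -/
lemma acyclic_of_dual_eq_zero [IsNoetherianRing R]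
    (ω : CochainComplex (ModuleCat.{u} R) ℤ) [IsDualizingComplex ω]
    (N : CochainComplex (ModuleCat.{u} R) ℤ) (hfin : ∀ n, Module.Finite R (N.homology n))
    (hbdd : ∃ b : ℤ, ∀ n > b, N.ExactAt n)
    (hN : ∀ (n : ℤ) (f : N⟦n⟧ ⟶ ω), Nonempty (Homotopy f 0)) : N.Acyclic := by
  by_contra hac
  obtain ⟨b, hb⟩ := hbdd
  obtain ⟨n₀, hn₀⟩ : ∃ n, ¬ N.ExactAt n := by
    by_contra! h
    exact hac h
  -- t is the top degree with nonzero cohomology.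
  obtain ⟨t, ht, hmax⟩ := Int.exists_greatest_of_bdd (P := fun n => ¬ N.ExactAt n)
    ⟨b, fun n hn => not_lt.1 fun h => hn (hb n h)⟩ ⟨n₀, hn₀⟩
  have : N.IsLE t := (CochainComplex.isLE_iff N t).2 fun i hi => by
    by_contra h
    exact (not_le.2 hi) (hmax i h)
  -- The duality results are stated for graded modules. Ordinary complexes are made into constant
  -- graded ones over the Laurent polynomial ring, acting through its augmentation.
  let ε : AddMonoidAlgebra R ℤ →ₐ[R] R := AddMonoidAlgebra.lift R R ℤ 1
  let 𝒮 : ℤ → Submodule R (AddMonoidAlgebra R ℤ) := AddMonoidAlgebra.grade R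
  let X : DerivedCategory (GrMod 𝒮) := DerivedCategory.Q.obj ((constC ε).obj N)
  -- R is the dual of ω, so by symmetry of duality maps N → R[n] vanish as soon as maps from ω to
  -- the dual of N[-n] do; and this dual is zero by `hN`.
  have hX : orth X (constD ε (ModuleCat.of R R)) := fun n => by
    let e : X⟦-n⟧ ≅ DerivedCategory.Q.obj ((constC ε).obj (N⟦-n⟧)) :=
      ((DerivedCategory.Q.commShiftIso (-n)).app _).symm ≪≫
        DerivedCategory.Q.mapIso ((((const ε).mapHomologicalComplex
          (ComplexShape.up ℤ)).commShiftIso (-n)).app N).symm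
    let V : DerivedCategory (GrMod 𝒮) := DerivedCategory.Q.obj ((constC ε).obj ω)
    let e' : (constD ε (ModuleCat.of R R))⟦n⟧⟦-n⟧ ≅ (dualD ω).obj (op V) :=
      (shiftFunctorCompIsoId _ n (-n) (by ring)).app (constD (𝒜 := 𝒮) ε (ModuleCat.of R R)) ≪≫
        (nonempty_dual_constC_iso (ω := ω) ε).some ≪≫ (dualDIso ω _).symm
    rw [← subsingleton_shift_iff _ _ (-n), subsingleton_congr e e', subsingleton_iff]
    refine fun g => eq_zero_of_dual ω V _ (fun g => IsZero.eq_of_tgt ?_ _ _) g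
    refine IsZero.of_iso (isZero_dual_constC ω (N⟦-n⟧) ε fun m f => ?_) (dualDIso ω _)
    have hf := (hN (-n + m) ((shiftFunctorAdd _ (-n) m).hom.app N ≫ f)).some
    have hf' : f = (shiftFunctorAdd _ (-n) m).inv.app N ≫
      (shiftFunctorAdd _ (-n) m).hom.app N ≫ f := by simp
    rw [hf']
    exact ⟨(hf.compLeft _).trans (Homotopy.ofEq comp_zero)⟩
  -- `eq_zero_of_orth` needs the terms, not only the cohomology, to vanish above t; truncation
  -- arranges this.
  have : QuasiIso (N.ιTruncLE t) := inferInstance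
  have hq : QuasiIso ((constC (𝒜 := 𝒮) ε).map (N.ιTruncLE t)) := inferInstance
  have hq' : IsIso (DerivedCategory.Q.map ((constC (𝒜 := 𝒮) ε).map (N.ιTruncLE t))) :=
    (DerivedCategory.isIso_Q_map_iff_quasiIso _ _).2 hq
  let X' : DerivedCategory (GrMod 𝒮) := DerivedCategory.Q.obj ((constC ε).obj (N.truncLE t))
  let eX : X' ≅ X := @asIso _ _ _ _ _ hq'
  have hX' (M : ModuleCat.{u} R) (h : orth X (constD ε M)) : orth X' (constD ε M) :=
    fun n => (subsingleton_congr eX (Iso.refl _)).2 (h n)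
  let eH : (N.truncLE t).homology t ≅ N.homology t :=
    asIso (HomologicalComplex.homologyMap (N.ιTruncLE t) t)
  have := hfin t
  have : Nontrivial (N.homology t) := by
    by_contra h
    rw [not_nontrivial_iff_subsingleton, ← ModuleCat.isZero_iff_subsingleton,
      ← HomologicalComplex.exactAt_iff_isZero_homology] at h
    exact ht h
  obtain ⟨J, hJ, l, hl⟩ := IsNoetherianRing.exists_linearMap_ne_zero (L := N.homology t)
    {J : Ideal R | orth X (constD ε (ModuleCat.of R (R ⧸ J)))}
    (orth_of_iso X ((DerivedCategory.singleFunctor _ 0).mapIso ((const ε).mapIso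
      (LinearEquiv.toModuleIso (Submodule.quotEquivOfEqBot (⊥ : Ideal R) rfl).symm))) hX)
    (fun J hJ x hx => orth_constD_sup ε X J x hx hJ)
  have h1 := eq_zero_of_orth ε (N.truncLE t) t _ (hX' _ hJ) (eH.hom ≫ ModuleCat.ofHom l)
  exact hl (congr_arg ModuleCat.Hom.hom ((cancel_epi eH.hom).1 (h1.trans comp_zero.symm)))

end GrMod

namespace GrMod
open CochainComplex.HomComplex

variable {R A : Type u} [CommRing R] [CommRing A] [Algebra R A]
  {𝒜 : ℤ → Submodule R A} [GradedAlgebra 𝒜]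

/-! ### Noetherian graded modules -/

/-- The ascending chain condition on graded submodules, together with the same condition for
`R`-submodules of each weight piece. -/
structure IsNoeth (M : GrMod 𝒜) : Prop where
  chain (S : ℕ → ∀ i, Submodule R (M.X i))
    (hS : ∀ (t : ℕ) {i j k : ℤ} (h : i + j = k) (a : 𝒜 i) (x : M.X j), x ∈ S t j →
      M.act h a x ∈ S t k)
    (mono : ∀ t s i, t ≤ s → S t i ≤ S s i) : ∃ t₀, ∀ t i, S t i ≤ S t₀ i
  piece (i : ℤ) : IsNoetherian R (M.X i)

/-- A chain in the middle is stationary once its preimages in `M₁` and its images in `M₃` are; the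
same holds for each weight piece. -/
lemma IsNoeth.of_exact {M₁ M₂ M₃ : GrMod 𝒜} (f : M₁ ⟶ M₂) (g : M₂ ⟶ M₃)
    (hfg : ∀ i (x : M₂.X i), g.app i x = 0 ↔ ∃ y, f.app i y = x) (h₁ : IsNoeth M₁)
    (h₃ : IsNoeth M₃) : IsNoeth M₂ where
  chain S hS mono := by
    obtain ⟨t, ht⟩ := h₁.chain (fun t i => (S t i).comap (f.app i))
      (fun t i j k h a x hx => by
        rw [Submodule.mem_comap, hom_comm]
        exact hS t h a _ hx) (fun t s i hts => Submodule.comap_mono (mono t s i hts))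
    obtain ⟨s, hs⟩ := h₃.chain (fun t i => (S t i).map (g.app i))
      (fun t i j k h a x hx => by
        obtain ⟨y, hy, rfl⟩ := hx
        exact ⟨_, hS t h a y hy, hom_comm _ _ _ _⟩)
      (fun t s i hts => Submodule.map_mono (mono t s i hts))
    refine ⟨max t s, fun r i x hx => ?_⟩
    obtain ⟨y, hy, hxy⟩ := hs r i ⟨x, hx, rfl⟩
    have hy' := mono _ _ i (le_max_right t s) hy
    obtain ⟨z, hz⟩ := (hfg i (x - y)).1 (by rw [map_sub, hxy, sub_self])
    have hz' : z ∈ (S (max r (max t s)) i).comap (f.app i) := by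
      rw [Submodule.mem_comap, hz]
      exact sub_mem (mono _ _ i (le_max_left _ _) hx) (mono _ _ i (le_max_right _ _) hy')
    have h := mono _ _ i (le_max_left t s) (ht _ i hz')
    rw [hz] at h
    simpa using add_mem h hy'
  piece i := by
    have := h₁.piece i
    have := h₃.piece i
    refine isNoetherian_of_range_eq_ker (f.app i) (g.app i) ?_
    ext x
    exact (hfg i x).symm

lemma isNoeth_of_isZero {M : GrMod 𝒜} (hM : IsZero M) : IsNoeth M where
  chain S hS mono := ⟨0, fun t i x _ => by
    rw [(isZero_iff M).1 hM i x]
    exact zero_mem _⟩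
  piece i := by
    have : Subsingleton (M.X i) := subsingleton_of_forall_eq 0 ((isZero_iff M).1 hM i)
    infer_instance

lemma IsNoeth.of_injective {M N : GrMod 𝒜} (f : M ⟶ N) (hf : ∀ i, Function.Injective (f.app i))
    (hN : IsNoeth N) : IsNoeth M :=
  IsNoeth.of_exact (0 : zero ⟶ M) f (fun i x => ⟨fun h => ⟨0, ((injective_iff_map_eq_zero _).1
    (hf i) x h).symm⟩, by rintro ⟨y, rfl⟩; exact map_zero _⟩)
    (isNoeth_of_isZero ((isZero_iff _).2 fun _ _ => rfl)) hN

lemma IsNoeth.of_surjective {M N : GrMod 𝒜} (f : M ⟶ N) (hf : ∀ i, Function.Surjective (f.app i))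
    (hM : IsNoeth M) : IsNoeth N :=
  IsNoeth.of_exact f (0 : N ⟶ zero) (fun i x => ⟨fun _ => hf i x, fun _ => rfl⟩) hM
    (isNoeth_of_isZero ((isZero_iff _).2 fun _ _ => rfl))

lemma IsNoeth.of_iso {M N : GrMod 𝒜} (e : M ≅ N) (hM : IsNoeth M) : IsNoeth N :=
  hM.of_surjective e.hom (surjective_of_epi e.hom)

lemma IsNoeth.tw {M : GrMod 𝒜} (hM : IsNoeth M) (d : ℤ) : IsNoeth ((tw d).obj M) where
  chain S hS mono := by
    -- The chain reindexed to the weights of `M`; quantifying over j with i = j + d replaces the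
    -- subtraction i - d.
    let S' (t : ℕ) (i : ℤ) : Submodule R (M.X i) :=
      { carrier := {x | ∀ (j : ℤ) (h : i = j + d), M.cst h x ∈ S t j}
        zero_mem' := fun j h => by
          rw [map_zero]
          exact zero_mem (S t j)
        add_mem' := fun hx hy j h => by
          rw [map_add]
          exact add_mem (hx j h) (hy j h)
        smul_mem' := fun r x hx j h => by
          rw [map_smul]
          exact Submodule.smul_mem (S t j) r (hx j h) }
    obtain ⟨t₀, ht₀⟩ := hM.chain S'
      (fun t i j k h a x hx l hl => by
        have := hS t (by lia : i + (j - d) = l) a _ (hx (j - d) (by lia))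
        rw [cst_act]
        refine Eq.mp (congr_arg (· ∈ S t l) ?_) this
        exact M.act_cst (by lia) _ a x)
      (fun t s i hts x hx j h => mono t s j hts (hx j h))
    refine ⟨t₀, fun t i x hx => ?_⟩
    have := ht₀ t (i + d) (x := x) (fun j h => by
      obtain rfl : i = j := by lia
      exact (M.cst_rfl h x).symm ▸ hx) i rfl
    exact (M.cst_rfl rfl x) ▸ this
  piece i := hM.piece (i + d)

/-- Induction on `s`: pass to the kernel of one of the maps. The dual `of_jointly_surjective` passes
to a cokernel. -/
lemma IsNoeth.of_jointly_injective {ι : Type*} [DecidableEq ι] (N : ι → GrMod 𝒜)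
    (hN : ∀ k, IsNoeth (N k)) (s : Finset ι) : ∀ (M : GrMod 𝒜) (g : ∀ k, M ⟶ N k),
      (∀ i (x : M.X i), (∀ k ∈ s, (g k).app i x = 0) → x = 0) → IsNoeth M := by
  induction s using Finset.induction with
  | empty =>
    exact fun M g h => isNoeth_of_isZero ((isZero_iff M).2 fun i x => h i x fun k hk =>
      absurd hk (Finset.notMem_empty k))
  | insert a s ha ih =>
    intro M g h
    refine IsNoeth.of_exact (kerι (g a)) (g a) (fun i x => ⟨fun hx => ⟨⟨x, hx⟩, rfl⟩, ?_⟩)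
      (ih (ker (g a)) (fun k => kerι (g a) ≫ g k) fun i x hx => Subtype.ext (h i x.1 ?_)) (hN a)
    · rintro ⟨y, rfl⟩
      exact y.2
    · intro k hk
      rcases Finset.mem_insert.1 hk with rfl | hk
      · exact x.2
      · exact hx k hk

lemma IsNoeth.of_jointly_surjective {ι : Type*} [DecidableEq ι] (N : ι → GrMod 𝒜)
    (hN : ∀ k, IsNoeth (N k)) (s : Finset ι) : ∀ (M : GrMod 𝒜) (g : ∀ k, N k ⟶ M),
      (∀ i (x : M.X i), ∃ y : ∀ k, (N k).X i, x = ∑ k ∈ s, (g k).app i (y k)) → IsNoeth M := by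
  induction s using Finset.induction with
  | empty =>
    refine fun M g h => isNoeth_of_isZero ((isZero_iff M).2 fun i x => ?_)
    obtain ⟨y, rfl⟩ := h i x
    exact Finset.sum_empty
  | insert a s ha ih =>
    intro M g h
    refine IsNoeth.of_exact (g a) (cokerπ (g a)) (fun i x => Submodule.Quotient.mk_eq_zero _)
      (hN a) (ih (coker (g a)) (fun k => g k ≫ cokerπ (g a)) fun i x => ?_)
    obtain ⟨x, rfl⟩ := Submodule.mkQ_surjective _ x
    obtain ⟨y, rfl⟩ := h i x
    refine ⟨y, ?_⟩
    rw [Finset.sum_insert ha, map_add, map_sum]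
    have : (LinearMap.range ((g a).app i)).mkQ ((g a).app i (y a)) = 0 :=
      (Submodule.Quotient.mk_eq_zero _).2 ⟨y a, rfl⟩
    rw [this, zero_add]
    rfl

/-- The weight pieces of a Noetherian graded algebra are finite over the piece of weight zero. -/
lemma finite_piece [IsNoetherianRing A] [Module.Finite R (𝒜 0)] (i : ℤ) :
    Module.Finite R (𝒜 i) := by
  -- Generators of the ideal spanned by `𝒜 i` are chosen inside `𝒜 i`. Comparing components of
  -- weight i, coefficients of weight 0 suffice, and `𝒜 0` is finite over R.
  obtain ⟨t, hts, ht⟩ := (Submodule.fg_span_iff_fg_span_finset_subset (R := A)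
    (𝒜 i : Set A)).1 (IsNoetherian.noetherian _)
  let φ : (t → 𝒜 0) →ₗ[R] 𝒜 i := ∑ k : t,
    (((self 𝒜).act (zero_add i)).flip (⟨k.1, hts k.2⟩ : 𝒜 i)) ∘ₗ LinearMap.proj k
  refine Module.Finite.of_surjective φ fun x => ?_
  have hx : (x : A) ∈ Submodule.span A (t : Set A) := ht ▸ Submodule.subset_span x.2
  obtain ⟨c, -, hc⟩ := Submodule.mem_span_finset.1 hx
  refine ⟨fun k => DirectSum.decompose 𝒜 (c k) 0, Subtype.ext ?_⟩
  have h1 : (φ (fun k => DirectSum.decompose 𝒜 (c k) 0) : A) =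
      ∑ k ∈ t, (DirectSum.decompose 𝒜 (c k) 0 : A) * k := by
    rw [← Finset.sum_coe_sort]
    simp only [φ, LinearMap.sum_apply, AddSubmonoidClass.coe_finsetSum]
    rfl
  rw [h1]
  have h2 : (DirectSum.decompose 𝒜 (x : A) i : A) = x := by
    rw [DirectSum.decompose_coe, DirectSum.of_eq_same]
  rw [← h2, ← hc, DirectSum.decompose_sum, DFinsupp.finsetSum_apply, AddSubmonoidClass.coe_finsetSum]
  refine Finset.sum_congr rfl fun k hk => ?_
  have := DirectSum.coe_decompose_mul_add_of_right_mem 𝒜 (i := 0) (a := c k) (hts hk)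
  rw [zero_add] at this
  exact this.symm

variable (𝒜) in
-- Graded submodules of A are homogeneous ideals, so the chain condition is that of `A`; the pieces
-- are finite over R by `finite_piece`.
lemma isNoeth_self [IsNoetherianRing R] [IsNoetherianRing A] [Module.Finite R (𝒜 0)] :
    IsNoeth (self 𝒜) where
  chain S hS mono := by
    let I (t : ℕ) : Ideal A :=
      { carrier := {a | ∀ i, DirectSum.decompose 𝒜 a i ∈ S t i}
        zero_mem' := fun i => by
          rw [DirectSum.decompose_zero]
          exact zero_mem (S t i)
        add_mem' := fun ha hb i => by
          rw [DirectSum.decompose_add, DirectSum.add_apply]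
          exact add_mem (ha i) (hb i)
        smul_mem' := fun b a ha => by
          change ∀ i, _
          induction b using DirectSum.Decomposition.inductionOn 𝒜 with
          | zero =>
            intro i
            rw [zero_smul, DirectSum.decompose_zero]
            exact zero_mem (S t i)
          | add b c hb hc =>
            intro i
            rw [add_smul, DirectSum.decompose_add, DirectSum.add_apply]
            exact add_mem (hb i) (hc i)
          | homogeneous b =>
            rename_i m
            intro i
            have h := DirectSum.coe_decompose_mul_add_of_left_mem 𝒜 (j := i - m) b.2 (b := a)
            obtain ⟨k, rfl⟩ : ∃ k, i = m + k := ⟨i - m, by ring⟩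
            rw [add_sub_cancel_left] at h
            have h' : DirectSum.decompose 𝒜 ((b : A) • a) (m + k) =
                (self 𝒜).act rfl b (DirectSum.decompose 𝒜 a k) := Subtype.ext h
            rw [h']
            exact hS t rfl b _ (ha k) }
    obtain ⟨t₀, ht₀⟩ := monotone_stabilizes_iff_noetherian.2 (inferInstanceAs (IsNoetherian A A))
      ⟨I, fun t s hts a ha i => mono t s i hts (ha i)⟩
    refine ⟨t₀, fun t i (x : 𝒜 i) hx => ?_⟩
    have hmem : (x : A) ∈ I t := fun j => by
      rw [DirectSum.decompose_coe]
      by_cases hj : i = j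
      · subst hj
        rw [DirectSum.of_eq_same]
        exact hx
      · rw [DirectSum.of_eq_of_ne _ _ _ (Ne.symm hj)]
        exact zero_mem (S t j)
    have h1 : (x : A) ∈ I (max t t₀) := fun j => mono _ _ j (le_max_left _ _) (hmem j)
    have h2 : (x : A) ∈ I t₀ := by
      have h0 : I t₀ = I (max t t₀) := ht₀ _ (le_max_right _ _)
      exact h0 ▸ h1
    have h3 := h2 i
    rwa [DirectSum.decompose_coe, DirectSum.of_eq_same] at h3
  piece i := by
    have := finite_piece (R := R) (𝒜 := 𝒜) i
    exact isNoetherian_of_isNoetherianRing_of_finite R (𝒜 i)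

/-- A finitely generated graded module is Noetherian. -/
lemma IsFG.isNoeth [IsNoetherianRing R] [IsNoetherianRing A] [Module.Finite R (𝒜 0)]
    {M : GrMod 𝒜} (hM : IsFG M) : IsNoeth M := by
  obtain ⟨n, d, x, h⟩ := hM
  refine IsNoeth.of_jointly_surjective (fun k => (GrMod.tw (-d k)).obj (self 𝒜))
    (fun k => (isNoeth_self 𝒜).tw _) Finset.univ M
    (fun k => genMap (add_neg_cancel (d k)) (x k)) fun i y => ?_
  obtain ⟨a, rfl⟩ := h i y
  exact ⟨fun k => a k, Finset.sum_congr rfl fun k _ => rfl⟩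

/-- A Noetherian graded module in which all elements are killed by elements of very negative
weight vanishes in very negative weights. -/
lemma IsNoeth.exists_subsingleton {M : GrMod 𝒜} (hM : IsNoeth M)
    (h : ∀ j (x : M.X j), ∃ m : ℕ, ∀ (i : ℤ) (a : 𝒜 i), i ≤ -m → M.act rfl a x = 0) :
    ∃ i₀ : ℤ, ∀ i < i₀, Subsingleton (M.X i) := by
  -- Elements annihilated by every scalar that would move them to weight at most -t. These form an
  -- ascending chain of graded submodules exhausting `M`.
  let S (t : ℕ) (j : ℤ) : Submodule R (M.X j) :=
    { carrier := {x | ∀ (i : ℤ) (a : 𝒜 i), i + j ≤ -t → M.act rfl a x = 0}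
      zero_mem' := fun i a _ => map_zero _
      add_mem' := fun hx hy i a hi => by rw [map_add, hx i a hi, hy i a hi, add_zero]
      smul_mem' := fun r x hx i a hi => by rw [map_smul, hx i a hi, smul_zero] }
  obtain ⟨t, ht⟩ := hM.chain S (fun t i j k hk a x hx l b hl => by
      subst hk
      refine (M.act_act rfl rfl (by ring) b a (hmul rfl b a) rfl x).trans ?_
      have := congr_arg (M.cst (add_assoc l i j)) (hx (l + i) (hmul rfl b a) (by lia))
      rwa [cst_act, map_zero] at this)
    (fun t s j hts x hx i a hi => hx i a (by lia))
  refine ⟨-t, fun i hi => subsingleton_of_forall_eq 0 fun x => ?_⟩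
  obtain ⟨m, hm⟩ := h i x
  -- The summand |i| turns a bound on the weight of a x into the bound on the weight of a. In weight
  -- below -t the scalar 1 is then among the annihilators.
  have hx : x ∈ S t i := ht (m + i.natAbs) i (x := x) fun j a hj => hm j a (by lia)
  have := congr_arg (M.cst (zero_add i)) (hx 0 (hone 𝒜) (by lia))
  rwa [cst_act, map_zero, act_hone] at this

end GrMod

/-! ### Coreflections of cones -/

section Coreflection
variable {C : Type u} [Category.{v} C] {P : ObjectProperty C}

namespace IsCoreflection

lemma exists_comp_eq {T X : C} {i : T ⟶ X} (h : IsCoreflection P i) {S : C} (hS : P S)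
    (g : S ⟶ X) : ∃ g' : S ⟶ T, g' ≫ i = g :=
  (h.bijective S hS).2 g

lemma eq_zero [Preadditive C] {T X : C} {i : T ⟶ X} (h : IsCoreflection P i) {S : C} (hS : P S)
    (g : S ⟶ T) (hg : g ≫ i = 0) : g = 0 :=
  (h.bijective S hS).1 (hg.trans zero_comp.symm)

lemma shift [HasShift C ℤ] [P.IsStableUnderShift ℤ] {T X : C} {i : T ⟶ X} (h : IsCoreflection P i) (n : ℤ) :
    IsCoreflection P (i⟦n⟧') :=
  h.map (shiftEquiv C n).symm.toAdjunction (P.le_shift (-n)) (P.le_shift n)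

variable [HasZeroObject C] [HasShift C ℤ] [Preadditive C]
  [∀ n : ℤ, (shiftFunctor C n).Additive] [Pretriangulated C] [P.IsStableUnderShift ℤ]

/-- Coreflections are stable under cones. -/
lemma third {t t' : Triangle C} (ht : t ∈ distTriang C) (ht' : t' ∈ distTriang C) (φ : t ⟶ t')
    (h₁ : IsCoreflection P φ.hom₁) (h₂ : IsCoreflection P φ.hom₂) (h₃ : P t.obj₃) :
    IsCoreflection P φ.hom₃ where
  prop := h₃
  bijective S hS := by
    -- The five lemma for maps from `S`, as a diagram chase; the shift of `h₁` handles the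
    -- connecting map.
    have inj (g : S ⟶ t.obj₃) (hg : g ≫ φ.hom₃ = 0) : g = 0 := by
      have h0 : g ≫ t.mor₃ = 0 := (h₁.shift 1).eq_zero hS _ (by
        rw [Category.assoc, φ.comm₃, reassoc_of% hg, zero_comp])
      obtain ⟨h, rfl⟩ := Triangle.coyoneda_exact₃ t ht g h0
      obtain ⟨k, hk⟩ := Triangle.coyoneda_exact₂ t' ht' (h ≫ φ.hom₂) (by
        rw [Category.assoc, ← φ.comm₂, ← Category.assoc, hg])
      obtain ⟨k', rfl⟩ := h₁.exists_comp_eq hS k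
      have h4 : h = k' ≫ t.mor₁ := sub_eq_zero.1 (h₂.eq_zero hS _ (by
        rw [Preadditive.sub_comp, hk, Category.assoc, Category.assoc, φ.comm₁, sub_self]))
      rw [h4, Category.assoc, comp_distTriang_mor_zero₁₂ t ht, comp_zero]
    refine ⟨fun g g' hg => sub_eq_zero.1 (inj _ ?_), fun g => ?_⟩
    · exact (Preadditive.sub_comp ..).trans (sub_eq_zero.2 hg)
    · obtain ⟨a, ha⟩ := (h₁.shift 1).exists_comp_eq hS (g ≫ t'.mor₃)
      have h0 : a ≫ t.mor₁⟦1⟧' = 0 := (h₂.shift 1).eq_zero hS _ (by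
        rw [Category.assoc, ← CategoryTheory.Functor.map_comp, φ.comm₁, CategoryTheory.Functor.map_comp, reassoc_of% ha,
          comp_distTriang_mor_zero₃₁ t' ht', comp_zero])
      obtain ⟨b, rfl⟩ := Triangle.coyoneda_exact₁ t ht a h0
      obtain ⟨c, hc⟩ := Triangle.coyoneda_exact₃ t' ht' (g - b ≫ φ.hom₃) (by
        rw [Preadditive.sub_comp, Category.assoc, ← φ.comm₃, ← ha, Category.assoc, sub_self])
      obtain ⟨c', rfl⟩ := h₂.exists_comp_eq hS c
      refine ⟨b + c' ≫ t.mor₂, ?_⟩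
      dsimp only
      rw [Preadditive.add_comp, Category.assoc c', φ.comm₂, ← Category.assoc c', ← hc,
        add_sub_cancel]

end IsCoreflection
end Coreflection

namespace GrMod

variable {R A : Type u} [CommRing R] [CommRing A] [Algebra R A]
  {𝒜 : ℤ → Submodule R A} [GradedAlgebra 𝒜]

/-! ### Multiplication by a homogeneous element on the derived category -/

lemma isTorsion_tw {I : Ideal A} {M : GrMod 𝒜} (h : IsTorsion I M) (d : ℤ) :
    IsTorsion I ((tw d).obj M) := by
  intro j x
  obtain ⟨n, hn⟩ := h (j + d) x
  have key (i k : ℤ) (a : 𝒜 i) (hk : i + (j + d) = k) (h0 : M.act rfl a x = 0) :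
      M.act hk a x = 0 := by
    subst hk
    exact h0
  exact ⟨n, fun i a ha => key i _ a _ (hn i a ha)⟩

/-- Opposite twists cancel. -/
def twIso (M : GrMod 𝒜) {d e : ℤ} (h : d + e = 0) : (tw e).obj ((tw d).obj M) ≅ M where
  hom := { app := fun i => M.cst (by lia : i + e + d = i)
           comm := fun hk a x => (M.cst_act (by lia) _ a x).trans (M.act_cst (by lia) _ a x).symm }
  inv := { app := fun i => M.cst (by lia : i = i + e + d)
           comm := fun hk a x => (M.cst_act _ _ a x).trans (M.act_cst (by lia) _ a x).symm }
  hom_inv_id := hom_ext fun i x => (M.cst_cst (by lia : i + e + d = i) (by lia) x).trans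
    (M.cst_rfl _ x)
  inv_hom_id := hom_ext fun i x => (M.cst_cst (by lia : i = i + e + d) (by lia) x).trans
    (M.cst_rfl _ x)

lemma twIso_naturality {M N : GrMod 𝒜} (f : M ⟶ N) {d e : ℤ} (h : d + e = 0) :
    (tw e).map ((tw d).map f) ≫ (twIso N h).hom = (twIso M h).hom ≫ f :=
  hom_ext fun i x => (hom_cst f (by lia : i + e + d = i) x).symm

/-- Twisting is an equivalence. -/
def twEquiv (d : ℤ) : GrMod 𝒜 ≌ GrMod 𝒜 :=
  CategoryTheory.Equivalence.mk (tw d) (tw (-d))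
    (NatIso.ofComponents (fun M => twIso M (add_neg_cancel d))
      fun f => twIso_naturality f (add_neg_cancel d)).symm
    (NatIso.ofComponents (fun M => twIso M (neg_add_cancel d))
      fun f => twIso_naturality f (neg_add_cancel d))

/-- Twists of objects of the derived category. -/
noncomputable abbrev twD (d : ℤ) : DerivedCategory (GrMod 𝒜) ⥤ DerivedCategory (GrMod 𝒜) :=
  (tw d).mapDerivedCategory

noncomputable instance (d : ℤ) : CatCommSq (twC (𝒜 := 𝒜) d) DerivedCategory.Q DerivedCategory.Q (twD d) :=
  ⟨(tw d).mapDerivedCategoryFactors.symm⟩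

/-- The inverse twist is left adjoint to the twist. -/
noncomputable def twAdj (d : ℤ) : twD (𝒜 := 𝒜) (-d) ⊣ twD d :=
  have : (twEquiv (𝒜 := 𝒜) d).symm.functor.PreservesZeroMorphisms :=
    inferInstanceAs (tw (𝒜 := 𝒜) (-d)).PreservesZeroMorphisms
  have adj : twC (𝒜 := 𝒜) (-d) ⊣ twC d :=
    (@CategoryTheory.Equivalence.mapHomologicalComplex ℤ _ _ _ _ _ _ (twEquiv (𝒜 := 𝒜) d).symm this
      (ComplexShape.up ℤ)).toAdjunction
  adj.localization DerivedCategory.Q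
    (HomologicalComplex.quasiIso (GrMod 𝒜) (ComplexShape.up ℤ)) DerivedCategory.Q
    (HomologicalComplex.quasiIso (GrMod 𝒜) (ComplexShape.up ℤ)) (twD (-d)) (twD d)

section
variable {d : ℤ} (f : 𝒜 d)

/-- Multiplication by a homogeneous element. -/
def mulNat : 𝟭 (GrMod 𝒜) ⟶ tw d where
  app M := { app := fun i => M.act (by lia) f, comm := fun _ a x => M.act_comm _ _ _ _ f a x }
  naturality _ _ φ := hom_ext fun i x => (hom_comm φ _ f x).symm

/-- Multiplication by a homogeneous element, on complexes. -/
noncomputable def mulNatC : 𝟭 (CochainComplex (GrMod 𝒜) ℤ) ⟶ twC d where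
  app K := { f := fun n => (mulNat f).app (K.X n)
             comm' := fun i j _ => ((mulNat f).naturality (K.d i j)).symm }
  naturality K L φ := by
    ext n : 1
    exact (mulNat f).naturality (φ.f n)

/-- Multiplication by a homogeneous element, on the derived category. -/
noncomputable def mulD : 𝟭 (DerivedCategory (GrMod 𝒜)) ⟶ twD d :=
  Localization.liftNatTrans DerivedCategory.Q
    (HomologicalComplex.quasiIso (GrMod 𝒜) (ComplexShape.up ℤ))
    (𝟭 (CochainComplex (GrMod 𝒜) ℤ) ⋙ DerivedCategory.Q)
    (twC d ⋙ DerivedCategory.Q) _ _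
    (Functor.whiskerRight (mulNatC f) DerivedCategory.Q)

lemma mulD_Q (K : CochainComplex (GrMod 𝒜) ℤ) :
    (mulD f).app (DerivedCategory.Q.obj K) =
      DerivedCategory.Q.map ((mulNatC f).app K) ≫ (tw d).mapDerivedCategoryFactors.inv.app K := by
  refine (Localization.liftNatTrans_app ..).trans ?_
  exact Category.id_comp _

/-- The cohomology of `X`. -/
noncomputable abbrev coh (n : ℤ) : DerivedCategory (GrMod 𝒜) ⥤ GrMod 𝒜 :=
  DerivedCategory.homologyFunctor (GrMod 𝒜) n

/-- Naturality of `mulNat` lets its values on cycles and homology serve as the map induced on left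
homology data. -/
lemma homologyMap_mulNat {S : ShortComplex (GrMod 𝒜)} (φ : S ⟶ S.map (tw d))
    (h₁ : φ.τ₁ = (mulNat f).app _) (h₂ : φ.τ₂ = (mulNat f).app _) :
    ShortComplex.homologyMap φ ≫ (S.mapHomologyIso (tw d)).hom = (mulNat f).app S.homology := by
  let hl := S.homologyData.left
  let γ : ShortComplex.LeftHomologyMapData φ hl (hl.map (tw d)) :=
    { φK := (mulNat f).app hl.K
      φH := (mulNat f).app hl.H
      commi := by
        rw [h₂]
        exact ((mulNat f).naturality hl.i).symm
      commf' := by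
        rw [h₁, ShortComplex.LeftHomologyData.map_f']
        exact (mulNat f).naturality hl.f'
      commπ := ((mulNat f).naturality hl.π) }
  rw [hl.mapHomologyIso_eq, γ.homologyMap_eq]
  refine Eq.trans ?_ ((congr_arg (· ≫ (mulNat f).app S.homology) hl.homologyIso.hom_inv_id).trans
    (Category.id_comp _))
  have h := (mulNat f).naturality hl.homologyIso.inv
  refine Eq.trans ?_ (Eq.trans (congr_arg (hl.homologyIso.hom ≫ ·) h.symm)
    (Category.assoc _ _ _).symm)
  change (hl.homologyIso.hom ≫ (mulNat f).app hl.H ≫ (hl.map (tw d)).homologyIso.inv) ≫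
    (hl.map (tw d)).homologyIso.hom ≫ (tw d).map hl.homologyIso.inv = _
  refine (Category.assoc _ _ _).trans (congr_arg (hl.homologyIso.hom ≫ ·) ?_)
  refine (Category.assoc _ _ _).trans (congr_arg ((mulNat f).app hl.H ≫ ·) ?_)
  exact Iso.inv_hom_id_assoc _ _

/-- On cohomology, `mulD f` is multiplication by `f`. -/
lemma exists_coh_mulD (X : DerivedCategory (GrMod 𝒜)) (n : ℤ) :
    ∃ e : (coh n).obj ((twD d).obj X) ≅ (tw d).obj ((coh n).obj X),
      (coh n).map ((mulD f).app X) ≫ e.hom = (mulNat f).app _ := by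
  obtain ⟨K, ⟨ε'⟩⟩ := exists_Q_iso X
  let ε : X ≅ DerivedCategory.Q.obj K := ε'.symm
  let hF := DerivedCategory.homologyFunctorFactors (GrMod 𝒜) n
  let e₀ : (coh n).obj (DerivedCategory.Q.obj ((twC d).obj K)) ≅
      (tw d).obj ((coh n).obj (DerivedCategory.Q.obj K)) :=
    hF.app _ ≪≫ (K.sc n).mapHomologyIso (tw d) ≪≫ (tw d).mapIso (hF.app K).symm
  have h₀ : (coh n).map (DerivedCategory.Q.map ((mulNatC f).app K)) ≫ e₀.hom =
      (mulNat f).app _ := by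
    have h1 := hF.hom.naturality ((mulNatC f).app K)
    have h2 := homologyMap_mulNat f (S := K.sc n)
      ((HomologicalComplex.shortComplexFunctor _ _ n).map ((mulNatC f).app K)) rfl rfl
    have h3 := (mulNat f).naturality (hF.hom.app K)
    refine (Category.assoc _ _ _).symm.trans
      ((congr_arg (fun t => t ≫ _) h1).trans ((Category.assoc _ _ _).trans ?_))
    refine Eq.trans (congr_arg (fun t => hF.hom.app K ≫ t) ((Category.assoc _ _ _).symm.trans
      (congr_arg (fun t => t ≫ (tw d).map (hF.inv.app K)) h2))) ?_
    refine (Category.assoc _ _ _).symm.trans ((congr_arg (fun t => t ≫ (tw d).map (hF.inv.app K)) h3).trans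
      ((Category.assoc _ _ _).trans ?_))
    refine Eq.trans (congr_arg (fun t => (mulNat f).app _ ≫ t) ?_) (Category.comp_id _)
    exact ((tw d).map_comp _ _).symm.trans ((congr_arg (tw d).map (hF.hom_inv_id_app K)).trans
      ((tw d).map_id _))
  refine ⟨(coh n).mapIso ((twD d).mapIso ε ≪≫ (tw d).mapDerivedCategoryFactors.app K) ≪≫ e₀ ≪≫
    (tw d).mapIso ((coh n).mapIso ε.symm), ?_⟩
  have h1 : (mulD f).app X ≫ (twD d).map ε.hom ≫ (tw d).mapDerivedCategoryFactors.hom.app K =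
      ε.hom ≫ DerivedCategory.Q.map ((mulNatC f).app K) := by
    have h2 : (mulD f).app X ≫ (twD d).map ε.hom = ε.hom ≫ (mulD f).app _ :=
      ((mulD f).naturality ε.hom).symm
    have h3 : (mulD f).app (DerivedCategory.Q.obj K) ≫ (tw d).mapDerivedCategoryFactors.hom.app K =
        DerivedCategory.Q.map ((mulNatC f).app K) := by
      rw [mulD_Q, Category.assoc, Iso.inv_hom_id_app]
      exact Category.comp_id _
    exact (Category.assoc _ _ _).symm.trans ((congr_arg (· ≫ _) h2).trans
      ((Category.assoc _ _ _).trans (congr_arg (ε.hom ≫ ·) h3)))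
  have h2 := congr_arg (coh n).map h1
  have h3 := (mulNat f).naturality ((coh n).map ε.hom)
  rw [Functor.map_comp, Functor.map_comp (coh n) ε.hom] at h2
  refine (Category.assoc _ _ _).symm.trans ((congr_arg (fun t => t ≫ _) h2).trans
    ((Category.assoc _ _ _).trans ?_))
  refine Eq.trans (congr_arg (fun t => (coh n).map ε.hom ≫ t) ((Category.assoc _ _ _).symm.trans
      (congr_arg (fun t => t ≫ (tw d).map ((coh n).map ε.inv)) h₀))) ?_
  refine (Category.assoc _ _ _).symm.trans ((congr_arg (fun t => t ≫ (tw d).map ((coh n).map ε.inv))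
    h3).trans ((Category.assoc _ _ _).trans ?_))
  refine Eq.trans (congr_arg (fun t => (mulNat f).app _ ≫ t) ?_) (Category.comp_id _)
  exact ((tw d).map_comp _ _).symm.trans ((congr_arg (tw d).map (((coh n).map_comp _ _).symm.trans
    ((congr_arg (coh n).map ε.hom_inv_id).trans ((coh n).map_id _)))).trans ((tw d).map_id _))

lemma dTor_twD [IsNoetherianRing A] (I : HomogeneousIdeal 𝒜) (d : ℤ)
    (X : DerivedCategory (GrMod 𝒜)) (hX : dTor I X) : dTor I ((twD d).obj X) := fun n =>
  (isTorsion_tw (hX n) d).of_iso (exists_coh_mulD (0 : 𝒜 d) X n).choose.symm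

end

/-- Cones of torsion objects are torsion. -/
lemma dTor_third [IsNoetherianRing A] (I : HomogeneousIdeal 𝒜)
    (t : Triangle (DerivedCategory (GrMod 𝒜))) (ht : t ∈ distTriang _) (h₁ : dTor I t.obj₁)
    (h₂ : dTor I t.obj₂) : dTor I t.obj₃ := by
  obtain ⟨l, hl⟩ := exists_dTor_eq I
  rw [hl] at h₁ h₂ ⊢
  exact fun g hg => Triangle.isZero₃_of_isZero₁₂ _ ((locD g.2).map_distinguished _ ht)
    (h₁ g hg) (h₂ g hg)

/-- Local cohomology of the cone of multiplication by `f`. -/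
lemma exists_lc_cone [IsNoetherianRing A] (I : HomogeneousIdeal 𝒜) {d : ℤ} (f : 𝒜 d)
    {X Z : DerivedCategory (GrMod 𝒜)} {p : (twD d).obj X ⟶ Z} {δ : Z ⟶ X⟦(1 : ℤ)⟧}
    (h : Triangle.mk ((mulD f).app X) p δ ∈ distTriang _) :
    ∃ (p' : (twD d).obj ((localCohomology I).obj X) ⟶ (localCohomology I).obj Z)
      (δ' : (localCohomology I).obj Z ⟶ ((localCohomology I).obj X)⟦(1 : ℤ)⟧),
      Triangle.mk ((mulD f).app ((localCohomology I).obj X)) p' δ' ∈ distTriang _ := by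
  let T := (localCohomology I).obj X
  obtain ⟨W, p', δ', hW⟩ := distinguished_cocone_triangle ((mulD f).app T)
  have hi := isCoreflection_lcCounit I X
  -- The cone W of multiplication by `f` on RΓ_I X maps to Z. The twist preserves coreflections, so
  -- by `IsCoreflection.third` this map is a coreflection, whence W = RΓ_I Z.
  obtain ⟨c, hc₁, hc₂⟩ := complete_distinguished_triangle_morphism _ _ hW h (lcCounit I X)
    ((twD d).map (lcCounit I X)) ((mulD f).naturality (lcCounit I X)).symm
  have h3 := IsCoreflection.third hW h
    { hom₁ := lcCounit I X
      hom₂ := (twD d).map (lcCounit I X)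
      hom₃ := c
      comm₁ := ((mulD f).naturality (lcCounit I X)).symm
      comm₂ := hc₁
      comm₃ := hc₂ } hi (hi.map (twAdj d) (dTor_twD I (-d)) (dTor_twD I d))
    (dTor_third I _ hW hi.prop (dTor_twD I d _ hi.prop))
  obtain ⟨e⟩ : Nonempty ((localCohomology I).obj Z ≅ W) := nonempty_lc_iso h3
  refine ⟨p' ≫ e.inv, e.hom ≫ δ', isomorphic_distinguished _ hW _
    (Triangle.isoMk _ _ (Iso.refl _) (Iso.refl _) e ?_ ?_ ?_)⟩
  · exact (Category.comp_id _).trans (Category.id_comp _).symm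
  · change (p' ≫ e.inv) ≫ e.hom = 𝟙 _ ≫ p'
    exact ((Category.assoc _ _ _).trans (congr_arg (p' ≫ ·) e.inv_hom_id)).trans
      ((Category.comp_id _).trans (Category.id_comp _).symm)
  · exact (congr_arg ((e.hom ≫ δ') ≫ ·) ((shiftFunctor _ (1 : ℤ)).map_id T)).trans
      (Category.comp_id _)

end GrMod

namespace GrMod

variable {R A : Type u} [CommRing R] [CommRing A] [Algebra R A]
  {𝒜 : ℤ → Submodule R A} [GradedAlgebra 𝒜]

/-! ### Koszul complexes and finiteness of local cohomology -/

lemma act_eq_zero_of_eq_zero (M : GrMod 𝒜) {i j k k' : ℤ} (h : i + j = k) (h' : i + j = k')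
    (a : 𝒜 i) (x : M.X j) (h0 : M.act h a x = 0) : M.act h' a x = 0 := by
  subst h h'
  exact h0

/-- One power of `g` moves an element into the image of α and a second one kills it; the exponents
add. -/
lemma isZero_loc_of_exact {e : ℤ} (g : 𝒜 e) {M N P : GrMod 𝒜} (α : M ⟶ N) (β : N ⟶ P)
    (h : ∀ i (z : N.X i), β.app i z = 0 → ∃ y, α.app i y = z)
    (hβ : ∀ i (z : N.X i), ∃ k : ℕ, P.act rfl (pw g k) (β.app i z) = 0)
    (hα : ∀ i (y : M.X i), ∃ k : ℕ, α.app _ (M.act rfl (pw g k) y) = 0) :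
    IsZero ((loc g).obj N) := by
  rw [isZero_loc_iff]
  intro i z
  obtain ⟨k, hk⟩ := hβ i z
  obtain ⟨y, hy⟩ := h _ (N.act rfl (pw g k) z) ((hom_comm β _ _ _).trans hk)
  obtain ⟨l, hl⟩ := hα _ y
  refine ⟨l + k, ?_⟩
  have h1 : N.act rfl (pw g l) (N.act rfl (pw g k) z) = 0 := by
    rw [← hy, ← hom_comm]
    exact hl
  rw [N.act_act rfl rfl (p := (l + k : ℕ) * e) (by push_cast; ring) _ _ (pw g (l + k))
    (by simp [pow_add])] at h1
  exact N.act_eq_zero_of_eq_zero _ _ _ _ h1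

section
variable {d : ℤ} (f : 𝒜 d) {M N : GrMod 𝒜} (β : N ⟶ M)

/-- If `N` maps onto the `f`-torsion of `M` and vanishes in certain weights, then so does `M`. -/
lemma eq_zero_of_surjective_torsion (hf : IsZero ((loc f).obj M))
    (hβ : ∀ i (x : M.X i), M.act (rfl : d + i = d + i) f x = 0 → ∃ y, β.app i y = x)
    (s : Set ℤ) (hs : ∀ i ∈ s, d + i ∈ s) (hN : ∀ i ∈ s, Subsingleton (N.X i)) (i : ℤ)
    (hi : i ∈ s) : Subsingleton (M.X i) := by
  -- If f^(k+1) x = 0, then f x, whose weight is again in `s`, vanishes by induction; so x comes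
  -- from `N`, which is zero in that weight.
  have key (k : ℕ) : ∀ i ∈ s, ∀ x : M.X i, M.act rfl (pw f k) x = 0 → x = 0 := by
    induction k with
    | zero =>
      intro i _ x hx
      have h0 : ((0 : ℕ) : ℤ) * d + i = i := by simp
      refine (M.act_hone (zero_add i) x).symm.trans ?_
      exact (M.act_congr _ h0 _ _ (by simp [hone]) x).trans
        (M.act_eq_zero_of_eq_zero rfl h0 _ _ hx)
    | succ k ih =>
      intro i hi x hx
      have h1 : M.act (rfl : d + i = d + i) f x = 0 := by
        refine ih _ (hs i hi) _ ?_
        rw [M.act_act rfl rfl (p := (k + 1 : ℕ) * d) (by push_cast; ring) _ _ (pw f (k + 1))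
          (by simp [pow_succ])]
        exact M.act_eq_zero_of_eq_zero _ _ _ _ hx
      obtain ⟨y, rfl⟩ := hβ i x h1
      have := hN i hi
      rw [Subsingleton.elim y 0, map_zero]
  refine subsingleton_of_forall_eq 0 fun x => ?_
  obtain ⟨k, hk⟩ := (isZero_loc_iff f M).1 hf i x
  exact key k i hi x hk

/-- Upward induction on the weight: multiplication by `f` has kernel a quotient of N_i, and its
target has the strictly smaller weight d + i. -/
lemma isNoetherian_of_surjective_torsion (hd : d < 0)
    (hβ : ∀ i (x : M.X i), M.act (rfl : d + i = d + i) f x = 0 ↔ ∃ y, β.app i y = x)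
    (hN : ∀ i, IsNoetherian R (N.X i)) (i₀ : ℤ) (hM : ∀ i < i₀, Subsingleton (M.X i)) (i : ℤ) :
    IsNoetherian R (M.X i) := by
  have key (m : ℕ) : ∀ i < i₀ + m, IsNoetherian R (M.X i) := by
    induction m with
    | zero =>
      intro i hi
      have := hM i (by simpa using hi)
      infer_instance
    | succ m ih =>
      intro i hi
      have := ih (d + i) (by push_cast at hi; lia)
      have := hN i
      refine isNoetherian_of_range_eq_ker (β.app i) (M.act (rfl : d + i = d + i) f) ?_
      ext x
      exact (hβ i x).symm
  exact key (i - i₀ + 1).toNat i (by lia)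

end

/-- The cohomology modules of the cone of multiplication by `f`. -/
lemma exists_coh_cone {d : ℤ} (f : 𝒜 d) {X Z : DerivedCategory (GrMod 𝒜)}
    {p : (twD d).obj X ⟶ Z} {δ : Z ⟶ X⟦(1 : ℤ)⟧}
    (h : Triangle.mk ((mulD f).app X) p δ ∈ distTriang _) (n : ℤ) :
    ∃ (α : (tw d).obj ((coh n).obj X) ⟶ (coh n).obj Z)
      (β : (coh n).obj Z ⟶ (coh (n + 1)).obj X),
      (∀ i z, β.app i z = 0 ↔ ∃ y, α.app i y = z) ∧
      (∀ i x, ((coh (n + 1)).obj X).act (rfl : d + i = d + i) f x = 0 ↔ ∃ z, β.app i z = x) ∧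
      ∀ i j (hj : d + i = j + d) (x : ((coh n).obj X).X i),
        α.app j (((coh n).obj X).act hj f x) = 0 := by
  obtain ⟨e, he⟩ := exists_coh_mulD f X n
  obtain ⟨e', he'⟩ := exists_coh_mulD f X (n + 1)
  let β := DerivedCategory.HomologySequence.δ (Triangle.mk ((mulD f).app X) p δ) n (n + 1) rfl
  have hp : e.inv ≫ (coh n).map p ≫ β = 0 :=
    (congr_arg (e.inv ≫ ·) (DerivedCategory.HomologySequence.comp_δ _ h n (n + 1) rfl)).trans comp_zero
  have hβ : β ≫ (mulNat f).app _ = 0 := by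
    refine (congr_arg (β ≫ ·) he'.symm).trans ?_
    refine (Category.assoc _ _ _).symm.trans ((congr_arg (· ≫ e'.hom)
      (DerivedCategory.HomologySequence.δ_comp _ h n (n + 1) rfl)).trans zero_comp)
  have hα : (mulNat f).app _ ≫ e.inv ≫ (coh n).map p = 0 := by
    refine (congr_arg (· ≫ e.inv ≫ (coh n).map p) he.symm).trans ?_
    refine (Category.assoc _ _ _).trans ((congr_arg ((coh n).map ((mulD f).app X) ≫ ·)
      (e.hom_inv_id_assoc _)).trans ?_)
    exact ((coh n).map_comp _ _).symm.trans ((congr_arg (coh n).map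
      (comp_distTriang_mor_zero₁₂ _ h)).trans ((coh n).map_zero _ _))
  refine ⟨e.inv ≫ (coh n).map p, β, fun i z => ⟨fun hz => ?_, ?_⟩, fun i x => ⟨fun hx => ?_, ?_⟩,
    fun i j hj x => ?_⟩
  · obtain ⟨y, hy⟩ := (exact_iff _).1 (DerivedCategory.HomologySequence.exact₃ _ h n (n + 1) rfl) i z hz
    refine ⟨e.hom.app i y, Eq.trans ?_ hy⟩
    exact congr_arg (fun t => ((coh n).map p).app i (Hom.app t i y)) e.hom_inv_id
  · rintro ⟨y, rfl⟩
    exact congr_arg (fun t => Hom.app t i y) hp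
  · refine (exact_iff _).1 (DerivedCategory.HomologySequence.exact₁ _ h n (n + 1) rfl) i x ?_
    apply ((injective_iff_map_eq_zero _).1 (injective_of_mono e'.hom i))
    refine (congr_arg (fun t => Hom.app t i x) he').trans ?_
    exact GrMod.act_eq_zero_of_eq_zero _ _ _ _ _ hx
  · rintro ⟨z, rfl⟩
    refine GrMod.act_eq_zero_of_eq_zero _ (by lia : d + i = i + d) _ _ _ ?_
    exact congr_arg (fun t => Hom.app t i z) hβ
  · obtain rfl : i = j := by lia
    exact congr_arg (fun t => Hom.app t i x) hα

/-- Complexes with Noetherian cohomology, vanishing in large degrees. -/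
structure IsBoundedNoeth (X : DerivedCategory (GrMod 𝒜)) : Prop where
  noeth (n : ℤ) : IsNoeth ((coh n).obj X)
  bdd : ∃ b : ℤ, ∀ n > b, IsZero ((coh n).obj X)

/-- Complexes with cohomology finite in each weight and vanishing in very negative weights and in
large degrees. -/
structure HasFinitePieces (X : DerivedCategory (GrMod 𝒜)) : Prop where
  noeth (n i : ℤ) : IsNoetherian R (((coh n).obj X).X i)
  low (n : ℤ) : ∃ i₀ : ℤ, ∀ i < i₀, Subsingleton (((coh n).obj X).X i)
  bdd : ∃ b : ℤ, ∀ n > b, IsZero ((coh n).obj X)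

lemma HasFinitePieces.of_iso {X Y : DerivedCategory (GrMod 𝒜)} (e : X ≅ Y)
    (h : HasFinitePieces X) : HasFinitePieces Y where
  noeth n i := by
    have := h.noeth n i
    exact isNoetherian_of_surjective (((coh n).mapIso e).hom.app i)
      (LinearMap.range_eq_top.2 (surjective_of_epi _ i))
  low n := by
    obtain ⟨i₀, hi₀⟩ := h.low n
    refine ⟨i₀, fun i hi => ?_⟩
    have := hi₀ i hi
    exact (surjective_of_epi ((coh n).mapIso e).hom i).subsingleton
  bdd := by
    obtain ⟨b, hb⟩ := h.bdd
    exact ⟨b, fun n hn => (hb n hn).of_iso ((coh n).mapIso e).symm⟩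

section
variable {d : ℤ} (f : 𝒜 d) {X Z : DerivedCategory (GrMod 𝒜)} {p : (twD d).obj X ⟶ Z}
  {δ : Z ⟶ X⟦(1 : ℤ)⟧} (h : Triangle.mk ((mulD f).app X) p δ ∈ distTriang _)
include h

lemma IsBoundedNoeth.cone (hX : IsBoundedNoeth X) : IsBoundedNoeth Z where
  noeth n := by
    obtain ⟨α, β, h₁, -⟩ := exists_coh_cone f h n
    exact IsNoeth.of_exact α β h₁ ((hX.noeth n).tw d) (hX.noeth (n + 1))
  bdd := by
    obtain ⟨b, hb⟩ := hX.bdd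
    refine ⟨b, fun n hn => ?_⟩
    obtain ⟨α, β, h₁, -⟩ := exists_coh_cone f h n
    rw [isZero_iff]
    intro i z
    obtain ⟨y, rfl⟩ := (h₁ i z).1 ((isZero_iff _).1 (hb (n + 1) (by lia)) _ _)
    rw [(isZero_iff _).1 ((tw d).map_isZero (hb n hn)) i y, map_zero]

/-- Each cohomology module of the cone is an extension of a module killed by `f` by another such
module. -/
lemma isZero_locD_cone_self : IsZero ((locD f).obj Z) := by
  rw [isZero_locD_iff]
  intro n
  obtain ⟨α, β, h₁, h₂, h₃⟩ := exists_coh_cone f h n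
  refine isZero_loc_of_exact f α β (fun i z => (h₁ i z).1) (fun i z => ⟨1, ?_⟩) (fun i y => ⟨1, ?_⟩)
  · have h4 := (h₂ i _).2 ⟨z, rfl⟩
    have h5 : d + i = ((1 : ℕ) : ℤ) * d + i := by push_cast; ring
    refine Eq.trans (GrMod.act_congr _ _ h5 _ f (by simp) _)
      (GrMod.act_eq_zero_of_eq_zero _ _ h5 _ _ h4)
  · have h5 : d + (i + d) = ((1 : ℕ) : ℤ) * d + i + d := by push_cast; ring
    refine Eq.trans (congr_arg _ ?_) (h₃ (i + d) _ h5 y)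
    exact ((coh n).obj X).act_congr _ h5 _ f (by simp) _

lemma isZero_locD_cone {e : ℤ} (g : 𝒜 e) (hX : IsZero ((locD g).obj X)) :
    IsZero ((locD g).obj Z) := by
  rw [isZero_locD_iff] at hX ⊢
  intro n
  obtain ⟨α, β, h₁, h₂, h₃⟩ := exists_coh_cone f h n
  refine isZero_loc_of_exact g α β (fun i z => (h₁ i z).1)
    (fun i z => (isZero_loc_iff g _).1 (hX (n + 1)) i _) (fun i y => ?_)
  obtain ⟨k, hk⟩ := (isZero_loc_iff g _).1 (hX n) (i + d) y
  refine ⟨k, Eq.trans (congr_arg _ ?_) (map_zero _)⟩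
  exact ((coh n).obj X).act_eq_zero_of_eq_zero rfl (add_assoc _ i d).symm (pw g k) y hk

/-- The elements of H^(n+1)(X) killed by `f` form a quotient of H^n(Z), and every element is killed
by a power of `f`. Vanishing spreads along powers of `f`, and finiteness propagates upward in weight
because d < 0. The degree shift is why the claims are first proved for n + 1. -/
lemma HasFinitePieces.of_cone (hd : d < 0) (hX : IsZero ((locD f).obj X))
    (hZ : HasFinitePieces Z) : HasFinitePieces X := by
  rw [isZero_locD_iff] at hX
  have low (n : ℤ) : ∃ i₀ : ℤ, ∀ i < i₀, Subsingleton (((coh (n + 1)).obj X).X i) := by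
    obtain ⟨α, β, h₁, h₂, h₃⟩ := exists_coh_cone f h n
    obtain ⟨i₀, hi₀⟩ := hZ.low n
    exact ⟨i₀, eq_zero_of_surjective_torsion f β (hX _) (fun i x => (h₂ i x).1) {i | i < i₀}
      (fun i hi => by simp only [Set.mem_ofPred_eq] at hi ⊢; lia) hi₀⟩
  have noeth (n i : ℤ) : IsNoetherian R (((coh (n + 1)).obj X).X i) := by
    obtain ⟨α, β, h₁, h₂, h₃⟩ := exists_coh_cone f h n
    obtain ⟨i₀, hi₀⟩ := low n
    exact isNoetherian_of_surjective_torsion f β hd h₂ (hZ.noeth n) i₀ hi₀ i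
  have bdd : ∃ b : ℤ, ∀ n > b, IsZero ((coh (n + 1)).obj X) := by
    obtain ⟨b, hb⟩ := hZ.bdd
    refine ⟨b, fun n hn => ?_⟩
    obtain ⟨α, β, h₁, h₂, h₃⟩ := exists_coh_cone f h n
    rw [isZero_iff]
    intro i x
    have := eq_zero_of_surjective_torsion f β (hX _) (fun i x => (h₂ i x).1) Set.univ
      (fun _ _ => trivial) (fun i _ => subsingleton_of_forall_eq 0
        ((isZero_iff _).1 (hb n hn) i)) i trivial
    exact Subsingleton.elim _ _
  refine ⟨fun n => ?_, fun n => ?_, ?_⟩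
  · obtain ⟨n, rfl⟩ : ∃ m, n = m + 1 := ⟨n - 1, by ring⟩
    exact noeth n
  · obtain ⟨n, rfl⟩ : ∃ m, n = m + 1 := ⟨n - 1, by ring⟩
    exact low n
  · obtain ⟨b, hb⟩ := bdd
    refine ⟨b + 1, fun n hn => ?_⟩
    obtain ⟨n, rfl⟩ : ∃ m, n = m + 1 := ⟨n - 1, by ring⟩
    exact hb n (by lia)

end

section
variable [IsNoetherianRing A]

variable (𝒜) in
/-- The ideal `I⁻` has finitely many homogeneous generators of negative weight. -/
lemma exists_neg_generators : ∃ l : List (Σ d, 𝒜 d), (∀ f ∈ l, f.1 < 0) ∧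
    (negIdeal 𝒜).toIdeal = Ideal.span {a : A | ∃ f ∈ l, (f.2 : A) = a} := by
  obtain ⟨t, hts, ht⟩ := (Submodule.fg_span_iff_fg_span_finset_subset (R := A)
    {a | ∃ i : ℤ, i < 0 ∧ a ∈ 𝒜 i}).1 (IsNoetherian.noetherian _)
  choose d hd hd' using fun a : t => hts a.2
  refine ⟨t.attach.toList.map (fun a => ⟨d a, ⟨a, hd' a⟩⟩), ?_, ?_⟩
  · intro f hf
    obtain ⟨b, _, rfl⟩ := List.mem_map.1 hf
    exact hd b
  · refine Eq.trans ht (congr_arg (Submodule.span A) ?_)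
    ext a
    constructor
    · intro ha
      exact ⟨⟨d ⟨a, ha⟩, ⟨a, hd' ⟨a, ha⟩⟩⟩, List.mem_map.2 ⟨⟨a, ha⟩, by simp, rfl⟩, rfl⟩
    · rintro ⟨f, hf, rfl⟩
      obtain ⟨b, _, rfl⟩ := List.mem_map.1 hf
      exact b.2

variable (𝒜) in
/-- Elements of very negative weight lie in large powers of `I⁻`. -/
lemma exists_mem_negIdeal_pow (n : ℕ) :
    ∃ m : ℕ, ∀ (i : ℤ) (a : 𝒜 i), i ≤ -m → (a : A) ∈ (negIdeal 𝒜).toIdeal ^ n := by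
  obtain ⟨t, hts, ht⟩ := (Submodule.fg_span_iff_fg_span_finset_subset (R := A)
    {a | ∃ i : ℤ, i < 0 ∧ a ∈ 𝒜 i}).1 (IsNoetherian.noetherian _)
  choose d hd hd' using fun a : t => hts a.2
  -- All generators have weight at least -D, so an element of weight at most -(n + 1)D has
  -- coefficients of weight at most -nD. The extra 1 keeps D positive, so that such an element has
  -- negative weight and lies in I^-.
  let D : ℕ := 1 + ∑ k : t, (d k).natAbs
  have hD (k : t) : -d k ≤ D := by
    have := Finset.single_le_sum (f := fun k : t => (d k).natAbs) (fun _ _ => Nat.zero_le _)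
      (Finset.mem_univ k)
    simp only [D]
    lia
  refine ⟨n * D, ?_⟩
  induction n with
  | zero => simp
  | succ n ih =>
    intro i a hi
    have hi' : i ≤ -(n * D : ℕ) - D := by
      refine hi.trans (le_of_eq ?_)
      push_cast
      ring
    have hD1 : (1 : ℤ) ≤ D := by
      have : 1 ≤ D := Nat.le_add_right 1 _
      exact_mod_cast this
    have ha : (a : A) ∈ Submodule.span A (t : Set A) :=
      ht ▸ Submodule.subset_span ⟨i, by lia, a.2⟩
    obtain ⟨c, -, hc⟩ := Submodule.mem_span_finset.1 ha
    have h2 : (DirectSum.decompose 𝒜 (a : A) i : A) = a := by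
      rw [DirectSum.decompose_coe, DirectSum.of_eq_same]
    rw [← h2, ← hc, DirectSum.decompose_sum, DFinsupp.finsetSum_apply,
      AddSubmonoidClass.coe_finsetSum]
    refine Ideal.sum_mem _ fun k hk => ?_
    have := DirectSum.coe_decompose_mul_add_of_right_mem 𝒜 (i := i - d ⟨k, hk⟩) (a := c k)
      (hd' ⟨k, hk⟩)
    rw [sub_add_cancel] at this
    rw [smul_eq_mul, this, pow_succ]
    refine Ideal.mul_mem_mul (ih _ _ ?_) (Ideal.subset_span (hts hk))
    have := hD ⟨k, hk⟩
    lia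

/-- Torsion objects with Noetherian cohomology. -/
lemma IsBoundedNoeth.hasFinitePieces {X : DerivedCategory (GrMod 𝒜)} (hX : IsBoundedNoeth X)
    (h : dTor (negIdeal 𝒜) X) : HasFinitePieces X where
  noeth n i := (hX.noeth n).piece i
  low n := (hX.noeth n).exists_subsingleton fun j x => by
    obtain ⟨k, hk⟩ := h n j x
    obtain ⟨m, hm⟩ := exists_mem_negIdeal_pow 𝒜 k
    exact ⟨m, fun i a hi => hk i a (hm i a hi)⟩
  bdd := hX.bdd

lemma nonempty_lc_iso_self (I : HomogeneousIdeal 𝒜) {X : DerivedCategory (GrMod 𝒜)}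
    (h : dTor I X) : Nonempty ((localCohomology I).obj X ≅ X) :=
  nonempty_lc_iso (i := 𝟙 X) ⟨h, fun S _ => by
    convert Function.bijective_id using 1
    ext g
    exact Category.comp_id g⟩

/-- Local cohomology with respect to `I⁻` is finite in each weight. -/
lemma IsBoundedNoeth.hasFinitePieces_lc {X : DerivedCategory (GrMod 𝒜)} (hX : IsBoundedNoeth X) :
    HasFinitePieces ((localCohomology (negIdeal 𝒜)).obj X) := by
  obtain ⟨L, hL, hspan⟩ := exists_neg_generators 𝒜
  have htor : dTor (negIdeal 𝒜) = torL L := by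
    ext X
    simp only [dTor, hspan, isTorsion_span_iff, torL, isZero_locD_iff]
    exact ⟨fun h f hf n => h n f hf, fun h n f hf => h f hf n⟩
  -- Here `l` lists the generators not yet known to act nilpotently on each element of the
  -- cohomology. Taking the cone by the first one removes it; when none is left, X is torsion and
  -- equals its local cohomology.
  have key (l : List (Σ d, 𝒜 d)) (hl : ∀ f ∈ l, f ∈ L) : ∀ X : DerivedCategory (GrMod 𝒜),
      IsBoundedNoeth X → (∀ g ∈ L, g ∈ l ∨ IsZero ((locD g.2).obj X)) →
      HasFinitePieces ((localCohomology (negIdeal 𝒜)).obj X) := by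
    induction l with
    | nil =>
      intro X hX h
      have hT : dTor (negIdeal 𝒜) X := htor ▸ fun g hg => (h g hg).resolve_left (by simp)
      exact (hX.hasFinitePieces hT).of_iso (nonempty_lc_iso_self _ hT).some.symm
    | cons f l ih =>
      intro X hX h
      obtain ⟨Z, p, δ, hd⟩ := distinguished_cocone_triangle ((mulD f.2).app X)
      have hZ := ih (fun g hg => hl g (List.mem_cons_of_mem _ hg)) Z (hX.cone f.2 hd)
        (fun g hg => by
          rcases h g hg with h | h
          · rcases List.mem_cons.1 h with rfl | h
            · exact Or.inr (isZero_locD_cone_self _ hd)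
            · exact Or.inl h
          · exact Or.inr (isZero_locD_cone _ hd _ h))
      obtain ⟨p', δ', hd'⟩ := exists_lc_cone (negIdeal 𝒜) f.2 hd
      have hf := hl f List.mem_cons_self
      -- X itself need not be f-torsion, but RΓ X is, so `of_cone` applies to the triangle of local
      -- cohomology.
      have hT : torL L ((localCohomology (negIdeal 𝒜)).obj X) :=
        htor ▸ (isCoreflection_lcCounit (negIdeal 𝒜) X).prop
      exact hZ.of_cone f.2 hd' (hL f hf) (hT f hf)
  exact key L (fun _ h => h) X hX fun g hg => Or.inl hg

end

end GrMod

namespace GrMod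
open CochainComplex.HomComplex

variable {R A : Type u} [CommRing R] [CommRing A] [Algebra R A]
  {𝒜 : ℤ → Submodule R A} [GradedAlgebra 𝒜]

/-! ### Finiteness of the graded Hom complex -/

/-- Evaluation of cochains at an element. -/
def evalAt (K F : CochainComplex (GrMod 𝒜) ℤ) (n p q w : ℤ) (hpq : p + n = q)
    (x : (K.X p).X w) : homX K F n ⟶ (tw w).obj (F.X q) where
  app i :=
    { toFun := fun z => (F.X q).cst (add_comm w i)
        ((Cochain.v (z : Cochain K ((twC i).obj F) n) p q hpq).app w x)
      map_add' := fun z z' => map_add ((F.X q).cst (add_comm w i)) _ _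
      map_smul' := fun r z => map_smul ((F.X q).cst (add_comm w i)) r _ }
  comm {i j k} h a z := by
    refine (congr_arg ((F.X q).cst (add_comm w k)) (homX_act_v_app K F n h a z p q hpq w x)).trans ?_
    refine ((F.X q).cst_act (by lia : i + (w + j) = w + k) (add_comm w k) a _).trans ?_
    exact ((F.X q).act_cst (by lia : i + (j + w) = k + w) (add_comm w j) a _).symm

/-- A cochain is determined by its values on finitely many generators, so the module of cochains
embeds into a finite product of twists of terms of `F`. -/
lemma isNoeth_homX (K F : CochainComplex (GrMod 𝒜) ℤ) (a b : ℤ) [K.IsStrictlyGE a]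
    [K.IsStrictlyLE b] (hK : ∀ p, IsFG (K.X p)) (hF : ∀ q, IsNoeth (F.X q)) (n : ℤ) :
    IsNoeth (homX K F n) := by
  choose g d x hx using hK
  refine IsNoeth.of_jointly_injective (ι := Σ p : ℤ, Fin (g p))
    (fun k => (tw (d k.1 k.2)).obj (F.X (k.1 + n))) (fun k => (hF _).tw _)
    ((Finset.Icc a b).sigma fun _ => Finset.univ) _
    (fun k => evalAt K F n k.1 (k.1 + n) _ rfl (x k.1 k.2)) fun i z hz => ?_
  refine grCochain_ext (K := K) (L := (twC i).obj F) (n := n) fun p q hpq w y => ?_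
  obtain rfl := hpq
  refine Eq.trans ?_ (congr_arg (fun t : K.X p ⟶ ((twC i).obj F).X (p + n) => Hom.app t w y)
    (Cochain.zero_v p (p + n) rfl)).symm
  by_cases hp : p ∈ Finset.Icc a b
  · obtain ⟨c, rfl⟩ := hx p w y
    rw [map_sum]
    refine Finset.sum_eq_zero fun k _ => ?_
    have h0 := hz ⟨p, k⟩ (Finset.mem_sigma.2 ⟨hp, Finset.mem_univ k⟩)
    have h1 : (Cochain.v (z : Cochain K ((twC i).obj F) n) p (p + n) rfl).app (d p k) (x p k) = 0 :=
      (injective_iff_map_eq_zero _).1 ((F.X (p + n)).cst_injective _) _ h0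
    rw [hom_comm, h1, map_zero]
  · have h : IsZero (K.X p) := by
      rw [Finset.mem_Icc, not_and_or, not_le, not_le] at hp
      rcases hp with hp | hp
      · exact K.isZero_of_isStrictlyGE a p
      · exact K.isZero_of_isStrictlyLE b p
    rw [(isZero_iff _).1 h w y, map_zero]
    rfl

lemma isZero_homX (K F : CochainComplex (GrMod 𝒜) ℤ) (a b : ℤ) [K.IsStrictlyGE a]
    [F.IsStrictlyLE b] (n : ℤ) (hn : b - a < n) : IsZero (homX K F n) := by
  refine (isZero_iff _).2 fun i z => ?_
  refine grCochain_ext (K := K) (L := (twC i).obj F) (n := n) fun p q hpq w y => ?_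
  by_cases hp : p < a
  · rw [(isZero_iff _).1 (K.isZero_of_isStrictlyGE a p) w y, map_zero, map_zero]
  · exact (isZero_iff _).1 ((tw i).map_isZero (F.isZero_of_isStrictlyLE b q (by lia))) w _ |>.trans
      ((isZero_iff _).1 ((tw i).map_isZero (F.isZero_of_isStrictlyLE b q (by lia))) w _).symm

lemma IsNoeth.homology (S : ShortComplex (GrMod 𝒜)) (h : IsNoeth S.X₂) : IsNoeth S.homology := by
  have h1 : IsNoeth (ker S.g) := h.of_injective (kerι S.g) fun i => Subtype.val_injective
  exact (h1.of_surjective (leftHomologyData S).π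
    fun i => Submodule.mkQ_surjective _).of_iso (leftHomologyData S).homologyIso.symm

lemma isBoundedNoeth_Q (C : CochainComplex (GrMod 𝒜) ℤ) (h : ∀ n, IsNoeth (C.X n))
    (hb : ∃ b : ℤ, ∀ n > b, IsZero (C.X n)) : IsBoundedNoeth (DerivedCategory.Q.obj C) where
  noeth n := (IsNoeth.homology (C.sc n) (h n)).of_iso
    ((DerivedCategory.homologyFunctorFactors (GrMod 𝒜) n).app C).symm
  bdd := by
    obtain ⟨b, hb⟩ := hb
    refine ⟨b, fun n hn => IsZero.of_iso ?_
      ((DerivedCategory.homologyFunctorFactors (GrMod 𝒜) n).app C)⟩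
    exact ((C.sc n).exact_iff_isZero_homology).1 ((C.sc n).exact_of_isZero_X₂ (hb n hn))

section
variable [IsNoetherianRing R] [IsNoetherianRing A] [Module.Finite R (𝒜 0)]

lemma IsPerf.isBoundedNoeth_homObj {K F : CochainComplex (GrMod 𝒜) ℤ} (hK : IsPerf K)
    (hF : IsPerf F) : IsBoundedNoeth (DerivedCategory.Q.obj (homObj K F)) := by
  obtain ⟨a, b, _, _⟩ := hK.bounded
  obtain ⟨_, b', _, _⟩ := hF.bounded
  exact isBoundedNoeth_Q _
    (isNoeth_homX K F a b hK.isFG fun q => (hF.isFG q).isNoeth)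
    ⟨b' - a, fun n hn => isZero_homX K F a b' n hn⟩

/-- RHom(K, RΓ F) = RΓ RHom(K, F), and RHom(K, F) is represented by a complex with Noetherian terms
bounded above. -/
lemma IsPerf.hasFinitePieces {K : CochainComplex (GrMod 𝒜) ℤ} (hK : IsPerf K) [K.IsKProjective]
    {F : DerivedCategory (GrMod 𝒜)} (hF : dPerf 𝒜 F) :
    HasFinitePieces ((homD K).obj ((localCohomology (negIdeal 𝒜)).obj F)) := by
  obtain ⟨F', hF', ⟨e⟩⟩ := hF.exists_isPerf
  have h := (hK.isBoundedNoeth_homObj hF').hasFinitePieces_lc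
  have e' : DerivedCategory.Q.obj (homObj K F') ≅ (homD K).obj F :=
    (homDFactors K).symm.app F' ≪≫ (homD K).mapIso e.symm
  exact h.of_iso ((localCohomology (negIdeal 𝒜)).mapIso e' ≪≫
    (hK.nonempty_lc_iso (negIdeal 𝒜) F).some)

end

lemma HasFinitePieces.wtC_zero {C : CochainComplex (GrMod 𝒜) ℤ} {V : DerivedCategory (GrMod 𝒜)}
    (hV : HasFinitePieces V) (e : V ≅ DerivedCategory.Q.obj C) :
    (∀ n, Module.Finite R (((wtC 0).obj C).homology n)) ∧
      ∃ b : ℤ, ∀ n > b, ((wtC 0).obj C).ExactAt n := by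
  have hC := hV.of_iso e
  let ε (n : ℤ) : ((wtC 0).obj C).homology n ≅ (wt 0).obj ((coh n).obj (DerivedCategory.Q.obj C)) :=
    (C.sc n).mapHomologyIso (wt 0) ≪≫
      (wt 0).mapIso ((DerivedCategory.homologyFunctorFactors (GrMod 𝒜) n).app C).symm
  constructor
  · intro n
    have := hC.noeth n 0
    have : Module.Finite R ((wt 0).obj ((coh n).obj (DerivedCategory.Q.obj C))) :=
      inferInstanceAs (Module.Finite R (((coh n).obj (DerivedCategory.Q.obj C)).X 0))
    exact Module.Finite.equiv (ε n).symm.toLinearEquiv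
  · obtain ⟨b, hb⟩ := hC.bdd
    refine ⟨b, fun n hn => ?_⟩
    rw [HomologicalComplex.exactAt_iff_isZero_homology]
    exact ((wt 0).map_isZero (hb n hn)).of_iso (ε n)

/-- For `V` with finite pieces, maps from shifts of `A` to `V` vanish if and only if maps from
shifts of `A` to the dual of `V` do. -/
lemma HasFinitePieces.subsingleton_iff_dual [IsNoetherianRing R] {V : DerivedCategory (GrMod 𝒜)}
    (hV : HasFinitePieces V) (ω : CochainComplex (ModuleCat.{u} R) ℤ) [IsDualizingComplex ω] :
    (∀ n : ℤ, Subsingleton (selfD 𝒜 ⟶ V⟦n⟧)) ↔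
      ∀ n : ℤ, Subsingleton (selfD 𝒜 ⟶ (dualD ω).obj (op (V⟦n⟧))) := by
  obtain ⟨C, ⟨e⟩⟩ := exists_Q_iso V
  rw [subsingleton_selfD_shift_iff C V e.symm, subsingleton_selfD_dual_iff ω C V e.symm]
  obtain ⟨h₁, h₂⟩ := hV.wtC_zero e.symm
  -- One direction needs only that ω is K-injective; the converse uses finiteness and
  -- `acyclic_of_dual_eq_zero`.
  refine ⟨fun h n f => CochainComplex.IsKInjective.nonempty_homotopy_zero f fun m => ?_,
    acyclic_of_dual_eq_zero ω _ h₁ h₂⟩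
  have h3 := h (n + m)
  rw [HomologicalComplex.exactAt_iff_isZero_homology] at h3 ⊢
  exact h3.of_iso ((CochainComplex.ShiftSequence.shiftIso (ModuleCat.{u} R) n m (n + m) rfl).app _)

end GrMod

theorem corollary6p5 {R A : Type u} [CommRing R] [IsNoetherianRing R] [CommRing A]
    [IsNoetherianRing A] [Algebra R A] (𝒜 : ℤ → Submodule R A) [GradedAlgebra 𝒜]
    [Module.Finite R (𝒜 0)]
    (ω : CochainComplex (ModuleCat.{u} R) ℤ) [GrMod.IsDualizingComplex ω]
    (hΨ : Nonempty (((GrMod.localCohomology (GrMod.posIdeal 𝒜)).obj (GrMod.selfD 𝒜))⟦(1 : ℤ)⟧ ≅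
      (GrMod.dualD ω).obj (op ((GrMod.localCohomology (GrMod.negIdeal 𝒜)).obj (GrMod.selfD 𝒜)))))
    (E : ObjectProperty (DerivedCategory (GrMod 𝒜))) [E.IsTriangulated]
    (hE : E ≤ GrMod.dPerf 𝒜) :
    ((E.ι ⋙ GrMod.cech (GrMod.posIdeal 𝒜)).Full ∧
        (E.ι ⋙ GrMod.cech (GrMod.posIdeal 𝒜)).Faithful) ↔
      ((E.ι ⋙ GrMod.cech (GrMod.negIdeal 𝒜)).Full ∧
        (E.ι ⋙ GrMod.cech (GrMod.negIdeal 𝒜)).Faithful) := by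
  exact full_faithful_iff_of_key 𝒜 ω hΨ
    (fun K hK _ F hF => (hK.hasFinitePieces hF).subsingleton_iff_dual ω) E hE
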